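/- **Setting.** A loop-free Markov persuasion process consists of finite nonempty sets $X$ (states), $\Omega$ (outcomes), $A$ (actions); a partition of $X$ into layers $X_0=\{x_0\},X_1,\dots,X_L=\{x_L\}$; a prior $\mu(\cdot\mid x)\in\Delta(\Omega)$ for every state $x$; transitions $P(\cdot\mid x,\omega,a)\in\Delta(X)$ that are supported on $X_{k+1}$ when $x\in X_k$, $k<L$; and reward tables $r_{S,t},r_{R,t}:X\times\Omega\times A\to[0,1]$ of the sender and the receivers, where the pairs $(r_{S,t},r_{R,t})$ are i.i.d. over the episodes $t=1,\dots,T$ (no independence between the entries of a table is required), with means $r_S,r_R$. In episode $t$ the sender commits to a policy $\phi_t:X\times\Omega\to\Delta(A)$; then, independently of the rewards of the episode, a trajectory is drawn with $\omega_k\sim\mu(\cdot\mid x_k)$, $a_k\sim\phi_t(\cdot\mid x_k,\omega_k)$, $x_{k+1}\sim P(\cdot\mid x_k,\omega_k,a_k)$ for $k=0,\dots,L-1$. Under full feedback the sender observes the trajectory and $r_{S,t}(x_k,\omega_k,a)$, $r_{R,t}(x_k,\omega_k,a)$ for all $k<L$ and all $a\in A$. Neither $P$, $\mu$ nor the law of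 the rewards is known to the sender. **Violation.** Let $q_t(x,\omega,a)$ be the probability, under $P,\mu,\phi_t$, that $(x,\omega,a)$ is visited, and let $b^{\phi}(a,x)\in\arg\max_{b\in A}\sum_{\omega}\mu(\omega\mid x)\phi(a\mid x,\omega)r_R(x,\omega,b)$ be the receiver's best response to recommendation $a$ in state $x$, with ties broken in favor of the sender (that is, maximizing $\sum_\omega\mu(\omega\mid x)\phi(a\mid x,\omega)r_S(x,\omega,b)$). Then $$V_T:=\sum_{t=1}^T\sum_{x\in X}\sum_{\omega\in\Omega}\sum_{a\in A}q_t(x,\omega,a)\bigl(r_R(x,\omega,b^{\phi_t}(a,x))-r_R(x,\omega,a)\bigr).$$ **Algorithm (OPPS with full feedback, confidence parameter $\delta$).** Let $N_t(\cdot)$ count the episodes before $t$ in which the argument is visited, and put $$\overline P_t(x'\mid x,\omega,a)=\tfrac{N_t(x,\omega,a,x')}{\max\{1,N_t(x,\omega,a)\}},\qquad \overline\mu_t(\omega\mid x)=\tfrac{N_t(x,\omega)}{\max\{1,N_t(x)\}},$$ $$\overline r_{S,t}(x,\omega,a)=\tfrac{\sum_{\tau<t}r_{S,\tau}(x,\omega,a)\mathbb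 1_\tau\{x,\omega\}}{\max\{1,N_t(x,\omega)\}},\qquad \overline r_{R,t}(x,\omega,a)=\tfrac{\sum_{\tau<t}r_{R,\tau}(x,\omega,a)\mathbb 1_\tau\{x,\omega\}}{\max\{1,N_t(x,\omega)\}},$$ where $\mathbb 1_\tau\{x,\omega\}$ indicates that $(x,\omega)$ is visited in episode $\tau$. With $k(x)$ the index of the layer of $x$, let $$\epsilon_t(x,\omega,a)=\sqrt{\tfrac{2|X_{k(x)+1}|\ln(T|X||\Omega||A|/\delta)}{\max\{1,N_t(x,\omega,a)\}}},\quad \zeta_t(x)=\sqrt{\tfrac{2|\Omega|\ln(T|X|/\delta)}{\max\{1,N_t(x)\}}},\quad \xi_t(x,\omega)=\min\Bigl\{1,\sqrt{\tfrac{\ln(3T|X||\Omega|/\delta)}{\max\{1,N_t(x,\omega)\}}}\Bigr\}.$$ For a vector $q=(q(x,\omega,a,x'))$ indexed by $x\in X_k$, $\omega\in\Omega$, $a\in A$, $x'\in X_{k+1}$, $0\le k<L$, write $q(x,\omega,a)=\sum_{x'}q(x,\omega,a,x')$, $q(x,\omega)=\sum_a q(x,\omega,a)$, $q(x)=\sum_\omega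 q(x,\omega)$. The linear program Opt-Opt at episode $t$ maximizes $\sum_{x,\omega,a}q(x,\omega,a)\bigl(\overline r_{S,t}(x,\omega,a)+\xi_t(x,\omega)\bigr)$ over $q\ge0$ and real variables $\zeta(x,\omega)$, $\epsilon(x,\omega,a,x')$ subject to 1. $\sum_{x\in X_k}q(x)=1$ for $0\le k<L$; 2. $\sum_{x'\in X_{k-1},\,\omega,\,a}q(x',\omega,a,x)=q(x)$ for $1\le k<L$, $x\in X_k$; 3. $|q(x,\omega,a,x')-\overline P_t(x'\mid x,\omega,a)\,q(x,\omega,a)|\le\epsilon(x,\omega,a,x')$ and $\sum_{x'}\epsilon(x,\omega,a,x')\le\epsilon_t(x,\omega,a)\,q(x,\omega,a)$; 4. $|q(x,\omega)-\overline\mu_t(\omega\mid x)\,q(x)|\le\zeta(x,\omega)$ and $\sum_\omega\zeta(x,\omega)\le\zeta_t(x)\,q(x)$; 5. $\sum_{\omega}q(x,\omega,a)\bigl(\overline r_{R,t}(x,\omega,a)+\xi_t(x,\omega)-\overline r_{R,t}(x,\omega,a')+\xi_t(x,\omega)\bigr)\ge0$ for all $x\ne x_L$ and $a,a'\in A$.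 At every episode $t$ the algorithm computes an optimal solution $\widehat q_t$ of Opt-Opt and commits to $\phi_t(a\mid x,\omega)=\widehat q_t(x,\omega,a)/\widehat q_t(x,\omega)$. Ties between optimal solutions, the values of $\phi_t(\cdot\mid x,\omega)$ where $\widehat q_t(x,\omega)=0$, and $\phi_t$ in episodes where Opt-Opt is infeasible are chosen by an arbitrary rule, subject to $\phi_t$ being a measurable function of the feedback from episodes $1,\dots,t-1$. **Theorem.** There is a universal constant $C>0$ such that for every such process, every $T$, every $\delta\in(0,1)$ and every such choice rule, OPPS with full feedback satisfies, with probability at least $1-7\delta$, $$V_T\le C\,L^2|X|\sqrt{T|A||\Omega|\ln\!\Bigl(\frac{T|X||\Omega||A|}{\delta}\Bigr)},$$ and also, with probability at least $1-7\delta$, $$V_T\le C\,L^2|X|\sqrt{T|A||\Omega|\ln(1/\delta)}\;\sqrt{1+\ln(T|X||\Omega||A|)}.$$ That is, $V_T\le\widetilde{\mathcal O}\bigl(L^2|X|\sqrt{T|A||\Omega|\ln(1/\delta)}\bigr)$. (For $T=0$ we have $V_T=0$, and the bounds are read as $0$.) -/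

import Mathlib

open MeasureTheory ProbabilityTheory

namespace Persuasion

/-- The partition of a finite state space `X` into layers `X_0, …, X_L`, where `X_0 = {x_0}` and
`X_L = {x_L}`. It is known to the learner. -/
structure Layers (X : Type*) (L : ℕ) where
  /-- the index of the layer that contains a state -/
  layer : X → Fin (L + 1)
  /-- the initial state `x_0` -/
  init : X
  /-- the final state `x_L` -/
  final : X
  layer_eq_zero_iff : ∀ x, layer x = 0 ↔ x = init
  layer_eq_last_iff : ∀ x, layer x = Fin.last L ↔ x = final

namespace Layers

variable {X : Type*} {L : ℕ} [Fintype X]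

/-- The layer `X_k`. -/
def layerSet (S : Layers X L) (k : ℕ) : Finset X :=
  Finset.univ.filter fun x => (S.layer x : ℕ) = k

/-- The layer that follows the one of `x`, namely `X_{k(x)+1}` (empty for the final state). -/
def next (S : Layers X L) (x : X) : Finset X :=
  Finset.univ.filter fun x' => (S.layer x' : ℕ) = (S.layer x : ℕ) + 1

/-- The layer that precedes the one of `x`, namely `X_{k(x)-1}` (empty for the initial state). -/
def prev (S : Layers X L) (x : X) : Finset X :=
  Finset.univ.filter fun x' => (S.layer x' : ℕ) + 1 = (S.layer x : ℕ)

end Layers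

/-- A table of rewards, one number in `[0,1]` for every triplet `(x, ω, a)`. -/
abbrev RewardTable (X Ω A : Type*) := X → Ω → A → unitInterval

instance {X Ω A : Type*} : MeasurableSpace (RewardTable X Ω A) := MeasurableSpace.pi

/-- A direct signaling policy: `φ x ω` is the distribution `φ(· | x, ω)` of the recommended
action. -/
abbrev Policy (X Ω A : Type*) [Fintype A] := X → Ω → stdSimplex ℝ A

/-- The trajectory `x_0, ω_0, a_0, x_1, …, ω_{L-1}, a_{L-1}, x_L` of an episode. -/
@[ext] structure Trajectory (X Ω A : Type*) (L : ℕ) where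
  state : Fin (L + 1) → X
  outcome : Fin L → Ω
  action : Fin L → A

namespace Trajectory

variable {X Ω A : Type*} {L : ℕ}

/-- A trajectory as a triple of functions. -/
def equivProd :
    Trajectory X Ω A L ≃ (Fin (L + 1) → X) × (Fin L → Ω) × (Fin L → A) where
  toFun τ := (τ.state, τ.outcome, τ.action)
  invFun p := ⟨p.1, p.2.1, p.2.2⟩
  left_inv _ := rfl
  right_inv _ := rfl

open Classical in
noncomputable instance [Fintype X] [Fintype Ω] [Fintype A] : Fintype (Trajectory X Ω A L) :=
  Fintype.ofEquiv _ equivProd.symm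

instance : MeasurableSpace (Trajectory X Ω A L) := ⊤

instance : DiscreteMeasurableSpace (Trajectory X Ω A L) := ⟨fun _ => trivial⟩

/-- The trajectory visits `x`. -/
def VisitsState (τ : Trajectory X Ω A L) (x : X) : Prop :=
  ∃ k : Fin L, τ.state k.castSucc = x

/-- The trajectory visits `(x, ω)`. -/
def VisitsOutcome (τ : Trajectory X Ω A L) (x : X) (ω : Ω) : Prop :=
  ∃ k : Fin L, τ.state k.castSucc = x ∧ τ.outcome k = ω

/-- The trajectory visits `(x, ω, a)`. -/
def VisitsAction (τ : Trajectory X Ω A L) (x : X) (ω : Ω) (a : A) : Prop :=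
  ∃ k : Fin L, τ.state k.castSucc = x ∧ τ.outcome k = ω ∧ τ.action k = a

/-- The trajectory visits `(x, ω, a, x')`. -/
def VisitsStep (τ : Trajectory X Ω A L) (x : X) (ω : Ω) (a : A) (x' : X) : Prop :=
  ∃ k : Fin L, τ.state k.castSucc = x ∧ τ.outcome k = ω ∧ τ.action k = a ∧ τ.state k.succ = x'

end Trajectory

/-- Everything that happens in an episode: the trajectory, the sender's rewards `r_{S,t}`, and the
receivers' rewards `r_{R,t}`. -/
abbrev Episode (X Ω A : Type*) (L : ℕ) :=
  Trajectory X Ω A L × RewardTable X Ω A × RewardTable X Ω A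

instance {X Ω A : Type*} {L : ℕ} : MeasurableSpace (Episode X Ω A L) := Prod.instMeasurableSpace

/-- What the sender observes of an episode under full feedback: the trajectory, and, for every
`k < L` and every action `a` (recommended or not), the sender's reward `r_{S,t}(x_k, ω_k, a)` and
the receivers' reward `r_{R,t}(x_k, ω_k, a)`. -/
abbrev Feedback (X Ω A : Type*) (L : ℕ) :=
  Trajectory X Ω A L × (Fin L → A → unitInterval) × (Fin L → A → unitInterval)

instance {X Ω A : Type*} {L : ℕ} : MeasurableSpace (Feedback X Ω A L) := Prod.instMeasurableSpace

/-- The full feedback of an episode. -/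
def observe {X Ω A : Type*} {L : ℕ} (e : Episode X Ω A L) : Feedback X Ω A L :=
  (e.1, fun k a => e.2.1 (e.1.state k.castSucc) (e.1.outcome k) a,
    fun k a => e.2.2 (e.1.state k.castSucc) (e.1.outcome k) a)

section Estimators

variable {X Ω A : Type*} {L n : ℕ}

open Classical in
/-- `N_t(x)`, after `n = t - 1` episodes with feedback `h`. -/
noncomputable def countState (h : Fin n → Feedback X Ω A L) (x : X) : ℕ :=
  (Finset.univ.filter fun i => (h i).1.VisitsState x).card

open Classical in
/-- `N_t(x, ω)`. -/
noncomputable def countOutcome (h : Fin n → Feedback X Ω A L) (x : X) (ω : Ω) : ℕ :=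
  (Finset.univ.filter fun i => (h i).1.VisitsOutcome x ω).card

open Classical in
/-- `N_t(x, ω, a)`. -/
noncomputable def countAction (h : Fin n → Feedback X Ω A L) (x : X) (ω : Ω) (a : A) : ℕ :=
  (Finset.univ.filter fun i => (h i).1.VisitsAction x ω a).card

open Classical in
/-- `N_t(x, ω, a, x')`. -/
noncomputable def countStep (h : Fin n → Feedback X Ω A L) (x : X) (ω : Ω) (a : A) (x' : X) : ℕ :=
  (Finset.univ.filter fun i => (h i).1.VisitsStep x ω a x').card

/-- The estimated transition probability of `x'` given `(x, ω, a)`. -/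
noncomputable def transEst (h : Fin n → Feedback X Ω A L) (x : X) (ω : Ω) (a : A) (x' : X) : ℝ :=
  (countStep h x ω a x' : ℝ) / max 1 (countAction h x ω a : ℝ)

/-- The estimated prior probability of `ω` at `x`. -/
noncomputable def priorEst (h : Fin n → Feedback X Ω A L) (x : X) (ω : Ω) : ℝ :=
  (countOutcome h x ω : ℝ) / max 1 (countState h x : ℝ)

open Classical in
/-- The empirical mean of the observed rewards of `(x, ω, a)`, where `r i k a` is the reward that
was observed for action `a` in step `k` of episode `i`. Under full feedback there is one such
observation for every visit to `(x, ω)`. -/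
noncomputable def rewardEst (h : Fin n → Feedback X Ω A L) (r : Fin n → Fin L → A → unitInterval)
    (x : X) (ω : Ω) (a : A) : ℝ :=
  (∑ i, ∑ k, if (h i).1.state k.castSucc = x ∧ (h i).1.outcome k = ω then (r i k a : ℝ) else 0) /
    max 1 (countOutcome h x ω : ℝ)

/-- The estimated sender's reward. -/
noncomputable def senderEst (h : Fin n → Feedback X Ω A L) : X → Ω → A → ℝ :=
  rewardEst h fun i => (h i).2.1

/-- The estimated receivers' reward. -/
noncomputable def receiverEst (h : Fin n → Feedback X Ω A L) : X → Ω → A → ℝ :=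
  rewardEst h fun i => (h i).2.2

variable [Fintype X] [Fintype Ω] [Fintype A]

/-- The confidence bound `ε_t(x, ω, a)` for transitions. -/
noncomputable def transBound (S : Layers X L) (T : ℕ) (δ : ℝ) (h : Fin n → Feedback X Ω A L)
    (x : X) (ω : Ω) (a : A) : ℝ :=
  √(2 * ((S.next x).card : ℝ) *
      Real.log ((T : ℝ) * Fintype.card X * Fintype.card Ω * Fintype.card A / δ) /
    max 1 (countAction h x ω a : ℝ))

/-- The confidence bound `ζ_t(x)` for priors. -/
noncomputable def priorBound (T : ℕ) (δ : ℝ) (h : Fin n → Feedback X Ω A L) (x : X) : ℝ :=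
  √(2 * (Fintype.card Ω : ℝ) * Real.log ((T : ℝ) * Fintype.card X / δ) /
    max 1 (countState h x : ℝ))

/-- The confidence bounds `ξ_{S,t}(x, ω, a) = ξ_{R,t}(x, ω, a)` for rewards under full feedback.
They do not depend on `a`. -/
noncomputable def rewardBound (T : ℕ) (δ : ℝ) (h : Fin n → Feedback X Ω A L) (x : X) (ω : Ω) : ℝ :=
  min 1 (√(Real.log (3 * (T : ℝ) * Fintype.card X * Fintype.card Ω / δ) /
    max 1 (countOutcome h x ω : ℝ)))

end Estimators

section OptOpt

variable {X Ω A : Type*} [Fintype X] [Fintype Ω] [Fintype A] {L n : ℕ}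

/-- `q(x, ω, a)`, the sum of `q(x, ω, a, x')` over the next layer. -/
def occAction (S : Layers X L) (q : X → Ω → A → X → ℝ) (x : X) (ω : Ω) (a : A) : ℝ :=
  ∑ x' ∈ S.next x, q x ω a x'

/-- `q(x, ω)`. -/
def occOutcome (S : Layers X L) (q : X → Ω → A → X → ℝ) (x : X) (ω : Ω) : ℝ :=
  ∑ a, occAction S q x ω a

/-- `q(x)`. -/
def occState (S : Layers X L) (q : X → Ω → A → X → ℝ) (x : X) : ℝ :=
  ∑ ω, occOutcome S q x ω

/-- The constraints of the linear program `Opt-Opt` after the feedback `h`, in the variables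
`q(x, ω, a, x')`, `ζ(x, ω)`, `ε(x, ω, a, x')`, where `x` lies in a layer `X_k` with `k < L` and
`x'` lies in `X_{k+1}` (other entries of `q`, `ζ`, `ε` are never read). -/
structure OptOptFeasible (S : Layers X L) (T : ℕ) (δ : ℝ) (h : Fin n → Feedback X Ω A L)
    (q : X → Ω → A → X → ℝ) (ζ : X → Ω → ℝ) (ε : X → Ω → A → X → ℝ) : Prop where
  mass : ∀ k : ℕ, k < L → ∑ x ∈ S.layerSet k, ∑ ω, ∑ a, ∑ x' ∈ S.next x, q x ω a x' = 1
  flow : ∀ x, S.layer x ≠ 0 → S.layer x ≠ Fin.last L →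
    ∑ x' ∈ S.prev x, ∑ ω, ∑ a, q x' ω a x = ∑ ω, ∑ a, ∑ x' ∈ S.next x, q x ω a x'
  trans_upper : ∀ x, S.layer x ≠ Fin.last L → ∀ ω a, ∀ x' ∈ S.next x,
    q x ω a x' - transEst h x ω a x' * ∑ x'' ∈ S.next x, q x ω a x'' ≤ ε x ω a x'
  trans_lower : ∀ x, S.layer x ≠ Fin.last L → ∀ ω a, ∀ x' ∈ S.next x,
    transEst h x ω a x' * ∑ x'' ∈ S.next x, q x ω a x'' - q x ω a x' ≤ ε x ω a x'
  trans_total : ∀ x, S.layer x ≠ Fin.last L → ∀ ω a,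
    ∑ x' ∈ S.next x, ε x ω a x' ≤ transBound S T δ h x ω a * ∑ x' ∈ S.next x, q x ω a x'
  prior_upper : ∀ x, S.layer x ≠ Fin.last L → ∀ ω,
    occOutcome S q x ω - priorEst h x ω * ∑ ω', occOutcome S q x ω' ≤ ζ x ω
  prior_lower : ∀ x, S.layer x ≠ Fin.last L → ∀ ω,
    priorEst h x ω * ∑ ω', occOutcome S q x ω' - occOutcome S q x ω ≤ ζ x ω
  prior_total : ∀ x, S.layer x ≠ Fin.last L →
    ∑ ω, ζ x ω ≤ priorBound T δ h x * ∑ ω, occOutcome S q x ω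
  incentive : ∀ x, S.layer x ≠ Fin.last L → ∀ a a',
    0 ≤ ∑ ω, ∑ x' ∈ S.next x, q x ω a x' *
      (receiverEst h x ω a + rewardBound T δ h x ω
        - receiverEst h x ω a' + rewardBound T δ h x ω)
  nonneg : ∀ x, S.layer x ≠ Fin.last L → ∀ ω a, ∀ x' ∈ S.next x, 0 ≤ q x ω a x'

/-- The objective of `Opt-Opt`. -/
noncomputable def optOptObjective (S : Layers X L) (T : ℕ) (δ : ℝ)
    (h : Fin n → Feedback X Ω A L) (q : X → Ω → A → X → ℝ) : ℝ :=
  ∑ x, ∑ ω, ∑ a, ∑ x' ∈ S.next x, q x ω a x' * (senderEst h x ω a + rewardBound T δ h x ω)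

/-- `q` is the occupancy part of an optimal solution of `Opt-Opt`. -/
def OptOptOptimal (S : Layers X L) (T : ℕ) (δ : ℝ) (h : Fin n → Feedback X Ω A L)
    (q : X → Ω → A → X → ℝ) : Prop :=
  (∃ ζ ε, OptOptFeasible S T δ h q ζ ε) ∧
    ∀ q' ζ' ε', OptOptFeasible S T δ h q' ζ' ε' →
      optOptObjective S T δ h q' ≤ optOptObjective S T δ h q

/-- `φ = φ^q`, that is, `φ(a | x, ω) = q(x, ω, a) / q(x, ω)`. Where the quotient is `0 / 0`, the
distribution `φ(· | x, ω)` is arbitrary. -/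
def InducedBy (S : Layers X L) (q : X → Ω → A → X → ℝ) (φ : Policy X Ω A) : Prop :=
  ∀ x, S.layer x ≠ Fin.last L → ∀ ω, occOutcome S q x ω ≠ 0 →
    ∀ a, φ x ω a = occAction S q x ω a / occOutcome S q x ω

end OptOpt

/-- A (deterministic) learning algorithm under full feedback: the policy for the next episode is a
measurable function of the feedback from the previous ones. -/
structure Algorithm (X Ω A : Type*) [Fintype A] (L : ℕ) where
  policy : (n : ℕ) → (Fin n → Feedback X Ω A L) → Policy X Ω A
  measurable_policy : ∀ n, Measurable (policy n)

/-- The algorithm is an instance of `OPPS` with full feedback, for `T` episodes and confidence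
parameter `δ`: in every episode it commits to the policy that some optimal solution of `Opt-Opt`
induces. Ties between optimal solutions are broken arbitrarily, and the policy is arbitrary in
an episode where `Opt-Opt` is infeasible. -/
def Algorithm.IsOPPS {X Ω A : Type*} [Fintype X] [Fintype Ω] [Fintype A] {L : ℕ}
    (alg : Algorithm X Ω A L) (S : Layers X L) (T : ℕ) (δ : ℝ) : Prop :=
  ∀ n < T, ∀ h : Fin n → Feedback X Ω A L,
    (∃ q ζ ε, OptOptFeasible S T δ h q ζ ε) →
      ∃ q, OptOptOptimal S T δ h q ∧ InducedBy S q (alg.policy n h)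

/-- An episodic loop-free Markov persuasion process with layers `S`, outcomes `Ω` and actions `A`.
The values of `prior` and `trans` at the final state are never used. -/
structure MPP {X : Type*} {L : ℕ} [Fintype X] (S : Layers X L) (Ω A : Type*) [Fintype Ω] where
  /-- `μ(· | x)` -/
  prior : X → stdSimplex ℝ Ω
  /-- `P(· | x, ω, a)` -/
  trans : X → Ω → A → stdSimplex ℝ X
  loopFree : ∀ x, S.layer x ≠ Fin.last L → ∀ ω a x', 0 < trans x ω a x' → x' ∈ S.next x
  /-- The law of the pair `(r_{S,t}, r_{R,t})` of reward tables of an episode. The distributions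
  `ν_S(x, ω, a)` and `ν_R(x, ω, a)` are its marginals; different entries may be dependent. -/
  rewardLaw : ProbabilityMeasure (RewardTable X Ω A × RewardTable X Ω A)

namespace MPP

variable {X Ω A : Type*} [Fintype X] [Fintype Ω] [Fintype A] {L : ℕ} {S : Layers X L}

/-- The mean sender's reward `r_S(x, ω, a)`. -/
noncomputable def senderMean (M : MPP S Ω A) (x : X) (ω : Ω) (a : A) : ℝ :=
  ∫ r, (r.1 x ω a : ℝ) ∂(M.rewardLaw : Measure (RewardTable X Ω A × RewardTable X Ω A))

/-- The mean receivers' reward `r_R(x, ω, a)`. -/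
noncomputable def receiverMean (M : MPP S Ω A) (x : X) (ω : Ω) (a : A) : ℝ :=
  ∫ r, (r.2 x ω a : ℝ) ∂(M.rewardLaw : Measure (RewardTable X Ω A × RewardTable X Ω A))

open Classical in
/-- The probability of a trajectory when the sender commits to `φ` and receivers follow the
recommendations. -/
noncomputable def trajProb (M : MPP S Ω A) (φ : Policy X Ω A) (τ : Trajectory X Ω A L) : ℝ :=
  (if τ.state 0 = S.init then 1 else 0) *
    ∏ k : Fin L, M.prior (τ.state k.castSucc) (τ.outcome k) *
      φ (τ.state k.castSucc) (τ.outcome k) (τ.action k) *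
      M.trans (τ.state k.castSucc) (τ.outcome k) (τ.action k) (τ.state k.succ)

open Classical in
/-- The occupancy measure `q^{P,φ,μ}`: for `x ∈ X_k` with `k < L`, the probability that
`(x_k, ω_k, a_k, x_{k+1}) = (x, ω, a, x')`. -/
noncomputable def occupancy (M : MPP S Ω A) (φ : Policy X Ω A) (x : X) (ω : Ω) (a : A) (x' : X) :
    ℝ :=
  ∑ τ : Trajectory X Ω A L, if ∃ k : Fin L, (k : ℕ) = (S.layer x : ℕ) ∧
      τ.state k.castSucc = x ∧ τ.outcome k = ω ∧ τ.action k = a ∧ τ.state k.succ = x'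
    then M.trajProb φ τ else 0

/-- The law of the trajectory of an episode with policy `φ`. -/
noncomputable def trajLaw (M : MPP S Ω A) (φ : Policy X Ω A) : Measure (Trajectory X Ω A L) :=
  ∑ τ, ENNReal.ofReal (M.trajProb φ τ) • Measure.dirac τ

/-- The law of an episode with policy `φ`: the rewards are sampled independently of the
trajectory. -/
noncomputable def episodeLaw (M : MPP S Ω A) (φ : Policy X Ω A) : Measure (Episode X Ω A L) :=
  (M.trajLaw φ).prod (M.rewardLaw : Measure (RewardTable X Ω A × RewardTable X Ω A))

/-- The policy `φ_t` (with `t = n + 1`) to which the algorithm commits after `n` episodes. -/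
def policyAfter (alg : Algorithm X Ω A L) {n : ℕ} (w : Fin n → Episode X Ω A L) : Policy X Ω A :=
  alg.policy n fun i => observe (w i)

/-- The joint law of the first `n` episodes: given the first `n`, the next one follows the law of
an episode with the policy that the algorithm chooses from the feedback received so far. -/
noncomputable def interactionLaw (M : MPP S Ω A) (alg : Algorithm X Ω A L) :
    (n : ℕ) → Measure (Fin n → Episode X Ω A L)
  | 0 => Measure.dirac Fin.elim0
  | n + 1 => (M.interactionLaw alg n).bind fun w =>
      (M.episodeLaw (policyAfter alg w)).map fun e => Fin.snoc (α := fun _ => Episode X Ω A L) w e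

-- The laws above are probability measures, and the law of an episode depends measurably on the
-- past, so that `Measure.bind` has its intended meaning.

open Classical in
theorem sum_path (μ : X → stdSimplex ℝ Ω) (φ : Policy X Ω A) (P : X → Ω → A → stdSimplex ℝ X) (n : ℕ) :
   ∀ x0 : X, (∑ s : Fin (n+1) → X, ∑ o : Fin n → Ω, ∑ a : Fin n → A, (if s 0 = x0 then (1:ℝ) else 0) *
    ∏ k : Fin n, μ (s k.castSucc) (o k) * φ (s k.castSucc) (o k) (a k) * P (s k.castSucc) (o k) (a k) (s k.succ)) = 1 := by
  induction n with
  | zero =>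
    intro x0
    rw [← (Equiv.funUnique (Fin 1) X).symm.sum_comp]
    simp
  | succ n ih =>
    intro x0
    have h0 : ∀ (x : X), ∑ o, μ x o = 1 := fun x => (μ x).2.2
    have h1 : ∀ x o, ∑ a, φ x o a = 1 := fun x o => (φ x o).2.2
    have h2 : ∀ x o a, ∑ y, P x o a y = 1 := fun x o a => (P x o a).2.2
    rw [← (Fin.consEquiv (fun _ : Fin (n+2) => X)).sum_comp, Fintype.sum_prod_type]
    simp_rw [← (Fin.consEquiv (fun _ : Fin (n+1) => Ω)).sum_comp, ← (Fin.consEquiv (fun _ : Fin (n+1) => A)).sum_comp, Fintype.sum_prod_type]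
    simp only [Fin.consEquiv_apply, Fin.prod_univ_succ, Fin.cons_zero, Fin.castSucc_zero, Fin.cons_succ, ← Fin.succ_castSucc]
    rw [Finset.sum_eq_single x0 (by intro b _ hb; simp [hb]) (by simp)]
    simp only [if_true, one_mul]
    calc _ = ∑ o0, ∑ a0, ∑ y, μ x0 o0 * φ x0 o0 a0 * P x0 o0 a0 y * (∑ s : Fin (n+1) → X, ∑ o : Fin n → Ω, ∑ a : Fin n → A, (if s 0 = y then (1:ℝ) else 0) *
    ∏ k : Fin n, μ (s k.castSucc) (o k) * φ (s k.castSucc) (o k) (a k) * P (s k.castSucc) (o k) (a k) (s k.succ)) := by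
          rw [Finset.sum_comm]
          refine Finset.sum_congr rfl fun o0 _ => ?_
          simp only [Finset.mul_sum]
          simp_rw [Finset.sum_comm (s := (Finset.univ : Finset (Fin n → Ω))) (t := (Finset.univ : Finset A))]
          rw [Finset.sum_comm]
          refine Finset.sum_congr rfl fun a0 _ => ?_
          rw [Finset.sum_comm (s := (Finset.univ : Finset X))]
          refine Finset.sum_congr rfl fun s _ => ?_
          rw [Finset.sum_comm (s := (Finset.univ : Finset X))]
          refine Finset.sum_congr rfl fun o _ => ?_
          rw [Finset.sum_comm (s := (Finset.univ : Finset X))]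
          refine Finset.sum_congr rfl fun a _ => ?_
          simp
      _ = 1 := by
          simp only [ih, mul_one]
          simp only [← Finset.mul_sum, mul_one, h0, h1, h2]

theorem trajProb_nonneg (M : MPP S Ω A) (φ : Policy X Ω A) (τ : Trajectory X Ω A L) :
    0 ≤ M.trajProb φ τ := by
  unfold trajProb
  refine mul_nonneg (by split_ifs <;> simp) (Finset.prod_nonneg fun k _ => ?_)
  exact mul_nonneg (mul_nonneg ((M.prior _).2.1 _) ((φ _ _).2.1 _)) ((M.trans _ _ _).2.1 _)

theorem sum_trajProb (M : MPP S Ω A) (φ : Policy X Ω A) : ∑ τ, M.trajProb φ τ = 1 := by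
  classical
  rw [← sum_path M.prior φ M.trans L S.init, ← Trajectory.equivProd.symm.sum_comp,
    Fintype.sum_prod_type]
  simp_rw [Fintype.sum_prod_type]
  rfl

instance (M : MPP S Ω A) (φ : Policy X Ω A) : IsProbabilityMeasure (M.trajLaw φ) := ⟨by
  simp [trajLaw, ← ENNReal.ofReal_sum_of_nonneg (fun τ _ => M.trajProb_nonneg φ τ), sum_trajProb]⟩

instance (M : MPP S Ω A) (φ : Policy X Ω A) : IsProbabilityMeasure (M.episodeLaw φ) := by
  unfold episodeLaw; infer_instance

theorem measurable_trajProb (M : MPP S Ω A) (τ : Trajectory X Ω A L) :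
    Measurable fun φ => M.trajProb φ τ := by
  unfold trajProb
  have : ∀ x o a, Measurable fun φ : Policy X Ω A => φ x o a := fun x o a =>
    (measurable_pi_apply a).comp (measurable_subtype_coe.comp
      ((measurable_pi_apply o).comp (measurable_pi_apply x)))
  exact measurable_const.mul (Finset.measurable_fun_prod _ fun k _ =>
    (measurable_const.mul (this _ _ _)).mul measurable_const)

theorem measurable_trajLaw (M : MPP S Ω A) : Measurable M.trajLaw := by
  refine Measure.measurable_of_measurable_coe _ fun s hs => ?_
  simp only [trajLaw, Measure.finsetSum_apply, Measure.smul_apply, smul_eq_mul]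
  have := M.measurable_trajProb
  fun_prop

theorem measurable_observe : Measurable (observe : Episode X Ω A L → Feedback X Ω A L) := by
  refine measurable_from_prod_countable_right fun τ => ?_
  have h : ∀ x o (a : A), Measurable fun r : RewardTable X Ω A => r x o a := fun x o a =>
    (measurable_pi_apply a).comp ((measurable_pi_apply o).comp (measurable_pi_apply x))
  refine measurable_const.prodMk (Measurable.prodMk ?_ ?_)
  · exact measurable_pi_lambda _ fun k => measurable_pi_lambda _ fun a =>
      (h (τ.state k.castSucc) (τ.outcome k) a).comp measurable_fst
  · exact measurable_pi_lambda _ fun k => measurable_pi_lambda _ fun a =>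
      (h (τ.state k.castSucc) (τ.outcome k) a).comp measurable_snd

theorem measurable_policyAfter (alg : Algorithm X Ω A L) (n : ℕ) :
    Measurable (policyAfter alg : (Fin n → Episode X Ω A L) → _) := by
  have := measurable_observe (X := X) (Ω := Ω) (A := A) (L := L)
  exact (alg.measurable_policy n).comp (by fun_prop)

theorem measurable_episodeLaw (M : MPP S Ω A) : Measurable M.episodeLaw := by
  let κ : Kernel (Policy X Ω A) (Trajectory X Ω A L) := ⟨M.trajLaw, M.measurable_trajLaw⟩
  have : IsMarkovKernel κ := ⟨fun φ => inferInstanceAs (IsProbabilityMeasure (M.trajLaw φ))⟩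
  convert (κ ×ₖ Kernel.const _ (M.rewardLaw : Measure (RewardTable X Ω A × RewardTable X Ω A))).measurable using 1
  ext1 φ
  rw [Kernel.prod_apply]; rfl

theorem measurable_snoc (n : ℕ) : Measurable fun p : (Fin n → Episode X Ω A L) × Episode X Ω A L =>
    Fin.snoc (α := fun _ => Episode X Ω A L) p.1 p.2 := by
  refine measurable_pi_lambda _ fun i => ?_
  refine Fin.lastCases ?_ (fun j => ?_) i
  · simpa using measurable_snd
  · simpa [Function.comp_def] using (measurable_pi_apply j).comp (measurable_fst (α := Fin n → Episode X Ω A L) (β := Episode X Ω A L))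

theorem measurable_step (M : MPP S Ω A) (alg : Algorithm X Ω A L) (n : ℕ) :
    Measurable fun w : Fin n → Episode X Ω A L => (M.episodeLaw (policyAfter alg w)).map fun e => Fin.snoc (α := fun _ => Episode X Ω A L) w e := by
  let κ : Kernel (Fin n → Episode X Ω A L) (Episode X Ω A L) :=
    ⟨fun w => M.episodeLaw (policyAfter alg w), M.measurable_episodeLaw.comp (measurable_policyAfter alg n)⟩
  have : IsMarkovKernel κ := ⟨fun w => inferInstanceAs (IsProbabilityMeasure (M.episodeLaw _))⟩
  convert ((Kernel.id ×ₖ κ).map (fun p : (Fin n → Episode X Ω A L) × Episode X Ω A L =>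
    Fin.snoc (α := fun _ => Episode X Ω A L) p.1 p.2)).measurable using 1
  ext1 w
  rw [Kernel.map_apply _ (measurable_snoc n), Kernel.prod_apply, Kernel.id_apply, Measure.dirac_prod,
    Measure.map_map (measurable_snoc n) (by fun_prop)]
  rfl

instance (M : MPP S Ω A) (alg : Algorithm X Ω A L) (n : ℕ) :
    IsProbabilityMeasure (M.interactionLaw alg n) := by
  induction n with
  | zero => unfold interactionLaw; infer_instance
  | succ n ih =>
    constructor
    rw [interactionLaw, Measure.bind_apply .univ (M.measurable_step alg n).aemeasurable]
    have : ∀ w : Fin n → Episode X Ω A L, (M.episodeLaw (policyAfter alg w)).map (fun e => Fin.snoc (α := fun _ => Episode X Ω A L) w e) Set.univ = 1 := by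
      intro w
      have hm : Measurable fun e => Fin.snoc (α := fun _ => Episode X Ω A L) w e :=
        (measurable_snoc n).comp (by fun_prop : Measurable fun e => (w, e))
      rw [Measure.map_apply hm .univ]
      simp
    simp [this]

/-- The (unnormalized) expected reward of a receiver who plays `b` at `x` after the
recommendation `a`. -/
noncomputable def receiverValue (M : MPP S Ω A) (φ : Policy X Ω A) (a : A) (x : X) (b : A) : ℝ :=
  ∑ ω, M.prior x ω * φ x ω a * M.receiverMean x ω b

/-- The (unnormalized) expected reward of the sender when `b` is played at `x` after the
recommendation `a`. -/
noncomputable def senderValue (M : MPP S Ω A) (φ : Policy X Ω A) (a : A) (x : X) (b : A) : ℝ :=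
  ∑ ω, M.prior x ω * φ x ω a * M.senderMean x ω b

theorem exists_bestResponse [Nonempty A] (M : MPP S Ω A) (φ : Policy X Ω A) (a : A) (x : X) :
    ∃ b, (∀ b', M.receiverValue φ a x b' ≤ M.receiverValue φ a x b) ∧
      ∀ b', (∀ b'', M.receiverValue φ a x b'' ≤ M.receiverValue φ a x b') →
        M.senderValue φ a x b' ≤ M.senderValue φ a x b := by
  classical
  obtain ⟨b₀, hb₀⟩ := Finite.exists_max (M.receiverValue φ a x)
  obtain ⟨b, hb, hmax⟩ := Finset.exists_max_image
    (Finset.univ.filter fun b => ∀ b', M.receiverValue φ a x b' ≤ M.receiverValue φ a x b)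
    (M.senderValue φ a x) ⟨b₀, by simpa using hb₀⟩
  exact ⟨b, by simpa using hb, fun b' hb' => hmax b' (by simpa using hb')⟩

/-- The best response `b^φ(a, x)`: a maximizer of the receiver's expected reward, with ties
broken in favor of the sender. -/
noncomputable def bestResponse [Nonempty A] (M : MPP S Ω A) (φ : Policy X Ω A) (a : A) (x : X) :
    A :=
  (M.exists_bestResponse φ a x).choose

/-- The cumulative violation `V_T` on the realization `w` of the `T` episodes. -/
noncomputable def violation [Nonempty A] (M : MPP S Ω A) (alg : Algorithm X Ω A L) (T : ℕ)
    (w : Fin T → Episode X Ω A L) : ℝ :=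
  ∑ t : Fin T,
    let φ := policyAfter alg fun i : Fin t => w (i.castLE t.isLt.le)
    ∑ x, ∑ ω, ∑ a, occAction S (M.occupancy φ) x ω a *
      (M.receiverMean x ω (M.bestResponse φ a x) - M.receiverMean x ω a)

end MPP

end Persuasion

/-!
The constant is `C = 126`. The proof has a deterministic part, about a single episode, and a
probabilistic part.

*One episode.* Suppose that the estimates of the transitions, of the prior and of the receivers'
rewards are within their confidence bounds (`MPP.Accurate`). Then `Opt-Opt` is feasible
(`MPP.Accurate.exists_feasible`): the true occupancy of the policy that reveals nothing, and
recommends a best action under the prior, satisfies all constraints. So the algorithm plays the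
policy `φ` induced by a feasible `q`. Such a `q` is the occupancy of `φ` in a surrogate process,
whose prior and transitions are within twice the confidence bounds of the true ones in the `ℓ¹` norm
(`MPP.priorOf`, `MPP.transOf`). Comparison of the two flows layer by layer
(`sum_abs_flow_sub_le`) bounds the distance between `q` and the true occupancy; every discrepancy
persists through at most `L` layers. At a state which `q` visits, the incentive constraints bound
the gain of any deviation under the surrogate prior, hence under the true one (`MPP.sum_gain_le`).
At a state which `q` does not visit, the gain is at most the probability to reach it, which is part of
the distance between the occupancies. Altogether the violation of the episode is at most the mean of
`bonus`, the weighted sum of the confidence bounds, clipped at `1`, along the trajectory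
(`MPP.sum_occAction_mul_le_sum_bonus`).

*Accuracy.* All deviation inequalities come from nonnegative supermartingales: a product over the
episodes of factors of conditional mean at most `1` has mean at most `1`
(`MPP.lintegral_prod_interactionLaw_le`). Freezing an exponential supermartingale after the `m`-th
visit to a target, for every `m ≤ T`, gives Hoeffding's inequality uniformly in the number of visits
(`MPP.interactionLaw_exists_sqrt_le`). For an empirical law on a finite set, it is applied to the
indicators of all subsets (`MPP.interactionLaw_exists_lt_sum_abs`). A union bound shows that all
estimates are accurate in all episodes outside an event of probability `5 * δ`
(`MPP.interactionLaw_not_accurate`). For the rewards this uses `|A| ≤ T`, since `|A|` does not enter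
their confidence bounds; if `T < |A|`, the trivial bound `T * L` on the violation suffices.

*Summation.* The bonus takes values in `[0, 18 * L ^ 2]`, so that by the Azuma-Hoeffding inequality
(`MPP.interactionLaw_azuma`) the sum of its conditional means exceeds the sum of its realized values
by at most a multiple of `L ^ 2 * √(T * log (1 / δ))`, outside an event of probability `δ`. This
range is free of logarithms thanks to the clipping. On every realization the sum of the bonuses is
of the order `√T`, since the sum of `1 / √n` along the `N` visits to a target is at most `3 * √N`,
and by the Cauchy-Schwarz inequality over the targets (`sum_bonus_le`). This gives the first bound
(`MPP.interactionLaw_violation_le`), and the second one follows from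
`log (K / δ) ≤ log (1 / δ) * (1 + log K)`, valid for `δ < 1 / 7`; for larger `δ` the claimed
probability is not positive.
-/

namespace Persuasion

/-! ### Exponential moments -/

theorem sum_castLE {β : Type*} [AddCommMonoid β] {T : ℕ} (n : Fin T) (F : Fin T → β) :
    ∑ i : Fin n, F (i.castLE n.isLt.le) = ∑ s, if s < n then F s else 0 := by
  rw [← Finset.sum_filter]
  refine Finset.sum_bij (fun i _ => i.castLE n.isLt.le) ?_ ?_ ?_ ?_
  · intro i _
    exact Finset.mem_filter.2 ⟨Finset.mem_univ _, i.isLt⟩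
  · intro i _ j _ h
    simpa [Fin.ext_iff] using h
  · intro b hb
    exact ⟨⟨b, by simpa using hb⟩, Finset.mem_univ _, rfl⟩
  · intro i _
    rfl

/-- Hoeffding's lemma, in the form of a bound on the exponential moment. -/
theorem lintegral_exp_sub_integral_le {E : Type*} [MeasurableSpace E] (μ : Measure E)
    [IsProbabilityMeasure μ] {f : E → ℝ} (hf : Measurable f) {a b : ℝ}
    (hab : ∀ e, f e ∈ Set.Icc a b) (s : ℝ) :
    ∫⁻ e, ENNReal.ofReal (Real.exp (s * (f e - ∫ x, f x ∂μ) - s ^ 2 * (b - a) ^ 2 / 8)) ∂μ ≤ 1 := by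
  have h := hasSubgaussianMGF_of_mem_Icc hf.aemeasurable (ae_of_all μ hab)
  have h1 := h.mgf_le s
  have h2 : (fun e => Real.exp (s * (f e - ∫ x, f x ∂μ) - s ^ 2 * (b - a) ^ 2 / 8)) =
      fun e => Real.exp (-(s ^ 2 * (b - a) ^ 2 / 8)) * Real.exp (s * (f e - ∫ x, f x ∂μ)) := by
    funext e
    rw [← Real.exp_add]
    ring_nf
  rw [← ofReal_integral_eq_lintegral_ofReal]
  · rw [h2, integral_const_mul, ← ENNReal.ofReal_one]
    refine ENNReal.ofReal_le_ofReal ?_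
    unfold mgf at h1
    refine (mul_le_mul_of_nonneg_left h1 (Real.exp_nonneg _)).trans ?_
    rw [← Real.exp_add, ← Real.exp_zero]
    refine Real.exp_le_exp.2 (le_of_eq ?_)
    push_cast
    rw [Real.norm_eq_abs, div_pow, sq_abs]
    ring
  · rw [h2]
    exact (h.integrable_exp_mul s).const_mul _
  · exact ae_of_all _ fun e => Real.exp_nonneg _

/-- Hoeffding's lemma for a law on a finite set, given by its weights. -/
theorem sum_mul_exp_le {I : Type*} [Fintype I] (p f : I → ℝ) (hp : ∀ i, 0 ≤ p i)
    (hp1 : ∑ i, p i = 1) {a b : ℝ} (hab : ∀ i, f i ∈ Set.Icc a b) (s : ℝ) :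
    ∑ i, p i * Real.exp (s * (f i - ∑ j, p j * f j) - s ^ 2 * (b - a) ^ 2 / 8) ≤ 1 := by
  let _ : MeasurableSpace I := ⊤
  have : DiscreteMeasurableSpace I := ⟨fun _ => trivial⟩
  let μ : Measure I := ∑ i, ENNReal.ofReal (p i) • Measure.dirac i
  have : IsProbabilityMeasure μ := ⟨by
    simp [μ, ← ENNReal.ofReal_sum_of_nonneg (fun i _ => hp i), hp1]⟩
  have hint : ∫ x, f x ∂μ = ∑ j, p j * f j := by
    rw [integral_finsetSum_measure fun i _ => (Integrable.smul_measure
      ((integrable_const (f i)).congr (by rw [Filter.EventuallyEq, ae_dirac_eq]; rfl))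
      ENNReal.ofReal_ne_top)]
    refine Finset.sum_congr rfl fun i _ => ?_
    rw [integral_smul_measure, integral_dirac, ENNReal.toReal_ofReal (hp i), smul_eq_mul]
  have h := lintegral_exp_sub_integral_le μ (f := f) .of_discrete hab s
  rw [hint, lintegral_finsetSum_measure] at h
  simp only [lintegral_smul_measure, lintegral_dirac, smul_eq_mul] at h
  rw [← ENNReal.ofReal_le_one, ENNReal.ofReal_sum_of_nonneg
    (fun i _ => mul_nonneg (hp i) (Real.exp_nonneg _))]
  simpa only [ENNReal.ofReal_mul (hp _)] using h

/-! ### Supermartingales along the interaction -/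

theorem measurable_prod_prefix {X Ω A : Type*} {L T : ℕ}
    (g : (n : ℕ) → (Fin n → Episode X Ω A L) → Episode X Ω A L → ENNReal)
    (hg : ∀ n, Measurable (Function.uncurry (g n))) :
    Measurable fun w : Fin T → Episode X Ω A L =>
      ∏ t : Fin T, g t (fun i => w (i.castLE t.isLt.le)) (w t) := by
  refine Finset.measurable_fun_prod _ fun t _ => ?_
  have h : Measurable fun w : Fin T → Episode X Ω A L => fun i : Fin t => w (i.castLE t.isLt.le) :=
    measurable_pi_lambda _ fun i => measurable_pi_apply _
  exact (hg t).comp (h.prodMk (measurable_pi_apply t))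

section Interaction

variable {X Ω A : Type*} [Fintype X] [Fintype Ω] [Fintype A] {L : ℕ} {S : Layers X L}

namespace MPP

/-- A product of nonnegative factors, one per episode, each of conditional mean at most `1` given
the past, has mean at most `1`. -/
theorem lintegral_prod_interactionLaw_le (M : MPP S Ω A) (alg : Algorithm X Ω A L)
    (g : (n : ℕ) → (Fin n → Episode X Ω A L) → Episode X Ω A L → ENNReal)
    (hg : ∀ n, Measurable (Function.uncurry (g n)))
    (h1 : ∀ n w, ∫⁻ e, g n w e ∂(M.episodeLaw (policyAfter alg w)) ≤ 1) (T : ℕ) :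
    ∫⁻ w, ∏ t : Fin T, g t (fun i => w (i.castLE t.isLt.le)) (w t)
      ∂(M.interactionLaw alg T) ≤ 1 := by
  induction T with
  | zero => simp
  | succ n ih =>
    rw [interactionLaw]
    refine (Measure.lintegral_bind_le _ _ _).trans (le_trans (lintegral_mono fun w => ?_) ih)
    refine (lintegral_map_le _ _).trans ?_
    have : ∀ e, ∏ t : Fin (n + 1),
        g t (fun i : Fin t => Fin.snoc (α := fun _ => Episode X Ω A L) w e (i.castLE t.isLt.le))
        (Fin.snoc (α := fun _ => Episode X Ω A L) w e t) =
        (∏ t : Fin n, g t (fun i => w (i.castLE t.isLt.le)) (w t)) * g n w e := by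
      intro e
      rw [Fin.prod_univ_castSucc]
      congr 1
      · refine Finset.prod_congr rfl fun t _ => ?_
        rw [Fin.snoc_castSucc]
        congr 1
        funext i
        exact Fin.snoc_castSucc (α := fun _ => Episode X Ω A L) (i := i.castLE t.isLt.le) ..
      · rw [Fin.snoc_last]
        congr 1
        funext i
        exact Fin.snoc_castSucc (α := fun _ => Episode X Ω A L) (i := i) ..
    simp_rw [this]
    have hm : Measurable (g n w) := (hg n).comp measurable_prodMk_left
    rw [lintegral_const_mul _ hm]
    exact mul_le_of_le_one_right' (h1 n w)

open Classical in
/-- A maximal Hoeffding inequality for the visits to a fixed target: `v e` says that episode `e`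
visits the target, and then `f e` is a centred variable with range of length `1`. Whatever the
number `N` of visits before an episode, the sum of the `f`'s over them exceeds `√(N c / 2)` with
small probability. For each value `m` of `N`, the exponential supermartingale is frozen after the
`m`-th visit, and Markov's inequality is applied at time `T`. -/
theorem interactionLaw_exists_sqrt_le (M : MPP S Ω A) (alg : Algorithm X Ω A L)
    (v : Episode X Ω A L → Prop) (f : Episode X Ω A L → ℝ) (hv : MeasurableSet {e | v e})
    (hf : Measurable f)
    (h1 : ∀ φ s, ∫⁻ e, (if v e then ENNReal.ofReal (Real.exp (s * f e - s ^ 2 / 8)) else 1)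
      ∂(M.episodeLaw φ) ≤ 1) (T : ℕ) {c : ℝ} (hc : 0 ≤ c) :
    (M.interactionLaw alg T).real {w | ∃ n : Fin T,
      0 < (Finset.univ.filter fun i : Fin n => v (w (i.castLE n.isLt.le))).card ∧
      √(((Finset.univ.filter fun i : Fin n => v (w (i.castLE n.isLt.le))).card : ℝ) * c / 2) ≤
        ∑ i : Fin n, if v (w (i.castLE n.isLt.le)) then f (w (i.castLE n.isLt.le)) else 0}
      ≤ T * Real.exp (-c) := by
  set N : (w : Fin T → Episode X Ω A L) → Fin T → ℕ := fun w n =>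
    (Finset.univ.filter fun i : Fin n => v (w (i.castLE n.isLt.le))).card with hN
  have hNsum : ∀ w n, N w n = ∑ s : Fin T, if s < n then (if v (w s) then 1 else 0) else 0 := by
    intro w n
    rw [hN]
    simp only [Finset.card_filter]
    exact sum_castLE n fun s => if v (w s) then 1 else 0
  have hNmono : ∀ w (n n' : Fin T), n ≤ n' → N w n ≤ N w n' := by
    intro w n n' h
    rw [hNsum, hNsum]
    refine Finset.sum_le_sum fun s _ => ?_
    by_cases hs : s < n
    · simp [hs, hs.trans_le h]
    · simp [hs]
  have hNlt : ∀ w (n n' : Fin T), n < n' → v (w n) → N w n < N w n' := by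
    intro w n n' h hvn
    rw [hNsum, hNsum]
    refine Finset.sum_lt_sum (fun s _ => ?_) ⟨n, Finset.mem_univ _, ?_⟩
    · by_cases hs : s < n
      · simp [hs, hs.trans h]
      · simp [hs]
    · simp [h, hvn]
  -- the minimizer of `s ↦ m * s ^ 2 / 8 - s * √(m * c / 2)`
  let lam : ℕ → ℝ := fun m => 4 * √(m * c / 2) / m
  let g : ℕ → (n : ℕ) → (Fin n → Episode X Ω A L) → Episode X Ω A L → ENNReal := fun m n w e =>
    if v e ∧ (Finset.univ.filter fun i : Fin n => v (w i)).card < m then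
      ENNReal.ofReal (Real.exp (lam m * f e - lam m ^ 2 / 8)) else 1
  have hg : ∀ m n, Measurable (Function.uncurry (g m n)) := by
    intro m n
    refine Measurable.ite (MeasurableSet.inter (measurable_snd hv) ?_) ?_ measurable_const
    · refine measurableSet_lt (f := fun p : (Fin n → Episode X Ω A L) × Episode X Ω A L =>
        (Finset.univ.filter fun i : Fin n => v (p.1 i)).card) ?_ measurable_const
      simp only [Finset.card_filter]
      refine Finset.measurable_fun_sum _ fun i _ => ?_
      refine Measurable.ite ?_ measurable_const measurable_const
      exact ((measurable_pi_apply i).comp measurable_fst) hv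
    · have := hf.comp (measurable_snd : Measurable
        (Prod.snd : (Fin n → Episode X Ω A L) × Episode X Ω A L → _))
      simp only [Function.comp_def] at this
      fun_prop
  have hg1 : ∀ m n w, ∫⁻ e, g m n w e ∂(M.episodeLaw (policyAfter alg w)) ≤ 1 := by
    intro m n w
    by_cases hm : (Finset.univ.filter fun i : Fin n => v (w i)).card < m
    · simp only [g, hm, and_true]; exact h1 _ _
    · simp [g, hm]
  have hmark : ∀ m, M.interactionLaw alg T {w | ENNReal.ofReal (Real.exp c) ≤
      ∏ t : Fin T, g m t (fun i => w (i.castLE t.isLt.le)) (w t)} ≤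
        ENNReal.ofReal (Real.exp (-c)) := by
    intro m
    refine (meas_ge_le_lintegral_div (measurable_prod_prefix (g m) (hg m)).aemeasurable
      (by simp [Real.exp_pos]) ENNReal.ofReal_ne_top).trans ?_
    rw [Real.exp_neg, ENNReal.ofReal_inv_of_pos (Real.exp_pos c), ← one_div]
    exact ENNReal.div_le_div_right (M.lintegral_prod_interactionLaw_le alg (g m) (hg m) (hg1 m) T) _
  have hsub : {w | ∃ n : Fin T, 0 < N w n ∧ √((N w n : ℝ) * c / 2) ≤
        ∑ i : Fin n, if v (w (i.castLE n.isLt.le)) then f (w (i.castLE n.isLt.le)) else 0} ⊆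
      ⋃ m ∈ Finset.Icc 1 T, {w | ENNReal.ofReal (Real.exp c) ≤
      ∏ t : Fin T, g m t (fun i => w (i.castLE t.isLt.le)) (w t)} := by
    rintro w ⟨n, hn0, hn⟩
    have hnT : N w n ≤ T := by
      refine (Finset.card_filter_le _ _).trans ?_
      simp
    simp only [Set.mem_iUnion]
    refine ⟨N w n, Finset.mem_Icc.2 ⟨hn0, hnT⟩, ?_⟩
    set m := N w n with hm
    rw [sum_castLE n fun s => if v (w s) then f (w s) else 0] at hn
    have hgt : ∀ t : Fin T, g m t (fun i => w (i.castLE t.isLt.le)) (w t) = ENNReal.ofReal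
        (Real.exp (if t < n then
          (if v (w t) then lam m * f (w t) - lam m ^ 2 / 8 else 0) else 0)) := by
      intro t
      by_cases hvt : v (w t)
      · by_cases ht : t < n
        · have : (Finset.univ.filter fun i : Fin t => v (w (i.castLE t.isLt.le))).card < m :=
            hNlt w t n ht hvt
          simp [g, hvt, ht, this]
        · have : ¬ (Finset.univ.filter fun i : Fin t => v (w (i.castLE t.isLt.le))).card < m :=
            not_lt.2 (hNmono w n t (not_lt.1 ht))
          simp [g, ht, this]
      · simp [g, hvt]
    simp only [Set.mem_ofPred_eq, hgt]
    rw [← ENNReal.ofReal_prod_of_nonneg (fun _ _ => Real.exp_nonneg _), ← Real.exp_sum]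
    refine ENNReal.ofReal_le_ofReal (Real.exp_le_exp.2 ?_)
    have hsplit : (∑ t : Fin T, if t < n then
          (if v (w t) then lam m * f (w t) - lam m ^ 2 / 8 else 0) else 0) =
        lam m * (∑ t, if t < n then (if v (w t) then f (w t) else 0) else 0) -
          m * (lam m ^ 2 / 8) := by
      have hmr : (m : ℝ) = ∑ s : Fin T, if s < n then (if v (w s) then (1 : ℝ) else 0) else 0 := by
        rw [hm, hNsum]
        push_cast
        rfl
      rw [hmr, Finset.mul_sum, Finset.sum_mul, ← Finset.sum_sub_distrib]
      refine Finset.sum_congr rfl fun s _ => ?_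
      split_ifs <;> simp
    rw [hsplit]
    have hmpos : (0 : ℝ) < m := by exact_mod_cast hn0
    have hsq : √((m : ℝ) * c / 2) ^ 2 = m * c / 2 := Real.sq_sqrt (by positivity)
    have hlam : 0 ≤ lam m := by positivity
    have e1 : lam m * √((m : ℝ) * c / 2) = 2 * c := by
      simp only [lam]
      field_simp
      rw [hsq]
      ring
    have e2 : m * (lam m ^ 2 / 8) = c := by
      simp only [lam]
      field_simp
      rw [hsq]
      ring
    have := mul_le_mul_of_nonneg_left hn hlam
    rw [e2]
    linarith
  have hfin := (measure_mono hsub).trans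
    ((measure_biUnion_finset_le (μ := M.interactionLaw alg T) _ _).trans
      (Finset.sum_le_sum fun m _ => hmark m))
  rw [Finset.sum_const, Nat.card_Icc, Nat.add_sub_cancel, nsmul_eq_mul] at hfin
  rw [measureReal_def]
  refine ENNReal.toReal_le_of_le_ofReal (by positivity) (hfin.trans (le_of_eq ?_))
  rw [ENNReal.ofReal_mul (by positivity), ENNReal.ofReal_natCast]

end MPP

end Interaction

/-! ### Marginals of the law of a trajectory -/

theorem Layers.val_layer_lt {X : Type*} {L : ℕ} {S : Layers X L} {x : X}
    (hx : S.layer x ≠ Fin.last L) :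
    (S.layer x : ℕ) < L := by
  have := (S.layer x).isLt
  have h : (S.layer x : ℕ) ≠ L := fun h => hx (Fin.ext h)
  omega

section Path

variable {X Ω A : Type*} [Fintype X] [Fintype Ω] [Fintype A]

/-- One step of the evolution of the (unnormalized) law of the state, when `W x ω a x'` is the
probability to pass from `x` to `x'` by way of `ω` and `a`. -/
def evolve (W : X → Ω → A → X → ℝ) (p : X → ℝ) (y : X) : ℝ :=
  ∑ x, ∑ ω, ∑ a, p x * W x ω a y

/-- Summing out the first step of a path: it starts the remaining path from the evolved law, with
the factor `F` for the first step absorbed into the transition weights. -/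
theorem sum_path_succ (W : X → Ω → A → X → ℝ) (p : X → ℝ) (n : ℕ)
    (F : X → Ω → A → X → ℝ) (G : (Fin (n + 1) → X) → (Fin n → Ω) → (Fin n → A) → ℝ) :
    (∑ s : Fin (n + 2) → X, ∑ o : Fin (n + 1) → Ω, ∑ a : Fin (n + 1) → A,
      p (s 0) * (∏ k : Fin (n + 1), W (s k.castSucc) (o k) (a k) (s k.succ)) *
        (F (s 0) (o 0) (a 0) (s 1) * G (Fin.tail s) (Fin.tail o) (Fin.tail a))) =
    ∑ s : Fin (n + 1) → X, ∑ o : Fin n → Ω, ∑ a : Fin n → A,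
      evolve (fun x ω a y => W x ω a y * F x ω a y) p (s 0) *
        (∏ k : Fin n, W (s k.castSucc) (o k) (a k) (s k.succ)) * G s o a := by
  rw [← (Fin.consEquiv (fun _ : Fin (n + 2) => X)).sum_comp, Fintype.sum_prod_type]
  simp_rw [← (Fin.consEquiv (fun _ : Fin (n + 1) => Ω)).sum_comp,
    ← (Fin.consEquiv (fun _ : Fin (n + 1) => A)).sum_comp, Fintype.sum_prod_type]
  simp only [Fin.consEquiv_apply, Fin.prod_univ_succ, Fin.cons_zero, Fin.castSucc_zero,
    Fin.cons_succ, ← Fin.succ_castSucc, Fin.cons_one]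
  rw [Finset.sum_comm]
  refine Finset.sum_congr rfl fun s _ => ?_
  rw [Finset.sum_congr rfl fun x _ => Finset.sum_comm, Finset.sum_comm]
  refine Finset.sum_congr rfl fun o _ => ?_
  rw [Finset.sum_congr rfl fun x _ => Finset.sum_congr rfl fun ω _ => Finset.sum_comm,
    Finset.sum_congr rfl fun x _ => Finset.sum_comm, Finset.sum_comm]
  refine Finset.sum_congr rfl fun a _ => ?_
  simp only [evolve, Finset.sum_mul]
  refine Finset.sum_congr rfl fun x _ => Finset.sum_congr rfl fun ω _ =>
    Finset.sum_congr rfl fun b _ => ?_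
  have hs : Fin.tail ((Fin.consEquiv fun _ => X) (x, s)) = s := Fin.tail_cons (α := fun _ => X) x s
  have ho : Fin.tail ((Fin.consEquiv fun _ => Ω) (ω, o)) = o := Fin.tail_cons (α := fun _ => Ω) ω o
  have ha : Fin.tail ((Fin.consEquiv fun _ => A) (b, a)) = a := Fin.tail_cons (α := fun _ => A) b a
  rw [hs, ho, ha]
  ring

theorem sum_path_eq_sum (W : X → Ω → A → X → ℝ) (hW : ∀ x, ∑ ω, ∑ a, ∑ y, W x ω a y = 1) (n : ℕ) :
    ∀ p : X → ℝ, (∑ s : Fin (n + 1) → X, ∑ o : Fin n → Ω, ∑ a : Fin n → A,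
      p (s 0) * ∏ k : Fin n, W (s k.castSucc) (o k) (a k) (s k.succ)) = ∑ x, p x := by
  induction n with
  | zero =>
    intro p
    rw [← (Equiv.funUnique (Fin 1) X).symm.sum_comp]
    simp
  | succ n ih =>
    intro p
    have h := sum_path_succ W p n (fun _ _ _ _ => 1) (fun _ _ _ => 1)
    simp only [mul_one] at h
    rw [h, ih]
    simp only [evolve]
    rw [Finset.sum_comm]
    refine Finset.sum_congr rfl fun x _ => ?_
    calc _ = p x * ∑ ω, ∑ a, ∑ y, W x ω a y := by
          rw [Finset.sum_comm, Finset.mul_sum]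
          refine Finset.sum_congr rfl fun ω _ => ?_
          rw [Finset.sum_comm, Finset.mul_sum]
          refine Finset.sum_congr rfl fun a _ => ?_
          rw [Finset.mul_sum]
      _ = p x := by rw [hW, mul_one]

/-- The marginal at step `k` of a law on paths that is a product of transition weights. -/
theorem sum_path_marginal (W : X → Ω → A → X → ℝ) (hW : ∀ x, ∑ ω, ∑ a, ∑ y, W x ω a y = 1)
    (F : X → Ω → A → X → ℝ) (n : ℕ) : ∀ (k : Fin n) (p : X → ℝ),
    (∑ s : Fin (n + 1) → X, ∑ o : Fin n → Ω, ∑ a : Fin n → A,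
      p (s 0) * (∏ k : Fin n, W (s k.castSucc) (o k) (a k) (s k.succ)) *
        F (s k.castSucc) (o k) (a k) (s k.succ)) =
    ∑ x, (evolve W)^[k] p x * ∑ ω, ∑ a, ∑ y, W x ω a y * F x ω a y := by
  induction n with
  | zero => exact fun k => k.elim0
  | succ n ih =>
    intro k p
    refine Fin.cases ?_ (fun j => ?_) k
    · have h := sum_path_succ W p n F (fun _ _ _ => 1)
      simp only [mul_one] at h
      simp only [Fin.castSucc_zero, Fin.succ_zero_eq_one, Fin.val_zero, Function.iterate_zero, id]
      rw [h, sum_path_eq_sum W hW]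
      simp only [evolve]
      rw [Finset.sum_comm]
      refine Finset.sum_congr rfl fun x _ => ?_
      rw [Finset.sum_comm, Finset.mul_sum]
      refine Finset.sum_congr rfl fun ω _ => ?_
      rw [Finset.sum_comm, Finset.mul_sum]
      refine Finset.sum_congr rfl fun a _ => ?_
      rw [Finset.mul_sum]
    · have h := sum_path_succ W p n (fun _ _ _ _ => 1)
        (fun s o a => F (s j.castSucc) (o j) (a j) (s j.succ))
      simp only [mul_one, one_mul] at h
      rw [Fin.val_succ, Function.iterate_succ_apply, ← ih j (evolve W p), ← h]
      rfl

end Path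

namespace MPP

section

variable {X Ω A : Type*} [Fintype X] [Fintype Ω] {L : ℕ} {S : Layers X L}

theorem prior_nonneg (M : MPP S Ω A) (x : X) (ω : Ω) : 0 ≤ M.prior x ω := (M.prior x).2.1 ω

theorem sum_prior (M : MPP S Ω A) (x : X) : ∑ ω, M.prior x ω = 1 := (M.prior x).2.2

theorem nonempty_outcome (M : MPP S Ω A) : Nonempty Ω := by
  by_contra h
  rw [not_nonempty_iff] at h
  have := M.sum_prior S.init
  simp at this

theorem trans_nonneg (M : MPP S Ω A) (x : X) (ω : Ω) (a : A) (y : X) : 0 ≤ M.trans x ω a y :=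
  (M.trans x ω a).2.1 y

theorem sum_trans (M : MPP S Ω A) (x : X) (ω : Ω) (a : A) : ∑ y, M.trans x ω a y = 1 :=
  (M.trans x ω a).2.2

theorem trans_eq_zero (M : MPP S Ω A) {x y : X} (hx : S.layer x ≠ Fin.last L) (hy : y ∉ S.next x)
    (ω : Ω) (a : A) : M.trans x ω a y = 0 := by
  by_contra h
  exact hy (M.loopFree x hx ω a y ((M.trans_nonneg x ω a y).lt_of_ne' h))

theorem sum_next_trans (M : MPP S Ω A) {x : X} (hx : S.layer x ≠ Fin.last L) (ω : Ω) (a : A) :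
    ∑ y ∈ S.next x, M.trans x ω a y = 1 := by
  rw [← M.sum_trans x ω a]
  exact Finset.sum_subset (Finset.subset_univ _) fun y _ hy => M.trans_eq_zero hx hy ω a

theorem receiverMean_mem_Icc (M : MPP S Ω A) (x : X) (ω : Ω) (a : A) :
    M.receiverMean x ω a ∈ Set.Icc (0 : ℝ) 1 := by
  refine ⟨integral_nonneg fun r => (r.2 x ω a).2.1, ?_⟩
  have := integral_mono_of_nonneg
    (μ := (M.rewardLaw : Measure (RewardTable X Ω A × RewardTable X Ω A)))
    (ae_of_all _ fun r => (r.2 x ω a).2.1) (integrable_const (1 : ℝ))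
    (ae_of_all _ fun r => (r.2 x ω a).2.2)
  simpa [receiverMean] using this

theorem policy_nonneg {X Ω A : Type*} [Fintype A] (φ : Policy X Ω A) (x : X) (ω : Ω) (a : A) :
    0 ≤ φ x ω a := (φ x ω).2.1 a

theorem sum_policy {X Ω A : Type*} [Fintype A] (φ : Policy X Ω A) (x : X) (ω : Ω) :
    ∑ a, φ x ω a = 1 := (φ x ω).2.2

end

variable {X Ω A : Type*} [Fintype X] [Fintype Ω] [Fintype A] {L : ℕ} {S : Layers X L}

/-- The probability to pass from `x` to `x'` by way of `ω` and `a` in one step. -/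
noncomputable def stepProb (M : MPP S Ω A) (φ : Policy X Ω A) (x : X) (ω : Ω) (a : A) (x' : X) :
    ℝ :=
  M.prior x ω * φ x ω a * M.trans x ω a x'

theorem sum_stepProb (M : MPP S Ω A) (φ : Policy X Ω A) (x : X) :
    ∑ ω, ∑ a, ∑ y, M.stepProb φ x ω a y = 1 := by
  have h0 : ∑ o, M.prior x o = 1 := (M.prior x).2.2
  have h1 : ∀ o, ∑ a, φ x o a = 1 := fun o => (φ x o).2.2
  have h2 : ∀ o a, ∑ y, M.trans x o a y = 1 := fun o a => (M.trans x o a).2.2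
  simp only [stepProb, ← Finset.mul_sum, h0, h1, h2, mul_one]

open Classical in
/-- The law of the state at step `k`. -/
noncomputable def stateProb (M : MPP S Ω A) (φ : Policy X Ω A) (k : ℕ) : X → ℝ :=
  (evolve (M.stepProb φ))^[k] fun x => if x = S.init then 1 else 0

theorem stateProb_succ (M : MPP S Ω A) (φ : Policy X Ω A) (k : ℕ) (y : X) :
    M.stateProb φ (k + 1) y = ∑ x, ∑ ω, ∑ a, M.stateProb φ k x * M.stepProb φ x ω a y := by
  rw [stateProb, Function.iterate_succ_apply']
  rfl

theorem stepProb_nonneg (M : MPP S Ω A) (φ : Policy X Ω A) (x : X) (ω : Ω) (a : A) (y : X) :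
    0 ≤ M.stepProb φ x ω a y :=
  mul_nonneg (mul_nonneg ((M.prior _).2.1 _) ((φ _ _).2.1 _)) ((M.trans _ _ _).2.1 _)

theorem stateProb_nonneg (M : MPP S Ω A) (φ : Policy X Ω A) (k : ℕ) (x : X) :
    0 ≤ M.stateProb φ k x := by
  induction k generalizing x with
  | zero => simp only [stateProb, Function.iterate_zero, id]; split_ifs <;> simp
  | succ k ih =>
    rw [stateProb_succ]
    exact Finset.sum_nonneg fun x _ => Finset.sum_nonneg fun ω _ => Finset.sum_nonneg fun a _ =>
      mul_nonneg (ih x) (M.stepProb_nonneg φ _ _ _ _)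

theorem sum_stateProb (M : MPP S Ω A) (φ : Policy X Ω A) (k : ℕ) :
    ∑ x, M.stateProb φ k x = 1 := by
  induction k with
  | zero =>
    simp only [stateProb, Function.iterate_zero, id]
    rw [Finset.sum_eq_single S.init (fun x _ hx => if_neg hx) (by simp), if_pos rfl]
  | succ k ih =>
    simp_rw [stateProb_succ]
    rw [Finset.sum_comm, ← ih]
    refine Finset.sum_congr rfl fun x _ => ?_
    conv_rhs => rw [← mul_one (M.stateProb φ k x), ← M.sum_stepProb φ x]
    rw [Finset.sum_comm, Finset.mul_sum]
    refine Finset.sum_congr rfl fun ω _ => ?_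
    rw [Finset.sum_comm, Finset.mul_sum]
    refine Finset.sum_congr rfl fun a _ => ?_
    rw [Finset.mul_sum]

theorem stateProb_eq_zero (M : MPP S Ω A) (φ : Policy X Ω A) {k : ℕ} (hk : k ≤ L) {x : X}
    (hx : (S.layer x : ℕ) ≠ k) : M.stateProb φ k x = 0 := by
  induction k generalizing x with
  | zero =>
    have : x ≠ S.init := by
      rintro rfl
      exact hx (by simp [(S.layer_eq_zero_iff S.init).2 rfl])
    simp [stateProb, this]
  | succ k ih =>
    rw [stateProb_succ]
    refine Finset.sum_eq_zero fun y _ => Finset.sum_eq_zero fun ω _ =>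
      Finset.sum_eq_zero fun a _ => ?_
    by_cases hy : (S.layer y : ℕ) = k
    · have hl : S.layer y ≠ Fin.last L := by
        intro h
        rw [h, Fin.val_last] at hy
        omega
      have hn : x ∉ S.next y := by
        simp only [Layers.next, Finset.mem_filter, Finset.mem_univ, true_and]
        omega
      simp [stepProb, M.trans_eq_zero hl hn]
    · rw [ih (by omega) hy, zero_mul]

/-- The probability that a trajectory passes through `x`. -/
noncomputable def reach (M : MPP S Ω A) (φ : Policy X Ω A) (x : X) : ℝ :=
  M.stateProb φ (S.layer x) x

theorem reach_nonneg (M : MPP S Ω A) (φ : Policy X Ω A) (x : X) : 0 ≤ M.reach φ x :=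
  M.stateProb_nonneg φ _ x

theorem sum_layerSet_reach (M : MPP S Ω A) (φ : Policy X Ω A) {k : ℕ} (hk : k ≤ L) :
    ∑ x ∈ S.layerSet k, M.reach φ x = 1 := by
  rw [← M.sum_stateProb φ k, ← Finset.sum_subset (Finset.subset_univ (S.layerSet k))]
  · refine Finset.sum_congr rfl fun x hx => ?_
    rw [reach, (Finset.mem_filter.1 hx).2]
  · intro x _ hx
    refine M.stateProb_eq_zero φ hk fun h => hx ?_
    simp [Layers.layerSet, h]

theorem reach_eq_sum_prev (M : MPP S Ω A) (φ : Policy X Ω A) {x : X} (hx : S.layer x ≠ 0) :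
    M.reach φ x = ∑ y ∈ S.prev x, ∑ ω, ∑ a, M.reach φ y * M.stepProb φ y ω a x := by
  obtain ⟨k, hk⟩ : ∃ k, (S.layer x : ℕ) = k + 1 :=
    Nat.exists_eq_succ_of_ne_zero fun h => hx (Fin.ext h)
  have hkL : k + 1 ≤ L := by have := (S.layer x).isLt; omega
  rw [reach, hk, stateProb_succ, ← Finset.sum_subset (Finset.subset_univ (S.prev x))]
  · refine Finset.sum_congr rfl fun y hy => ?_
    have : (S.layer y : ℕ) = k := by
      have := (Finset.mem_filter.1 hy).2
      omega
    rw [reach, this]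
  · intro y _ hy
    have : (S.layer y : ℕ) ≠ k := by
      intro h
      exact hy (by simp [Layers.prev, h, hk])
    simp [M.stateProb_eq_zero φ (by omega) this]

/-- The law of `(x_k, ω_k, a_k, x_{k+1})`. -/
theorem sum_trajProb_mul (M : MPP S Ω A) (φ : Policy X Ω A) (k : Fin L) (F : X → Ω → A → X → ℝ) :
    ∑ τ, M.trajProb φ τ * F (τ.state k.castSucc) (τ.outcome k) (τ.action k) (τ.state k.succ) =
      ∑ x, M.stateProb φ k x * ∑ ω, ∑ a, ∑ y, M.stepProb φ x ω a y * F x ω a y := by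
  classical
  have h := sum_path_marginal (M.stepProb φ) (M.sum_stepProb φ) F L k
    (fun x => if x = S.init then 1 else 0)
  rw [stateProb, ← h, ← Trajectory.equivProd.symm.sum_comp, Fintype.sum_prod_type]
  simp_rw [Fintype.sum_prod_type]
  rfl

theorem layer_state_of_trajProb_ne_zero (M : MPP S Ω A) {φ : Policy X Ω A}
    {τ : Trajectory X Ω A L} (h : M.trajProb φ τ ≠ 0) (k : Fin (L + 1)) :
    S.layer (τ.state k) = k := by
  classical
  have h0 : τ.state 0 = S.init := by
    by_contra h'
    exact h (by simp [trajProb, h'])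
  have hs : ∀ k : Fin L,
      M.trans (τ.state k.castSucc) (τ.outcome k) (τ.action k) (τ.state k.succ) ≠ 0 := by
    intro k h'
    refine h ?_
    rw [trajProb, Finset.prod_eq_zero (Finset.mem_univ k) (by rw [h', mul_zero]), mul_zero]
  induction k using Fin.induction with
  | zero => rw [h0]; exact (S.layer_eq_zero_iff _).2 rfl
  | succ k ih =>
    have hl : S.layer (τ.state k.castSucc) ≠ Fin.last L := by
      rw [ih]
      exact (Fin.castSucc_lt_last k).ne
    have := M.loopFree _ hl _ _ _ ((M.trans_nonneg _ _ _ _).lt_of_ne' (hs k))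
    have h2 := (Finset.mem_filter.1 this).2
    rw [ih] at h2
    exact Fin.ext (by simpa using h2)

theorem occupancy_eq (M : MPP S Ω A) (φ : Policy X Ω A) {x : X} (hx : S.layer x ≠ Fin.last L)
    (ω : Ω) (a : A) (x' : X) :
    M.occupancy φ x ω a x' = M.reach φ x * M.stepProb φ x ω a x' := by
  classical
  set k : Fin L := ⟨S.layer x, Layers.val_layer_lt hx⟩ with hk
  have h := M.sum_trajProb_mul φ k
    fun y o b y' => if y = x ∧ o = ω ∧ b = a ∧ y' = x' then 1 else 0
  have h2 : M.occupancy φ x ω a x' = ∑ τ, M.trajProb φ τ * (if τ.state k.castSucc = x ∧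
      τ.outcome k = ω ∧ τ.action k = a ∧ τ.state k.succ = x' then 1 else 0) := by
    unfold occupancy
    refine Finset.sum_congr rfl fun τ _ => ?_
    rw [mul_ite, mul_one, mul_zero]
    refine if_congr ⟨?_, fun h => ⟨k, rfl, h⟩⟩ rfl rfl
    rintro ⟨j, hj, h⟩
    obtain rfl : j = k := Fin.ext hj
    exact h
  rw [h2, h]
  simp only [mul_ite, mul_one, mul_zero, ite_and]
  rw [Finset.sum_eq_single x]
  · simp [reach, hk]
  · intro y _ hy
    simp [hy]
  · simp

theorem occupancy_eq_zero (M : MPP S Ω A) (φ : Policy X Ω A) {x : X} (hx : S.layer x = Fin.last L)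
    (ω : Ω) (a : A) (x' : X) : M.occupancy φ x ω a x' = 0 := by
  unfold occupancy
  refine Finset.sum_eq_zero fun τ _ => if_neg ?_
  rintro ⟨k, hk, -⟩
  rw [hx, Fin.val_last] at hk
  exact absurd k.isLt (by omega)

theorem occAction_occupancy (M : MPP S Ω A) (φ : Policy X Ω A) {x : X}
    (hx : S.layer x ≠ Fin.last L) (ω : Ω) (a : A) :
    occAction S (M.occupancy φ) x ω a = M.reach φ x * (M.prior x ω * φ x ω a) := by
  simp only [occAction, M.occupancy_eq φ hx, stepProb]
  rw [← Finset.mul_sum, ← Finset.mul_sum, M.sum_next_trans hx, mul_one]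

/-- The mean of a nonnegative function `V` of the trajectory is at least the contribution of the
visit to `x`, if `V` dominates `g ω a` whenever `ω` and `a` follow upon `x`. -/
theorem reach_mul_le_sum_trajProb (M : MPP S Ω A) (φ : Policy X Ω A) {x : X}
    (hx : S.layer x ≠ Fin.last L) (g : Ω → A → ℝ) (V : Trajectory X Ω A L → ℝ)
    (hV : ∀ τ, 0 ≤ V τ)
    (hg : ∀ (τ : Trajectory X Ω A L) k, τ.state k.castSucc = x →
      g (τ.outcome k) (τ.action k) ≤ V τ) :
    M.reach φ x * (∑ ω, M.prior x ω * ∑ a, φ x ω a * g ω a) ≤ ∑ τ, M.trajProb φ τ * V τ := by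
  classical
  set k : Fin L := ⟨S.layer x, Layers.val_layer_lt hx⟩ with hk
  have h := M.sum_trajProb_mul φ k fun y o b _ => if y = x then g o b else 0
  have h3 : ∑ y, M.stateProb φ k y *
      ∑ ω, ∑ a, ∑ y', M.stepProb φ y ω a y' * (if y = x then g ω a else 0) =
      M.reach φ x * (∑ ω, M.prior x ω * ∑ a, φ x ω a * g ω a) := by
    rw [Finset.sum_eq_single x (fun y _ hy => by simp [hy]) (by simp)]
    have : (k : ℕ) = S.layer x := rfl
    rw [reach, this]
    congr 1
    refine Finset.sum_congr rfl fun ω _ => ?_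
    rw [Finset.mul_sum]
    refine Finset.sum_congr rfl fun a _ => ?_
    simp only [if_true, stepProb]
    rw [← Finset.sum_mul, ← Finset.mul_sum, M.sum_trans]
    ring
  rw [← h3, ← h]
  refine Finset.sum_le_sum fun τ _ => mul_le_mul_of_nonneg_left ?_ (M.trajProb_nonneg φ τ)
  split_ifs with hs
  · exact hg τ k hs
  · exact hV τ

end MPP

/-! ### Normalization of a nonnegative vector -/

/-- The vector `u` on `s` divided by its total mass, or the default `p` if the mass vanishes. -/
noncomputable def normalizeOr {I : Type*} (s : Finset I) (u p : I → ℝ) (i : I) : ℝ :=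
  if ∑ j ∈ s, u j = 0 then p i else u i / ∑ j ∈ s, u j

section Normalize

variable {I : Type*} {s : Finset I} {u p : I → ℝ}

theorem normalizeOr_nonneg (hu : ∀ i ∈ s, 0 ≤ u i) (hp : ∀ i ∈ s, 0 ≤ p i) {i : I} (hi : i ∈ s) :
    0 ≤ normalizeOr s u p i := by
  unfold normalizeOr
  split_ifs
  · exact hp i hi
  · exact div_nonneg (hu i hi) (Finset.sum_nonneg hu)

theorem sum_normalizeOr (hp : ∑ i ∈ s, p i = 1) : ∑ i ∈ s, normalizeOr s u p i = 1 := by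
  unfold normalizeOr
  split_ifs with h
  · exact hp
  · rw [← Finset.sum_div, div_self h]

theorem sum_mul_normalizeOr (hu : ∀ i ∈ s, 0 ≤ u i) {i : I} (hi : i ∈ s) :
    (∑ j ∈ s, u j) * normalizeOr s u p i = u i := by
  unfold normalizeOr
  split_ifs with h
  · rw [h, zero_mul, (Finset.sum_eq_zero_iff_of_nonneg hu).1 h i hi]
  · field_simp

/-- If both `p` and the normalization of `u` are `b`-close to the same vector `p₀` in the `ℓ¹`
norm, then they are close to each other. -/
theorem sum_abs_normalizeOr_sub_le (hu : ∀ i ∈ s, 0 ≤ u i) (hp : ∀ i ∈ s, 0 ≤ p i)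
    (hp1 : ∑ i ∈ s, p i = 1) {p₀ e : I → ℝ} {b : ℝ}
    (h1 : ∀ i ∈ s, u i - p₀ i * ∑ j ∈ s, u j ≤ e i) (h2 : ∀ i ∈ s, p₀ i * ∑ j ∈ s, u j - u i ≤ e i)
    (he : ∑ i ∈ s, e i ≤ b * ∑ j ∈ s, u j) (hb : ∑ i ∈ s, |p₀ i - p i| ≤ b) :
    ∑ i ∈ s, |normalizeOr s u p i - p i| ≤ 2 * min 1 b := by
  have hb0 : 0 ≤ b := (Finset.sum_nonneg fun i _ => abs_nonneg _).trans hb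
  have htwo : ∑ i ∈ s, |normalizeOr s u p i - p i| ≤ 2 := by
    calc _ ≤ ∑ i ∈ s, (normalizeOr s u p i + p i) := Finset.sum_le_sum fun i hi => by
          have := normalizeOr_nonneg hu hp hi
          have := hp i hi
          rw [abs_le]
          constructor <;> linarith
      _ = 2 := by rw [Finset.sum_add_distrib, sum_normalizeOr hp1, hp1]; norm_num
  rw [mul_min_of_nonneg _ _ zero_le_two, le_min_iff]
  refine ⟨by linarith, ?_⟩
  by_cases h : ∑ j ∈ s, u j = 0
  · simpa [normalizeOr, h] using hb0
  have hQ : 0 < ∑ j ∈ s, u j := (Finset.sum_nonneg hu).lt_of_ne' h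
  have h3 : ∑ i ∈ s, |normalizeOr s u p i - p₀ i| ≤ b := by
    refine le_of_mul_le_mul_right ?_ hQ
    refine le_trans ?_ he
    rw [Finset.sum_mul]
    refine Finset.sum_le_sum fun i hi => ?_
    rw [← abs_of_pos hQ, ← abs_mul, sub_mul, mul_comm (normalizeOr s u p i),
      sum_mul_normalizeOr hu hi, abs_le]
    constructor <;> linarith [h1 i hi, h2 i hi]
  calc _ ≤ ∑ i ∈ s, (|normalizeOr s u p i - p₀ i| + |p₀ i - p i|) :=
        Finset.sum_le_sum fun i _ => abs_sub_le _ _ _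
    _ ≤ 2 * b := by rw [Finset.sum_add_distrib]; linarith

end Normalize

/-! ### Comparison of two flows through the layers -/

section Flow

variable {X Ω A : Type*} [Fintype X] [Fintype Ω] [Fintype A] {L : ℕ}

/-- The states outside the last layer. -/
def Layers.nonfinal (S : Layers X L) : Finset X :=
  Finset.univ.filter fun x => S.layer x ≠ Fin.last L

theorem Layers.sum_nonfinal (S : Layers X L) (f : X → ℝ) :
    ∑ x ∈ S.nonfinal, f x = ∑ k ∈ Finset.range L, ∑ x ∈ S.layerSet k, f x := by
  rw [← Finset.sum_fiberwise_of_maps_to (t := Finset.range L) (g := fun x => (S.layer x : ℕ))]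
  · refine Finset.sum_congr rfl fun k hk => Finset.sum_congr ?_ fun _ _ => rfl
    ext x
    simp only [nonfinal, layerSet, Finset.mem_filter, Finset.mem_univ, true_and,
      and_iff_right_iff_imp]
    rintro h h'
    rw [h', Fin.val_last] at h
    exact (Finset.mem_range.1 hk).ne h.symm
  · intro x hx
    exact Finset.mem_range.2 (Layers.val_layer_lt (Finset.mem_filter.1 hx).2)

theorem Layers.layer_ne_last_of_mem {S : Layers X L} {k : ℕ} (hk : k < L) {x : X}
    (hx : x ∈ S.layerSet k) : S.layer x ≠ Fin.last L := by
  intro h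
  have := (Finset.mem_filter.1 hx).2
  rw [h, Fin.val_last] at this
  omega

theorem Layers.next_eq_layerSet {S : Layers X L} {k : ℕ} {x : X} (hx : x ∈ S.layerSet k) :
    S.next x = S.layerSet (k + 1) := by
  simp only [next, layerSet, (Finset.mem_filter.1 hx).2]

theorem Layers.prev_eq_layerSet {S : Layers X L} {k : ℕ} {x : X} (hx : x ∈ S.layerSet (k + 1)) :
    S.prev x = S.layerSet k := by
  simp only [prev, layerSet, (Finset.mem_filter.1 hx).2, Nat.add_right_cancel_iff]

/-- Two flows `r` and `s` that start from the same distribution, and follow the transition weights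
`W` and `V` respectively, differ at most by the discrepancies between `W` and `V` met along `r`,
once for every later layer. -/
theorem sum_abs_flow_sub_le (S : Layers X L) (r s : X → ℝ) (W V : X → Ω → A → X → ℝ)
    (h0 : ∀ x, S.layer x = 0 → S.layer x ≠ Fin.last L → r x = s x) (hr0 : ∀ x, 0 ≤ r x)
    (hr : ∀ x, S.layer x ≠ 0 → S.layer x ≠ Fin.last L →
      r x = ∑ y ∈ S.prev x, ∑ ω, ∑ a, r y * W y ω a x)
    (hs : ∀ x, S.layer x ≠ 0 → S.layer x ≠ Fin.last L →
      s x = ∑ y ∈ S.prev x, ∑ ω, ∑ a, s y * V y ω a x)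
    (hV0 : ∀ x, S.layer x ≠ Fin.last L → ∀ ω a, ∀ y ∈ S.next x, 0 ≤ V x ω a y)
    (hV1 : ∀ x, S.layer x ≠ Fin.last L → ∑ ω, ∑ a, ∑ y ∈ S.next x, V x ω a y = 1) :
    ∑ x ∈ S.nonfinal, |r x - s x| ≤
      L * ∑ x ∈ S.nonfinal, r x * ∑ ω, ∑ a, ∑ y ∈ S.next x, |W x ω a y - V x ω a y| := by
  set e : X → ℝ := fun x => ∑ ω, ∑ a, ∑ y ∈ S.next x, |W x ω a y - V x ω a y| with he
  have he0 : ∀ x, 0 ≤ e x := fun x => Finset.sum_nonneg fun _ _ => Finset.sum_nonneg fun _ _ =>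
    Finset.sum_nonneg fun _ _ => abs_nonneg _
  have hswap : ∀ (k : ℕ) (f : X → Ω → A → X → ℝ),
      ∑ x ∈ S.layerSet (k + 1), ∑ y ∈ S.prev x, ∑ ω, ∑ a, f y ω a x =
        ∑ y ∈ S.layerSet k, ∑ ω, ∑ a, ∑ x ∈ S.next y, f y ω a x := by
    intro k f
    rw [Finset.sum_congr rfl fun x hx => by rw [Layers.prev_eq_layerSet hx], Finset.sum_comm]
    refine Finset.sum_congr rfl fun y hy => ?_
    rw [Layers.next_eq_layerSet hy, Finset.sum_comm]
    refine Finset.sum_congr rfl fun ω _ => ?_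
    rw [Finset.sum_comm]
  have key : ∀ k, k < L → ∑ x ∈ S.layerSet k, |r x - s x| ≤
      ∑ j ∈ Finset.range k, ∑ x ∈ S.layerSet j, r x * e x := by
    intro k
    induction k with
    | zero =>
      intro hL
      simp only [Finset.range_zero, Finset.sum_empty]
      refine le_of_eq (Finset.sum_eq_zero fun x hx => ?_)
      rw [h0 x (Fin.ext (Finset.mem_filter.1 hx).2) (Layers.layer_ne_last_of_mem hL hx), sub_self,
        abs_zero]
    | succ k ih =>
      intro hk
      rw [Finset.sum_range_succ]
      have h1 : ∑ x ∈ S.layerSet (k + 1), |r x - s x| ≤ ∑ x ∈ S.layerSet (k + 1),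
          ∑ y ∈ S.prev x, ∑ ω, ∑ a, (|r y - s y| * V y ω a x + r y * |W y ω a x - V y ω a x|) := by
        refine Finset.sum_le_sum fun x hx => ?_
        have hx0 : S.layer x ≠ 0 := by
          intro h
          have := (Finset.mem_filter.1 hx).2
          rw [h] at this
          simp at this
        have hxl := Layers.layer_ne_last_of_mem hk hx
        rw [hr x hx0 hxl, hs x hx0 hxl, ← Finset.sum_sub_distrib]
        refine (Finset.abs_sum_le_sum_abs _ _).trans (Finset.sum_le_sum fun y hy => ?_)
        rw [← Finset.sum_sub_distrib]
        refine (Finset.abs_sum_le_sum_abs _ _).trans (Finset.sum_le_sum fun ω _ => ?_)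
        rw [← Finset.sum_sub_distrib]
        refine (Finset.abs_sum_le_sum_abs _ _).trans (Finset.sum_le_sum fun a _ => ?_)
        rw [Layers.prev_eq_layerSet hx] at hy
        have hyl := Layers.layer_ne_last_of_mem (by omega) hy
        have hV := hV0 y hyl ω a x (by rwa [Layers.next_eq_layerSet hy])
        have e1 : r y * W y ω a x - s y * V y ω a x =
            (r y - s y) * V y ω a x + r y * (W y ω a x - V y ω a x) := by ring
        rw [e1]
        refine (abs_add_le _ _).trans (le_of_eq ?_)
        rw [abs_mul, abs_mul, abs_of_nonneg hV, abs_of_nonneg (hr0 y)]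
      refine h1.trans ?_
      rw [hswap]
      have h2 : ∀ y ∈ S.layerSet k, ∑ ω, ∑ a, ∑ x ∈ S.next y,
          (|r y - s y| * V y ω a x + r y * |W y ω a x - V y ω a x|) = |r y - s y| + r y * e y := by
        intro y hy
        simp only [Finset.sum_add_distrib, ← Finset.mul_sum]
        rw [hV1 y (Layers.layer_ne_last_of_mem (by omega) hy), mul_one]
      rw [Finset.sum_congr rfl h2, Finset.sum_add_distrib]
      exact add_le_add (ih (by omega)) le_rfl
  rw [S.sum_nonfinal fun x => |r x - s x|]
  calc _ ≤ ∑ k ∈ Finset.range L, ∑ x ∈ S.nonfinal, r x * e x := by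
        refine Finset.sum_le_sum fun k hk => ?_
        refine (key k (Finset.mem_range.1 hk)).trans ?_
        rw [S.sum_nonfinal]
        refine Finset.sum_le_sum_of_subset_of_nonneg ?_ fun j _ _ =>
          Finset.sum_nonneg fun x _ => mul_nonneg (hr0 x) (he0 x)
        exact Finset.range_subset_range.2 (Finset.mem_range.1 hk).le
    _ = _ := by simp [he]

end Flow

/-! ### The violation of an episode with accurate estimates -/

section Deterministic

section

variable {X Ω A : Type*} [Fintype X] [Fintype Ω] {L n : ℕ}

theorem rewardBound_nonneg (T : ℕ) (δ : ℝ) (h : Fin n → Feedback X Ω A L) (x : X) (ω : Ω) :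
    0 ≤ rewardBound T δ h x ω := le_min zero_le_one (Real.sqrt_nonneg _)

theorem rewardBound_le_one (T : ℕ) (δ : ℝ) (h : Fin n → Feedback X Ω A L) (x : X) (ω : Ω) :
    rewardBound T δ h x ω ≤ 1 := min_le_left _ _

end

variable {X Ω A : Type*} [Fintype X] [Fintype Ω] [Fintype A] {L n : ℕ} {S : Layers X L}

/-- The estimates of the transitions, of the prior and of the receivers' rewards after the
feedback `h` are within their confidence bounds. -/
structure MPP.Accurate (M : MPP S Ω A) (T : ℕ) (δ : ℝ) (h : Fin n → Feedback X Ω A L) : Prop where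
  trans : ∀ x, S.layer x ≠ Fin.last L → ∀ ω a,
    ∑ x' ∈ S.next x, |transEst h x ω a x' - M.trans x ω a x'| ≤ transBound S T δ h x ω a
  prior : ∀ x, S.layer x ≠ Fin.last L →
    ∑ ω, |priorEst h x ω - M.prior x ω| ≤ priorBound T δ h x
  reward : ∀ x, S.layer x ≠ Fin.last L → ∀ ω a,
    |receiverEst h x ω a - M.receiverMean x ω a| ≤ rewardBound T δ h x ω

open Classical in
/-- An upper bound for the violation of an episode, as a function of its trajectory: the sum of
the confidence bounds at the visited places. The weight `4` comes from the four reward bounds in an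
incentive constraint, `10` from the change of the prior in that constraint, and `2 * L` from the
discrepancy of the two flows, which persists in all later layers. The bounds are clipped at `1` so
that the bonus is bounded. -/
noncomputable def bonus (S : Layers X L) (T : ℕ) (δ : ℝ) (h : Fin n → Feedback X Ω A L)
    (τ : Trajectory X Ω A L) : ℝ :=
  ∑ x, ((∑ ω, if τ.VisitsOutcome x ω then 4 * rewardBound T δ h x ω else 0) +
    (if τ.VisitsState x then (10 + 2 * L) * min 1 (priorBound T δ h x) else 0) +
    ∑ ω, ∑ a, if τ.VisitsAction x ω a then 2 * L * min 1 (transBound S T δ h x ω a) else 0)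

variable {T : ℕ} {δ : ℝ} {h : Fin n → Feedback X Ω A L} {q : X → Ω → A → X → ℝ}
  {ζ : X → Ω → ℝ} {ε : X → Ω → A → X → ℝ} {φ : Policy X Ω A}

theorem OptOptFeasible.occAction_nonneg (hq : OptOptFeasible S T δ h q ζ ε) {x : X}
    (hx : S.layer x ≠ Fin.last L) (ω : Ω) (a : A) : 0 ≤ occAction S q x ω a :=
  Finset.sum_nonneg fun x' hx' => hq.nonneg x hx ω a x' hx'

theorem OptOptFeasible.occOutcome_nonneg (hq : OptOptFeasible S T δ h q ζ ε) {x : X}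
    (hx : S.layer x ≠ Fin.last L) (ω : Ω) : 0 ≤ occOutcome S q x ω :=
  Finset.sum_nonneg fun a _ => hq.occAction_nonneg hx ω a

theorem OptOptFeasible.occAction_eq (hq : OptOptFeasible S T δ h q ζ ε)
    (hφ : InducedBy S q φ) {x : X} (hx : S.layer x ≠ Fin.last L) (ω : Ω) (a : A) :
    occAction S q x ω a = occOutcome S q x ω * φ x ω a := by
  by_cases h0 : occOutcome S q x ω = 0
  · rw [h0, zero_mul]
    exact (Finset.sum_eq_zero_iff_of_nonneg fun a _ => hq.occAction_nonneg hx ω a).1 h0 a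
      (Finset.mem_univ a)
  · rw [hφ x hx ω h0 a]
    field_simp

namespace MPP

/-- The prior that explains the occupancies `q`; the true prior at a state that `q` does not
visit. -/
noncomputable def priorOf (M : MPP S Ω A) (q : X → Ω → A → X → ℝ) (x : X) : Ω → ℝ :=
  normalizeOr Finset.univ (occOutcome S q x) (M.prior x)

/-- The transitions that explain the occupancies `q`; the true ones where `q` does not visit. -/
noncomputable def transOf (M : MPP S Ω A) (q : X → Ω → A → X → ℝ) (x : X) (ω : Ω) (a : A) :
    X → ℝ :=
  normalizeOr (S.next x) (q x ω a) (M.trans x ω a)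

theorem priorOf_nonneg (M : MPP S Ω A) (hq : OptOptFeasible S T δ h q ζ ε) {x : X}
    (hx : S.layer x ≠ Fin.last L) (ω : Ω) : 0 ≤ M.priorOf q x ω :=
  normalizeOr_nonneg (fun ω _ => hq.occOutcome_nonneg hx ω) (fun ω _ => M.prior_nonneg x ω)
    (Finset.mem_univ ω)

theorem sum_priorOf (M : MPP S Ω A) (q : X → Ω → A → X → ℝ) (x : X) : ∑ ω, M.priorOf q x ω = 1 :=
  sum_normalizeOr (M.sum_prior x)

theorem transOf_nonneg (M : MPP S Ω A) (hq : OptOptFeasible S T δ h q ζ ε) {x : X}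
    (hx : S.layer x ≠ Fin.last L) (ω : Ω) (a : A) {y : X} (hy : y ∈ S.next x) :
    0 ≤ M.transOf q x ω a y :=
  normalizeOr_nonneg (hq.nonneg x hx ω a) (fun y _ => M.trans_nonneg x ω a y) hy

theorem sum_transOf {A : Type*} (M : MPP S Ω A) (q : X → Ω → A → X → ℝ) {x : X}
    (hx : S.layer x ≠ Fin.last L) (ω : Ω) (a : A) : ∑ y ∈ S.next x, M.transOf q x ω a y = 1 :=
  sum_normalizeOr (M.sum_next_trans hx ω a)

theorem occOutcome_eq (M : MPP S Ω A) (hq : OptOptFeasible S T δ h q ζ ε) {x : X}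
    (hx : S.layer x ≠ Fin.last L) (ω : Ω) :
    occOutcome S q x ω = occState S q x * M.priorOf q x ω :=
  (sum_mul_normalizeOr (fun ω _ => hq.occOutcome_nonneg hx ω) (Finset.mem_univ ω)).symm

theorem eq_occState_mul (M : MPP S Ω A) (hq : OptOptFeasible S T δ h q ζ ε) (hφ : InducedBy S q φ)
    {x : X} (hx : S.layer x ≠ Fin.last L) (ω : Ω) (a : A) {y : X} (hy : y ∈ S.next x) :
    q x ω a y = occState S q x * (M.priorOf q x ω * φ x ω a * M.transOf q x ω a y) := by
  have h1 : occAction S q x ω a * M.transOf q x ω a y = q x ω a y :=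
    sum_mul_normalizeOr (hq.nonneg x hx ω a) hy
  rw [← h1, hq.occAction_eq hφ hx, M.occOutcome_eq hq hx]
  ring

theorem sum_abs_priorOf_sub_le (M : MPP S Ω A) (hM : M.Accurate T δ h)
    (hq : OptOptFeasible S T δ h q ζ ε) {x : X} (hx : S.layer x ≠ Fin.last L) :
    ∑ ω, |M.priorOf q x ω - M.prior x ω| ≤ 2 * min 1 (priorBound T δ h x) :=
  sum_abs_normalizeOr_sub_le (fun ω _ => hq.occOutcome_nonneg hx ω) (fun ω _ => M.prior_nonneg x ω)
    (M.sum_prior x) (fun ω _ => hq.prior_upper x hx ω) (fun ω _ => hq.prior_lower x hx ω)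
    (hq.prior_total x hx) (hM.prior x hx)

theorem sum_abs_transOf_sub_le (M : MPP S Ω A) (hM : M.Accurate T δ h)
    (hq : OptOptFeasible S T δ h q ζ ε) {x : X} (hx : S.layer x ≠ Fin.last L) (ω : Ω) (a : A) :
    ∑ y ∈ S.next x, |M.transOf q x ω a y - M.trans x ω a y| ≤
      2 * min 1 (transBound S T δ h x ω a) :=
  sum_abs_normalizeOr_sub_le (hq.nonneg x hx ω a) (fun y _ => M.trans_nonneg x ω a y)
    (M.sum_next_trans hx ω a) (hq.trans_upper x hx ω a) (hq.trans_lower x hx ω a)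
    (hq.trans_total x hx ω a) (hM.trans x hx ω a)

/-- The discrepancy between the true transition weights and those that explain `q`. -/
theorem sum_abs_stepProb_sub_le (M : MPP S Ω A) (hM : M.Accurate T δ h)
    (hq : OptOptFeasible S T δ h q ζ ε) (φ : Policy X Ω A) {x : X} (hx : S.layer x ≠ Fin.last L) :
    ∑ ω, ∑ a, ∑ y ∈ S.next x,
      |M.stepProb φ x ω a y - M.priorOf q x ω * φ x ω a * M.transOf q x ω a y| ≤
    2 * min 1 (priorBound T δ h x) +
      ∑ ω, M.prior x ω * ∑ a, φ x ω a * (2 * min 1 (transBound S T δ h x ω a)) := by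
  have h1 : ∀ ω a, ∑ y ∈ S.next x,
      |M.stepProb φ x ω a y - M.priorOf q x ω * φ x ω a * M.transOf q x ω a y| ≤
      |M.priorOf q x ω - M.prior x ω| * φ x ω a +
        M.prior x ω * (φ x ω a * (2 * min 1 (transBound S T δ h x ω a))) := by
    intro ω a
    have hp := M.prior_nonneg x ω
    have hf := policy_nonneg φ x ω a
    calc _ ≤ ∑ y ∈ S.next x, (|M.priorOf q x ω - M.prior x ω| * φ x ω a * M.transOf q x ω a y +
          M.prior x ω * φ x ω a * |M.transOf q x ω a y - M.trans x ω a y|) := by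
          refine Finset.sum_le_sum fun y hy => ?_
          have ht := M.transOf_nonneg hq hx ω a hy
          have e1 : M.stepProb φ x ω a y - M.priorOf q x ω * φ x ω a * M.transOf q x ω a y =
            -((M.priorOf q x ω - M.prior x ω) * φ x ω a * M.transOf q x ω a y +
              M.prior x ω * φ x ω a * (M.transOf q x ω a y - M.trans x ω a y)) := by
            rw [stepProb]
            ring
          rw [e1, abs_neg]
          refine (abs_add_le _ _).trans (le_of_eq ?_)
          rw [abs_mul, abs_mul, abs_mul (M.prior x ω * φ x ω a), abs_of_nonneg hf, abs_of_nonneg ht,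
            abs_of_nonneg (mul_nonneg hp hf)]
      _ ≤ _ := by
          rw [Finset.sum_add_distrib, ← Finset.mul_sum, ← Finset.mul_sum, M.sum_transOf q hx,
            mul_one, ← mul_assoc (M.prior x ω)]
          gcongr
          exact M.sum_abs_transOf_sub_le hM hq hx ω a
  refine (Finset.sum_le_sum fun ω _ => Finset.sum_le_sum fun a _ => h1 ω a).trans ?_
  simp only [Finset.sum_add_distrib, ← Finset.mul_sum, sum_policy, mul_one]
  gcongr
  exact M.sum_abs_priorOf_sub_le hM hq hx

/-- The true occupancies of the states stay close to those that the linear program predicts. -/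
theorem sum_abs_reach_sub_le (M : MPP S Ω A) (hM : M.Accurate T δ h)
    (hq : OptOptFeasible S T δ h q ζ ε) (hφ : InducedBy S q φ) :
    ∑ x ∈ S.nonfinal, |M.reach φ x - occState S q x| ≤
      L * ∑ x ∈ S.nonfinal, M.reach φ x * (2 * min 1 (priorBound T δ h x) +
        ∑ ω, M.prior x ω * ∑ a, φ x ω a * (2 * min 1 (transBound S T δ h x ω a))) := by
  refine (sum_abs_flow_sub_le S (M.reach φ) (occState S q) (M.stepProb φ)
    (fun x ω a y => M.priorOf q x ω * φ x ω a * M.transOf q x ω a y) ?_ (M.reach_nonneg φ)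
    (fun x hx _ => M.reach_eq_sum_prev φ hx) ?_ ?_ ?_).trans ?_
  · intro x hx hxl
    have hL : 0 < L := by have := Layers.val_layer_lt hxl; omega
    have hset : S.layerSet 0 = {x} := by
      ext y
      rw [(S.layer_eq_zero_iff x).1 hx, Finset.mem_singleton, ← S.layer_eq_zero_iff]
      simp [Layers.layerSet]
    have h1 := M.sum_layerSet_reach φ hL.le
    have h2 := hq.mass 0 hL
    rw [hset, Finset.sum_singleton] at h1 h2
    rw [h1, ← h2]
    rfl
  · intro x hx0 hxl
    refine (hq.flow x hx0 hxl).symm.trans ?_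
    refine Finset.sum_congr rfl fun y hy => Finset.sum_congr rfl fun ω _ =>
      Finset.sum_congr rfl fun a _ => ?_
    have hy' := (Finset.mem_filter.1 hy).2
    have hyl : S.layer y ≠ Fin.last L := by
      intro h
      rw [h, Fin.val_last] at hy'
      have := (S.layer x).isLt
      omega
    exact M.eq_occState_mul hq hφ hyl ω a (by simp [Layers.next, hy'])
  · intro x hx ω a y hy
    exact mul_nonneg (mul_nonneg (M.priorOf_nonneg hq hx ω) (policy_nonneg φ x ω a))
      (M.transOf_nonneg hq hx ω a hy)
  · intro x hx
    simp only [← Finset.mul_sum, M.sum_transOf q hx, mul_one, sum_policy, sum_priorOf]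
  · gcongr with x hx
    · exact M.reach_nonneg φ x
    · exact M.sum_abs_stepProb_sub_le hM hq φ (Finset.mem_filter.1 hx).2

/-- At a state that `q` visits, the incentive constraints of `Opt-Opt` bound what the receivers can
gain from any deviation `b`. -/
theorem sum_gain_le (M : MPP S Ω A) (hM : M.Accurate T δ h) (hq : OptOptFeasible S T δ h q ζ ε)
    (hφ : InducedBy S q φ) {x : X} (hx : S.layer x ≠ Fin.last L) (h0 : occState S q x ≠ 0)
    (b : A → A) :
    ∑ ω, ∑ a, M.prior x ω * φ x ω a * (M.receiverMean x ω (b a) - M.receiverMean x ω a) ≤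
      ∑ ω, M.prior x ω * ∑ a, φ x ω a * (4 * rewardBound T δ h x ω) +
        10 * min 1 (priorBound T δ h x) := by
  have hpos : 0 < occState S q x :=
    (Finset.sum_nonneg fun ω _ => hq.occOutcome_nonneg hx ω).lt_of_ne' h0
  have hic : ∀ a, 0 ≤ ∑ ω, M.priorOf q x ω * φ x ω a * (4 * rewardBound T δ h x ω -
      (M.receiverMean x ω (b a) - M.receiverMean x ω a)) := by
    intro a
    have h1 := hq.incentive x hx a (b a)
    have h2 : ∀ ω, ∑ x' ∈ S.next x, q x ω a x' * (receiverEst h x ω a + rewardBound T δ h x ω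
        - receiverEst h x ω (b a) + rewardBound T δ h x ω) ≤ occState S q x *
        (M.priorOf q x ω * φ x ω a * (4 * rewardBound T δ h x ω -
          (M.receiverMean x ω (b a) - M.receiverMean x ω a))) := by
      intro ω
      rw [← Finset.sum_mul]
      change occAction S q x ω a * _ ≤ _
      rw [hq.occAction_eq hφ hx, M.occOutcome_eq hq hx, mul_assoc (occState S q x),
        mul_assoc (occState S q x)]
      have e1 := abs_le.1 (hM.reward x hx ω a)
      have e2 := abs_le.1 (hM.reward x hx ω (b a))
      refine mul_le_mul_of_nonneg_left (mul_le_mul_of_nonneg_left (by linarith)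
        (mul_nonneg (M.priorOf_nonneg hq hx ω) (policy_nonneg φ x ω a))) hpos.le
    have h3 := h1.trans (Finset.sum_le_sum fun ω _ => h2 ω)
    rw [← Finset.mul_sum] at h3
    exact (mul_nonneg_iff_of_pos_left hpos).1 h3
  -- the gain is compared with the incentive constraint, in which the prior is `M.priorOf q`
  have hpt : ∀ ω a, M.prior x ω * φ x ω a * (M.receiverMean x ω (b a) - M.receiverMean x ω a) ≤
      M.prior x ω * (φ x ω a * (4 * rewardBound T δ h x ω)) +
        5 * (|M.priorOf q x ω - M.prior x ω| * φ x ω a) -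
      M.priorOf q x ω * φ x ω a * (4 * rewardBound T δ h x ω -
      (M.receiverMean x ω (b a) - M.receiverMean x ω a)) := by
    intro ω a
    set d := M.receiverMean x ω (b a) - M.receiverMean x ω a with hd
    have h1 := M.receiverMean_mem_Icc x ω (b a)
    have h2 := M.receiverMean_mem_Icc x ω a
    have h3 := rewardBound_nonneg T δ h x ω
    have h4 := rewardBound_le_one T δ h x ω
    have h5 := policy_nonneg φ x ω a
    have h6 : |4 * rewardBound T δ h x ω - d| ≤ 5 := by
      rw [abs_le]
      constructor <;> linarith [h1.1, h1.2, h2.1, h2.2]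
    have h7 : (M.priorOf q x ω - M.prior x ω) * (4 * rewardBound T δ h x ω - d) ≤
        |M.priorOf q x ω - M.prior x ω| * 5 :=
      (le_abs_self _).trans (by rw [abs_mul]; gcongr)
    have h8 := mul_le_mul_of_nonneg_right h7 h5
    linarith
  refine (Finset.sum_le_sum fun ω _ => Finset.sum_le_sum fun a _ => hpt ω a).trans ?_
  simp only [Finset.sum_add_distrib, Finset.sum_sub_distrib, ← Finset.mul_sum, sum_policy, mul_one]
  have h1 := M.sum_abs_priorOf_sub_le hM hq hx
  have h2 : 0 ≤ ∑ ω, ∑ a, M.priorOf q x ω * φ x ω a * (4 * rewardBound T δ h x ω -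
      (M.receiverMean x ω (b a) - M.receiverMean x ω a)) := by
    rw [Finset.sum_comm]
    exact Finset.sum_nonneg fun a _ => hic a
  simp only [Finset.sum_sub_distrib, mul_sub] at h2
  simp only [mul_sub, Finset.sum_sub_distrib]
  linarith

theorem sum_gain_le_one (M : MPP S Ω A) (φ : Policy X Ω A) (x : X) (b : A → A) :
    ∑ ω, ∑ a, M.prior x ω * φ x ω a * (M.receiverMean x ω (b a) - M.receiverMean x ω a) ≤ 1 := by
  calc _ ≤ ∑ ω, ∑ a, M.prior x ω * φ x ω a := by
        refine Finset.sum_le_sum fun ω _ => Finset.sum_le_sum fun a _ => ?_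
        refine mul_le_of_le_one_right (mul_nonneg (M.prior_nonneg x ω) (policy_nonneg φ x ω a)) ?_
        linarith [(M.receiverMean_mem_Icc x ω (b a)).2, (M.receiverMean_mem_Icc x ω a).1]
    _ = 1 := by simp only [← Finset.mul_sum, sum_policy, mul_one]

theorem sum_occAction_mul_eq (M : MPP S Ω A) (φ : Policy X Ω A) (b : A → X → A) :
    ∑ x, ∑ ω, ∑ a, occAction S (M.occupancy φ) x ω a *
      (M.receiverMean x ω (b a x) - M.receiverMean x ω a) =
    ∑ x ∈ S.nonfinal, M.reach φ x * ∑ ω, ∑ a, M.prior x ω * φ x ω a *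
      (M.receiverMean x ω (b a x) - M.receiverMean x ω a) := by
  rw [← Finset.sum_subset (Finset.subset_univ S.nonfinal)]
  · refine Finset.sum_congr rfl fun x hx => ?_
    simp only [M.occAction_occupancy φ (Finset.mem_filter.1 hx).2, Finset.mul_sum, mul_assoc]
  · intro x _ hx
    have hx : S.layer x = Fin.last L := by simpa [Layers.nonfinal] using hx
    simp [occAction, M.occupancy_eq_zero φ hx]

theorem sum_occAction_mul_le (M : MPP S Ω A) (φ : Policy X Ω A) (b : A → X → A) :
    ∑ x, ∑ ω, ∑ a, occAction S (M.occupancy φ) x ω a *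
      (M.receiverMean x ω (b a x) - M.receiverMean x ω a) ≤ L := by
  rw [M.sum_occAction_mul_eq]
  calc _ ≤ ∑ x ∈ S.nonfinal, M.reach φ x := Finset.sum_le_sum fun x _ =>
        mul_le_of_le_one_right (M.reach_nonneg φ x) (M.sum_gain_le_one φ x fun a => b a x)
    _ = ∑ k ∈ Finset.range L, 1 := by
        rw [S.sum_nonfinal]
        exact Finset.sum_congr rfl fun k hk => M.sum_layerSet_reach φ (Finset.mem_range.1 hk).le
    _ = L := by simp

/-- The violation of an episode is at most the mean of the bonus of its trajectory. -/
theorem sum_occAction_mul_le_sum_bonus (M : MPP S Ω A) (hM : M.Accurate T δ h)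
    (hq : OptOptFeasible S T δ h q ζ ε) (hφ : InducedBy S q φ) (b : A → X → A) :
    ∑ x, ∑ ω, ∑ a, occAction S (M.occupancy φ) x ω a *
      (M.receiverMean x ω (b a x) - M.receiverMean x ω a) ≤
    ∑ τ, M.trajProb φ τ * bonus S T δ h τ := by
  classical
  rw [M.sum_occAction_mul_eq]
  have hz0 : ∀ x, 0 ≤ min 1 (priorBound T δ h x) := fun x => le_min zero_le_one (Real.sqrt_nonneg _)
  have hy0 : ∀ x ω a, 0 ≤ min 1 (transBound S T δ h x ω a) := fun x ω a =>
    le_min zero_le_one (Real.sqrt_nonneg _)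
  have hx0 := rewardBound_nonneg T δ h
  have h1 : ∀ x ∈ S.nonfinal, M.reach φ x * ∑ ω, ∑ a, M.prior x ω * φ x ω a *
      (M.receiverMean x ω (b a x) - M.receiverMean x ω a) ≤ |M.reach φ x - occState S q x| +
      M.reach φ x * (∑ ω, M.prior x ω * ∑ a, φ x ω a * (4 * rewardBound T δ h x ω) +
        10 * min 1 (priorBound T δ h x)) := by
    intro x hx
    have hr := M.reach_nonneg φ x
    by_cases h0 : occState S q x = 0
    -- no incentive constraint at `x`, but then the gain is at most the discrepancy of the flows
    · rw [h0, sub_zero, abs_of_nonneg hr]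
      have h1 := mul_le_mul_of_nonneg_left (M.sum_gain_le_one φ x fun a => b a x) hr
      have h2 : 0 ≤ ∑ ω, M.prior x ω * ∑ a, φ x ω a * (4 * rewardBound T δ h x ω) +
        10 * min 1 (priorBound T δ h x) := by
        refine add_nonneg (Finset.sum_nonneg fun ω _ => mul_nonneg (M.prior_nonneg x ω)
          (Finset.sum_nonneg fun a _ => mul_nonneg (policy_nonneg φ x ω a) ?_)) ?_
        · linarith [hx0 x ω]
        · linarith [hz0 x]
      linarith [mul_nonneg hr h2]
    · have := mul_le_mul_of_nonneg_left
        (M.sum_gain_le hM hq hφ (Finset.mem_filter.1 hx).2 h0 fun a => b a x) hr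
      linarith [abs_nonneg (M.reach φ x - occState S q x)]
  refine (Finset.sum_le_sum h1).trans ?_
  rw [Finset.sum_add_distrib]
  refine (add_le_add_left (M.sum_abs_reach_sub_le hM hq hφ) _).trans ?_
  -- the terms of the bonus that belong to `x` are collected along the visit to `x`
  have h2 : ∀ x ∈ S.nonfinal, M.reach φ x * (∑ ω, M.prior x ω * ∑ a, φ x ω a *
      (4 * rewardBound T δ h x ω + (10 + 2 * L) * min 1 (priorBound T δ h x) +
        2 * L * min 1 (transBound S T δ h x ω a))) ≤
      ∑ τ, M.trajProb φ τ *
      ((∑ ω, if τ.VisitsOutcome x ω then 4 * rewardBound T δ h x ω else 0) +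
    (if τ.VisitsState x then (10 + 2 * L) * min 1 (priorBound T δ h x) else 0) +
    ∑ ω, ∑ a, if τ.VisitsAction x ω a then 2 * L * min 1 (transBound S T δ h x ω a) else 0) := by
    intro x hx
    have n1 : ∀ (τ : Trajectory X Ω A L) ω,
        0 ≤ if τ.VisitsOutcome x ω then 4 * rewardBound T δ h x ω else 0 := fun τ ω => by
      split_ifs
      · linarith [hx0 x ω]
      · exact le_rfl
    have n2 : ∀ (τ : Trajectory X Ω A L) ω a,
        0 ≤ if τ.VisitsAction x ω a then 2 * L * min 1 (transBound S T δ h x ω a) else 0 :=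
      fun τ ω a => by
      split_ifs
      · have := hy0 x ω a
        positivity
      · exact le_rfl
    refine M.reach_mul_le_sum_trajProb φ (Finset.mem_filter.1 hx).2 _ _ (fun τ => ?_)
      fun τ k hk => ?_
    · refine add_nonneg (add_nonneg (Finset.sum_nonneg fun ω _ => n1 τ ω) ?_)
        (Finset.sum_nonneg fun ω _ => Finset.sum_nonneg fun a _ => n2 τ ω a)
      split_ifs
      · have := hz0 x
        positivity
      · exact le_rfl
    · refine add_le_add (add_le_add ?_ ?_) ?_
      · refine le_trans ?_
          (Finset.single_le_sum (fun ω _ => n1 τ ω) (Finset.mem_univ (τ.outcome k)))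
        rw [if_pos ⟨k, hk, rfl⟩]
      · rw [if_pos ⟨k, hk⟩]
      · refine le_trans ?_ (Finset.single_le_sum (fun ω _ => Finset.sum_nonneg fun a _ => n2 τ ω a)
          (Finset.mem_univ (τ.outcome k)))
        refine le_trans ?_
          (Finset.single_le_sum (fun a _ => n2 τ _ a) (Finset.mem_univ (τ.action k)))
        rw [if_pos ⟨k, hk, rfl, rfl⟩]
  have h3 : ∑ τ, M.trajProb φ τ * bonus S T δ h τ = ∑ x, ∑ τ, M.trajProb φ τ *
      ((∑ ω, if τ.VisitsOutcome x ω then 4 * rewardBound T δ h x ω else 0) +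
    (if τ.VisitsState x then (10 + 2 * L) * min 1 (priorBound T δ h x) else 0) +
    ∑ ω, ∑ a, if τ.VisitsAction x ω a then 2 * L * min 1 (transBound S T δ h x ω a) else 0) := by
    rw [Finset.sum_comm]
    refine Finset.sum_congr rfl fun τ _ => ?_
    rw [← Finset.mul_sum]
    rfl
  rw [h3]
  refine le_trans ?_ (Finset.sum_le_sum_of_subset_of_nonneg (Finset.subset_univ S.nonfinal) ?_)
  · refine le_trans (le_of_eq ?_) (Finset.sum_le_sum h2)
    rw [Finset.mul_sum, ← Finset.sum_add_distrib]
    refine Finset.sum_congr rfl fun x _ => ?_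
    have e1 : ∀ c : ℝ, ∑ ω, M.prior x ω * ∑ a, φ x ω a * c = c := fun c => by
      simp only [← Finset.sum_mul, sum_policy, one_mul]
    have e2 : ∀ c : ℝ, ∑ ω, M.prior x ω * ∑ a, φ x ω a * (c * min 1 (transBound S T δ h x ω a)) =
        c * ∑ ω, M.prior x ω * ∑ a, φ x ω a * min 1 (transBound S T δ h x ω a) := fun c => by
      simp only [Finset.mul_sum]
      refine Finset.sum_congr rfl fun ω _ => Finset.sum_congr rfl fun a _ => ?_
      ring
    simp only [mul_add (φ x _ _), Finset.sum_add_distrib, mul_add (M.prior x _)]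
    rw [e1, e2, e2]
    ring
  · intro x _ _
    refine Finset.sum_nonneg fun τ _ => mul_nonneg (M.trajProb_nonneg φ τ) ?_
    refine add_nonneg (add_nonneg (Finset.sum_nonneg fun ω _ => ?_) ?_)
        (Finset.sum_nonneg fun ω _ => Finset.sum_nonneg fun a _ => ?_)
    · split_ifs
      · linarith [hx0 x ω]
      · exact le_rfl
    · split_ifs
      · have := hz0 x
        positivity
      · exact le_rfl
    · split_ifs
      · have := hy0 x ω a
        positivity
      · exact le_rfl

end MPP

end Deterministic

/-! ### Feasibility of `Opt-Opt` -/

namespace MPP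

variable {X Ω A : Type*} [Fintype X] [Fintype Ω] [Fintype A] {L n : ℕ} {S : Layers X L}

theorem sum_next_stepProb (M : MPP S Ω A) (φ : Policy X Ω A) {x : X} (hx : S.layer x ≠ Fin.last L) :
    ∑ ω, ∑ a, ∑ y ∈ S.next x, M.stepProb φ x ω a y = 1 := by
  simp only [stepProb, ← Finset.mul_sum, M.sum_next_trans hx, mul_one, sum_policy]

theorem occOutcome_occupancy (M : MPP S Ω A) (φ : Policy X Ω A) {x : X}
    (hx : S.layer x ≠ Fin.last L) (ω : Ω) :
    occOutcome S (M.occupancy φ) x ω = M.reach φ x * M.prior x ω := by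
  simp only [occOutcome, M.occAction_occupancy φ hx, ← Finset.mul_sum, sum_policy, mul_one]

theorem sum_occOutcome_occupancy (M : MPP S Ω A) (φ : Policy X Ω A) {x : X}
    (hx : S.layer x ≠ Fin.last L) : ∑ ω, occOutcome S (M.occupancy φ) x ω = M.reach φ x := by
  simp only [M.occOutcome_occupancy φ hx, ← Finset.mul_sum, sum_prior, mul_one]

/-- With accurate estimates, the true occupancy of a policy that reveals nothing, and always
recommends an action that is optimal for the receivers under the prior, is feasible. -/
theorem Accurate.exists_feasible [Nonempty A] {M : MPP S Ω A} {T : ℕ} {δ : ℝ}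
    {h : Fin n → Feedback X Ω A L} (hM : M.Accurate T δ h) :
    ∃ q ζ ε, OptOptFeasible S T δ h q ζ ε := by
  classical
  have hb : ∀ x, ∃ b, ∀ a, ∑ ω, M.prior x ω * M.receiverMean x ω a ≤
      ∑ ω, M.prior x ω * M.receiverMean x ω b := fun x => Finite.exists_max _
  choose b hb using hb
  let φ : Policy X Ω A := fun x _ => ⟨Pi.single (b x) 1, single_mem_stdSimplex ℝ (b x)⟩
  have hφ : ∀ x ω a, φ x ω a = if a = b x then 1 else 0 := fun x ω a => by
    change (Pi.single (b x) (1 : ℝ) : A → ℝ) a = _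
    rw [Pi.single_apply]
  refine ⟨M.occupancy φ,
    fun x ω => |occOutcome S (M.occupancy φ) x ω -
      priorEst h x ω * ∑ ω', occOutcome S (M.occupancy φ) x ω'|,
    fun x ω a x' => |M.occupancy φ x ω a x' -
      transEst h x ω a x' * ∑ x'' ∈ S.next x, M.occupancy φ x ω a x''|, ?_⟩
  constructor
  · intro k hk
    rw [← M.sum_layerSet_reach φ hk.le]
    refine Finset.sum_congr rfl fun x hx => ?_
    have hx := Layers.layer_ne_last_of_mem hk hx
    simp only [M.occupancy_eq φ hx, ← Finset.mul_sum, M.sum_next_stepProb φ hx, mul_one]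
  · intro x hx0 hx
    simp only [M.occupancy_eq φ hx, ← Finset.mul_sum, M.sum_next_stepProb φ hx, mul_one]
    rw [M.reach_eq_sum_prev φ hx0]
    refine Finset.sum_congr rfl fun y hy => Finset.sum_congr rfl fun ω _ =>
      Finset.sum_congr rfl fun a _ => ?_
    refine M.occupancy_eq φ (fun h => ?_) ω a x
    have hy := (Finset.mem_filter.1 hy).2
    rw [h, Fin.val_last] at hy
    have := (S.layer x).isLt
    omega
  · exact fun x _ ω a x' _ => le_abs_self _
  · exact fun x _ ω a x' _ => (neg_sub _ _).symm.trans_le (neg_le_abs _)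
  · intro x hx ω a
    change _ ≤ transBound S T δ h x ω a * occAction S (M.occupancy φ) x ω a
    have h0 : 0 ≤ occAction S (M.occupancy φ) x ω a := by
      rw [M.occAction_occupancy φ hx]
      exact mul_nonneg (M.reach_nonneg φ x)
        (mul_nonneg (M.prior_nonneg x ω) (policy_nonneg φ x ω a))
    refine le_trans (le_of_eq ?_) (mul_le_mul_of_nonneg_right (hM.trans x hx ω a) h0)
    rw [Finset.sum_mul]
    refine Finset.sum_congr rfl fun y _ => ?_
    change |_ - _ * occAction S (M.occupancy φ) x ω a| = _
    rw [← abs_of_nonneg h0, ← abs_mul, abs_of_nonneg h0, ← abs_neg, M.occAction_occupancy φ hx,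
      M.occupancy_eq φ hx, stepProb]
    ring_nf
  · exact fun x _ ω => le_abs_self _
  · exact fun x _ ω => (neg_sub _ _).symm.trans_le (neg_le_abs _)
  · intro x hx
    simp only [M.sum_occOutcome_occupancy φ hx]
    have h0 := M.reach_nonneg φ x
    refine le_trans (le_of_eq ?_) (mul_le_mul_of_nonneg_right (hM.prior x hx) h0)
    rw [Finset.sum_mul]
    refine Finset.sum_congr rfl fun ω _ => ?_
    rw [M.occOutcome_occupancy φ hx]
    nth_rewrite 3 [← abs_of_nonneg h0]
    rw [← abs_mul, ← abs_neg]
    ring_nf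
  · intro x hx a a'
    simp only [← Finset.sum_mul]
    change 0 ≤ ∑ ω, occAction S (M.occupancy φ) x ω a * _
    simp only [M.occAction_occupancy φ hx, hφ]
    by_cases ha : a = b x
    · subst ha
      refine le_trans (mul_nonneg (M.reach_nonneg φ x) (sub_nonneg.2 (hb x a'))) ?_
      rw [← Finset.sum_sub_distrib, Finset.mul_sum]
      refine Finset.sum_le_sum fun ω _ => ?_
      rw [if_pos rfl, mul_one, mul_assoc, ← mul_sub]
      have e1 := abs_le.1 (hM.reward x hx ω (b x))
      have e2 := abs_le.1 (hM.reward x hx ω a')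
      exact mul_le_mul_of_nonneg_left (mul_le_mul_of_nonneg_left (by linarith)
        (M.prior_nonneg x ω)) (M.reach_nonneg φ x)
    · simp [ha]
  · intro x hx ω a y _
    rw [M.occupancy_eq φ hx]
    exact mul_nonneg (M.reach_nonneg φ x) (M.stepProb_nonneg φ x ω a y)

end MPP

/-! ### Confidence bounds -/

/-- The `ℓ¹` distance of two vectors of equal mass is twice the mass of the positive part of their
difference. -/
theorem sum_abs_sub_eq {I : Type*} (s : Finset I) (u p : I → ℝ) (h : ∑ i ∈ s, u i = ∑ i ∈ s, p i) :
    ∑ i ∈ s, |u i - p i| = 2 * ∑ i ∈ s.filter (fun i => p i < u i), (u i - p i) := by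
  have h1 : ∑ i ∈ s, (u i - p i) = 0 := by rw [Finset.sum_sub_distrib, h, sub_self]
  rw [← sub_zero (2 * _), ← h1, Finset.sum_filter, Finset.mul_sum, ← Finset.sum_sub_distrib]
  refine Finset.sum_congr rfl fun i _ => ?_
  split_ifs with hi
  · rw [abs_of_pos (sub_pos.2 hi)]; ring
  · rw [abs_of_nonpos (sub_nonpos.2 (not_lt.1 hi))]; ring

namespace MPP

theorem measurableSet_traj {X Ω A : Type*} {L : ℕ} (U : Set (Trajectory X Ω A L)) :
    MeasurableSet {e : Episode X Ω A L | e.1 ∈ U} :=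
  measurable_fst (MeasurableSet.of_discrete (s := U))

variable {X Ω A : Type*} [Fintype X] [Fintype Ω] [Fintype A] {L : ℕ} {S : Layers X L}

open Classical in
/-- Concentration, uniformly in time, of the empirical law of a variable `Y` with finitely many
values, sampled whenever an episode visits a target: Hoeffding's inequality for the indicator of
every subset of the values. -/
theorem interactionLaw_exists_lt_sum_abs (M : MPP S Ω A) (alg : Algorithm X Ω A L) {I : Type*}
    (v : Episode X Ω A L → Prop) (Y : Episode X Ω A L → I) (s : Finset I) (p : I → ℝ)
    (hs : s.Nonempty) (hp : ∀ i ∈ s, 0 ≤ p i) (hp1 : ∑ i ∈ s, p i = 1)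
    (hv : MeasurableSet {e | v e}) (hY : ∀ B : Finset I, MeasurableSet {e | Y e ∈ B})
    (h1 : ∀ φ, ∀ B ⊆ s, ∀ t, ∫⁻ e, (if v e then ENNReal.ofReal (Real.exp
      (t * ((if Y e ∈ B then 1 else 0) - ∑ i ∈ B, p i) - t ^ 2 / 8)) else 1)
      ∂(M.episodeLaw φ) ≤ 1) (T : ℕ) {l : ℝ} (hl : 1 ≤ l) :
    (M.interactionLaw alg T).real {w | (∀ t, v (w t) → Y (w t) ∈ s) ∧ ∃ n : Fin T,
      √(2 * (s.card : ℝ) * l /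
        max 1 ((Finset.univ.filter fun i : Fin n => v (w (i.castLE n.isLt.le))).card : ℝ)) <
      ∑ j ∈ s, |((Finset.univ.filter fun i : Fin n =>
          v (w (i.castLE n.isLt.le)) ∧ Y (w (i.castLE n.isLt.le)) = j).card : ℝ) /
        max 1 ((Finset.univ.filter fun i : Fin n => v (w (i.castLE n.isLt.le))).card : ℝ) - p j|} ≤
      2 * T * Real.exp (-l) := by
  set m := s.card with hm
  have hm1 : 1 ≤ m := hs.card_pos
  have hm1' : (1 : ℝ) ≤ m := by exact_mod_cast hm1
  let E : Finset I → Set (Fin T → Episode X Ω A L) := fun B => {w | ∃ n : Fin T,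
      0 < (Finset.univ.filter fun i : Fin n => v (w (i.castLE n.isLt.le))).card ∧
      √(((Finset.univ.filter fun i : Fin n => v (w (i.castLE n.isLt.le))).card : ℝ) * (m * l) / 2) ≤
        ∑ i : Fin n, if v (w (i.castLE n.isLt.le)) then
          ((if Y (w (i.castLE n.isLt.le)) ∈ B then 1 else 0) - ∑ i ∈ B, p i) else 0}
  have hE : ∀ B ∈ s.powerset, (M.interactionLaw alg T).real (E B) ≤ T * Real.exp (-(m * l)) := by
    intro B hB
    refine M.interactionLaw_exists_sqrt_le alg v
      (fun e => (if Y e ∈ B then 1 else 0) - ∑ i ∈ B, p i) hv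
      ((Measurable.ite (hY B) measurable_const measurable_const).sub measurable_const)
      (fun φ t => h1 φ B (Finset.mem_powerset.1 hB) t) T (by positivity)
  refine (measureReal_mono (s₂ := ⋃ B ∈ s.powerset, E B) ?_ (measure_ne_top _ _)).trans
    ((measureReal_biUnion_finset_le _ _).trans ((Finset.sum_le_sum hE).trans ?_))
  · rintro w ⟨hws, n, hn⟩
    set N : ℕ := (Finset.univ.filter fun i : Fin n => v (w (i.castLE n.isLt.le))).card with hN
    set C : I → ℕ := fun j => (Finset.univ.filter fun i : Fin n =>
          v (w (i.castLE n.isLt.le)) ∧ Y (w (i.castLE n.isLt.le)) = j).card with hC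
    have hCB : ∀ B : Finset I, (∑ j ∈ B, (C j : ℝ)) =
        ∑ i : Fin n, if v (w (i.castLE n.isLt.le)) then
          (if Y (w (i.castLE n.isLt.le)) ∈ B then (1 : ℝ) else 0) else 0 := by
      intro B
      simp only [hC, Finset.card_filter]
      push_cast
      rw [Finset.sum_comm]
      refine Finset.sum_congr rfl fun i _ => ?_
      by_cases hvi : v (w (i.castLE n.isLt.le))
      · simp [hvi]
      · simp [hvi]
    have hNr : (N : ℝ) = ∑ i : Fin n, if v (w (i.castLE n.isLt.le)) then (1 : ℝ) else 0 := by
      rw [hN, Finset.card_filter]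
      push_cast
      rfl
    have hCs : ∑ j ∈ s, (C j : ℝ) = N := by
      rw [hCB, hNr]
      refine Finset.sum_congr rfl fun i _ => ?_
      by_cases hvi : v (w (i.castLE n.isLt.le))
      · rw [if_pos hvi, if_pos hvi, if_pos (hws _ hvi)]
      · simp [hvi]
    change √(2 * (m : ℝ) * l / max 1 (N : ℝ)) < ∑ j ∈ s, |(C j : ℝ) / max 1 (N : ℝ) - p j| at hn
    -- without a visit, the estimate is `0`, at distance `1` from `p`, which is below the bound
    have hN0 : 0 < N := by
      rw [Nat.pos_iff_ne_zero]
      intro h0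
      have hC0 : ∀ j ∈ s, (C j : ℝ) = 0 := (Finset.sum_eq_zero_iff_of_nonneg
        (fun j _ => Nat.cast_nonneg _)).1 (by rw [hCs, h0, Nat.cast_zero])
      have e1 : ∑ j ∈ s, |(C j : ℝ) / max 1 (N : ℝ) - p j| = 1 := by
        rw [← hp1]
        refine Finset.sum_congr rfl fun j hj => ?_
        rw [hC0 j hj, zero_div, zero_sub, abs_neg, abs_of_nonneg (hp j hj)]
      rw [e1, h0, Nat.cast_zero, max_eq_left zero_le_one, div_one, Real.sqrt_lt' one_pos] at hn
      nlinarith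
    have hN1 : (1 : ℝ) ≤ N := by exact_mod_cast hN0
    have hNpos : (0 : ℝ) < N := by linarith
    rw [max_eq_right hN1, sum_abs_sub_eq s (fun j => (C j : ℝ) / N) p
      (by rw [← Finset.sum_div, hCs, hp1, div_self hNpos.ne'])] at hn
    set B := s.filter (fun j => p j < (C j : ℝ) / N) with hB
    simp only [Set.mem_iUnion]
    refine ⟨B, Finset.mem_powerset.2 (Finset.filter_subset _ _), n, hN0, ?_⟩
    have e1 : (∑ i : Fin n, if v (w (i.castLE n.isLt.le)) then
          ((if Y (w (i.castLE n.isLt.le)) ∈ B then 1 else 0) - ∑ i ∈ B, p i) else 0) =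
        N * ∑ j ∈ B, ((C j : ℝ) / N - p j) := by
      rw [Finset.sum_sub_distrib, mul_sub, ← Finset.sum_div, mul_div_cancel₀ _ hNpos.ne', hCB, hNr,
        Finset.sum_mul, ← Finset.sum_sub_distrib]
      refine Finset.sum_congr rfl fun i _ => ?_
      by_cases hvi : v (w (i.castLE n.isLt.le))
      · simp [hvi]
      · simp [hvi]
    rw [e1]
    have e2 : √((N : ℝ) * (m * l) / 2) = N / 2 * √(2 * (m : ℝ) * l / N) := by
      rw [← Real.sqrt_sq (by positivity : (0 : ℝ) ≤ N / 2), ← Real.sqrt_mul (by positivity)]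
      congr 1
      field_simp
    change √((N : ℝ) * (m * l) / 2) ≤ _
    rw [e2]
    have := mul_lt_mul_of_pos_left hn (by positivity : (0 : ℝ) < N / 2)
    linarith
  · rw [Finset.sum_const, Finset.card_powerset, nsmul_eq_mul]
    have e1 : Real.exp (-(m * l)) = Real.exp (-l) ^ m := by
      rw [← Real.exp_nat_mul]
      congr 1
      ring
    -- the union over the `2 ^ m` subsets costs only a factor `2`
    have e2 : 2 * Real.exp (-l) ≤ 1 := by
      have h2 : Real.exp (-l) ≤ Real.exp (-1) := Real.exp_le_exp.2 (by linarith)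
      have := Real.exp_neg_one_lt_half
      linarith
    have e3 : (2 * Real.exp (-l)) ^ m ≤ 2 * Real.exp (-l) :=
      pow_le_of_le_one (by positivity) e2 (by omega)
    rw [mul_pow] at e3
    rw [e1, ← hm]
    push_cast
    calc (2 : ℝ) ^ m * (T * Real.exp (-l) ^ m) = T * (2 ^ m * Real.exp (-l) ^ m) := by ring
      _ ≤ T * (2 * Real.exp (-l)) := by gcongr
      _ = _ := by ring

theorem lintegral_trajLaw (M : MPP S Ω A) (φ : Policy X Ω A) (F : Trajectory X Ω A L → ENNReal) :
    ∫⁻ τ, F τ ∂(M.trajLaw φ) = ∑ τ, ENNReal.ofReal (M.trajProb φ τ) * F τ := by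
  rw [trajLaw, lintegral_finsetSum_measure]
  simp

theorem lintegral_episodeLaw_fst (M : MPP S Ω A) (φ : Policy X Ω A)
    (F : Trajectory X Ω A L → ENNReal) :
    ∫⁻ e, F e.1 ∂(M.episodeLaw φ) = ∑ τ, ENNReal.ofReal (M.trajProb φ τ) * F τ := by
  rw [← M.lintegral_trajLaw, episodeLaw, lintegral_prod _ (Measurable.aemeasurable (by
    exact (Measurable.of_discrete (f := F)).comp measurable_fst))]
  simp

/-- A function of one step has mean at most `1` if this holds given the state before the step. -/
theorem lintegral_step_le_one (M : MPP S Ω A) (φ : Policy X Ω A) (k : Fin L)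
    (F : X → Ω → A → X → ℝ) (hF0 : ∀ x ω a y, 0 ≤ F x ω a y)
    (hF : ∀ x, ∑ ω, ∑ a, ∑ y, M.stepProb φ x ω a y * F x ω a y ≤ 1) :
    ∫⁻ e, ENNReal.ofReal
      (F (e.1.state k.castSucc) (e.1.outcome k) (e.1.action k) (e.1.state k.succ))
      ∂(M.episodeLaw φ) ≤ 1 := by
  rw [M.lintegral_episodeLaw_fst φ fun τ =>
    ENNReal.ofReal (F (τ.state k.castSucc) (τ.outcome k) (τ.action k) (τ.state k.succ))]
  simp only [← ENNReal.ofReal_mul (M.trajProb_nonneg φ _)]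
  rw [← ENNReal.ofReal_sum_of_nonneg fun τ _ => mul_nonneg (M.trajProb_nonneg φ τ) (hF0 _ _ _ _),
    M.sum_trajProb_mul, ENNReal.ofReal_le_one, ← M.sum_stateProb φ k]
  exact Finset.sum_le_sum fun x _ => mul_le_of_le_one_right (M.stateProb_nonneg φ _ x) (hF x)

/-- Almost surely, all trajectories pass through the layers one by one. -/
theorem interactionLaw_not_layered (M : MPP S Ω A) (alg : Algorithm X Ω A L) (T : ℕ) :
    (M.interactionLaw alg T).real {w | ¬ ∀ t k, S.layer ((w t).1.state k) = k} = 0 := by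
  classical
  let U : Set (Trajectory X Ω A L) := {τ | ∀ k, S.layer (τ.state k) = k}
  -- the factor `⊤` on a null set does not contribute to the mean of the product
  let g : (n : ℕ) → (Fin n → Episode X Ω A L) → Episode X Ω A L → ENNReal := fun _ _ e =>
    if e.1 ∈ U then 1 else ⊤
  have hg : ∀ n, Measurable (Function.uncurry (g n)) := fun n =>
    Measurable.ite (measurable_snd (measurableSet_traj U)) measurable_const measurable_const
  have h1 : ∀ n w, ∫⁻ e, g n w e ∂(M.episodeLaw (policyAfter alg w)) ≤ 1 := by
    intro n w
    rw [M.lintegral_episodeLaw_fst _ fun τ => if τ ∈ U then 1 else ⊤]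
    refine le_of_le_of_eq (Finset.sum_le_sum (g := fun τ => ENNReal.ofReal
      (M.trajProb (policyAfter alg w) τ)) fun τ _ => ?_) ?_
    · split_ifs with hτ
      · rw [mul_one]
      · by_cases h0 : M.trajProb (policyAfter alg w) τ = 0
        · simp [h0]
        · exact absurd (fun k => M.layer_state_of_trajProb_ne_zero h0 k) hτ
    · rw [← ENNReal.ofReal_sum_of_nonneg (fun τ _ => M.trajProb_nonneg _ τ), sum_trajProb,
        ENNReal.ofReal_one]
  have h2 := ae_lt_top (measurable_prod_prefix (T := T) g hg)
    (ne_top_of_le_ne_top ENNReal.one_ne_top (M.lintegral_prod_interactionLaw_le alg g hg h1 T))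
  rw [measureReal_eq_zero_iff]
  refine measure_mono_null (fun w hw => ?_) (ae_iff.1 h2)
  obtain ⟨t, ht⟩ := not_forall.1 hw
  simp only [Set.mem_ofPred_eq, not_lt, top_le_iff]
  rw [← Finset.mul_prod_erase _ _ (Finset.mem_univ t)]
  have e1 : g t (fun i => w (i.castLE t.isLt.le)) (w t) = ⊤ := if_neg ht
  rw [e1]
  refine ENNReal.top_mul (Finset.prod_ne_zero_iff.2 fun j _ => ?_)
  simp only [g]
  split_ifs <;> simp

end MPP

/-! ### Accuracy of the estimates -/

section Visits

variable {X Ω A : Type*} {L : ℕ} {S : Layers X L} {τ : Trajectory X Ω A L}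

/-- On a trajectory that passes through the layers one by one, `x` can only be visited in the step
given by its layer. -/
theorem exists_state_eq_iff (hτ : ∀ k, S.layer (τ.state k) = k) {x : X} {k : Fin L}
    (hk : (k : ℕ) = S.layer x) (P : Fin L → Prop) :
    (∃ j : Fin L, τ.state j.castSucc = x ∧ P j) ↔ τ.state k.castSucc = x ∧ P k := by
  refine ⟨?_, fun h => ⟨k, h⟩⟩
  rintro ⟨j, hj, hP⟩
  have h1 := hτ j.castSucc
  rw [hj] at h1
  obtain rfl : j = k := Fin.ext (by rw [hk, h1, Fin.val_castSucc])
  exact ⟨hj, hP⟩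

theorem visitsState_iff (hτ : ∀ k, S.layer (τ.state k) = k) {x : X} {k : Fin L}
    (hk : (k : ℕ) = S.layer x) : τ.VisitsState x ↔ τ.state k.castSucc = x := by
  simpa [Trajectory.VisitsState] using exists_state_eq_iff hτ hk fun _ => True

theorem state_succ_mem_next [Fintype X] (hτ : ∀ k, S.layer (τ.state k) = k) (k : Fin L) :
    τ.state k.succ ∈ S.next (τ.state k.castSucc) := by
  simp [Layers.next, hτ]

/-- The feedback from the episodes before `n`. -/
def historyBefore {T : ℕ} (w : Fin T → Episode X Ω A L) (n : Fin T) : Fin n → Feedback X Ω A L :=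
  fun i => observe (w (i.castLE n.isLt.le))

open Classical in
/-- The estimate of the receivers' reward as an average of entries of the full reward tables, which
does not refer to the feedback. -/
theorem receiverEst_eq [Fintype A] {T : ℕ} {w : Fin T → Episode X Ω A L}
    (hw : ∀ t k, S.layer ((w t).1.state k) = k) {x : X} {k : Fin L} (hk : (k : ℕ) = S.layer x)
    (n : Fin T) (ω : Ω) (a : A) {U : Set (Trajectory X Ω A L)}
    (hU : ∀ τ, τ ∈ U ↔ τ.state k.castSucc = x ∧ τ.outcome k = ω) :
    receiverEst (historyBefore w n) x ω a = (∑ i : Fin n, if (w (i.castLE n.isLt.le)).1 ∈ U then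
      ((w (i.castLE n.isLt.le)).2.2 x ω a : ℝ) else 0) /
      max 1 (countOutcome (historyBefore w n) x ω : ℝ) := by
  unfold receiverEst rewardEst
  congr 1
  refine Finset.sum_congr rfl fun i _ => ?_
  rw [Finset.sum_eq_single k]
  · by_cases h : (w (i.castLE n.isLt.le)).1 ∈ U
    · have h' := (hU _).1 h
      rw [if_pos h]
      refine (if_pos h').trans ?_
      change ((w _).2.2 ((w _).1.state k.castSucc) ((w _).1.outcome k) a : ℝ) = _
      rw [h'.1, h'.2]
    · rw [if_neg h]
      exact if_neg fun h' => h ((hU _).2 h')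
  · intro j _ hj
    refine if_neg fun h => hj ?_
    have h1 := hw (i.castLE n.isLt.le) j.castSucc
    have h2 : (w (i.castLE n.isLt.le)).1.state j.castSucc = x := h.1
    rw [h2] at h1
    exact Fin.ext (by rw [hk, h1, Fin.val_castSucc])
  · simp

end Visits

namespace MPP

variable {X Ω A : Type*} [Fintype X] [Fintype Ω] [Fintype A] {L : ℕ} {S : Layers X L}

open Classical in
theorem sum_mul_exp_indicator_le {I : Type*} [Fintype I] (p : I → ℝ) (hp : ∀ i, 0 ≤ p i)
    (hp1 : ∑ i, p i = 1) (B : Finset I) (t : ℝ) :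
    ∑ i, p i * Real.exp (t * ((if i ∈ B then 1 else 0) - ∑ j ∈ B, p j) - t ^ 2 / 8) ≤ 1 := by
  have h := sum_mul_exp_le p (fun i => if i ∈ B then 1 else 0) hp hp1 (a := 0) (b := 1)
    (fun i => by split_ifs <;> simp) t
  simpa using h

theorem interactionLaw_transBound_lt (M : MPP S Ω A) (alg : Algorithm X Ω A L) (T : ℕ) {δ : ℝ}
    (hl : 1 ≤ Real.log ((T : ℝ) * Fintype.card X * Fintype.card Ω * Fintype.card A / δ))
    {x : X} (hx : S.layer x ≠ Fin.last L) (ω : Ω) (a : A) :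
    (M.interactionLaw alg T).real {w | (∀ t k, S.layer ((w t).1.state k) = k) ∧ ∃ n : Fin T,
      transBound S T δ (historyBefore w n) x ω a <
        ∑ y ∈ S.next x, |transEst (historyBefore w n) x ω a y - M.trans x ω a y|} ≤
      2 * T * Real.exp
        (-Real.log ((T : ℝ) * Fintype.card X * Fintype.card Ω * Fintype.card A / δ)) := by
  classical
  set k : Fin L := ⟨S.layer x, Layers.val_layer_lt hx⟩
  have hk : (k : ℕ) = S.layer x := rfl
  have hne : (S.next x).Nonempty := by
    rw [Finset.nonempty_iff_ne_empty]
    intro h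
    have := M.sum_next_trans hx ω a
    simp [h] at this
  have h := M.interactionLaw_exists_lt_sum_abs alg
    (fun e => e.1.state k.castSucc = x ∧ e.1.outcome k = ω ∧ e.1.action k = a)
    (fun e => e.1.state k.succ) (S.next x) (M.trans x ω a) hne
    (fun y _ => M.trans_nonneg x ω a y) (M.sum_next_trans hx ω a)
    (measurableSet_traj {τ | τ.state k.castSucc = x ∧ τ.outcome k = ω ∧ τ.action k = a})
    (fun B => measurableSet_traj {τ | τ.state k.succ ∈ B}) (fun φ B _ t => ?_) T hl
  · refine (measureReal_mono ?_ (measure_ne_top _ _)).trans h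
    rintro w ⟨hw, n, hn⟩
    refine ⟨fun t ht => ?_, n, ?_⟩
    · rw [← ht.1]
      exact state_succ_mem_next (hw t) k
    · have h1 : countAction (historyBefore w n) x ω a = (Finset.univ.filter fun i : Fin n =>
          (w (i.castLE n.isLt.le)).1.state k.castSucc = x ∧
          (w (i.castLE n.isLt.le)).1.outcome k = ω ∧
          (w (i.castLE n.isLt.le)).1.action k = a).card := by
        unfold countAction
        congr 1
        exact Finset.filter_congr fun i _ => exists_state_eq_iff (hw _) hk _
      have h2 : ∀ y, countStep (historyBefore w n) x ω a y = (Finset.univ.filter fun i : Fin n =>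
          ((w (i.castLE n.isLt.le)).1.state k.castSucc = x ∧
          (w (i.castLE n.isLt.le)).1.outcome k = ω ∧ (w (i.castLE n.isLt.le)).1.action k = a) ∧
          (w (i.castLE n.isLt.le)).1.state k.succ = y).card := by
        intro y
        unfold countStep
        congr 1
        refine Finset.filter_congr fun i _ => ?_
        rw [and_assoc, and_assoc]
        exact exists_state_eq_iff (hw _) hk _
      simp only [transBound, transEst, h1, h2] at hn
      convert hn
  · refine le_of_eq_of_le (lintegral_congr fun e => ?_) (M.lintegral_step_le_one φ k
      (fun y o b y' => if y = x ∧ o = ω ∧ b = a then Real.exp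
        (t * ((if y' ∈ B then 1 else 0) - ∑ i ∈ B, M.trans x ω a i) - t ^ 2 / 8) else 1) ?_ ?_)
    · rw [apply_ite ENNReal.ofReal, ENNReal.ofReal_one]
      congr
    · intro y o b y'
      split_ifs <;> positivity
    · intro y
      calc _ ≤ ∑ o, ∑ b, M.prior y o * φ y o b := by
            refine Finset.sum_le_sum fun o _ => Finset.sum_le_sum fun b _ => ?_
            simp only [stepProb, mul_assoc, ← Finset.mul_sum]
            rw [← mul_assoc]
            refine mul_le_of_le_one_right
              (mul_nonneg (M.prior_nonneg y o) (policy_nonneg φ y o b)) ?_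
            by_cases hv : y = x ∧ o = ω ∧ b = a
            · obtain ⟨rfl, rfl, rfl⟩ := hv
              simp only [and_self, if_true]
              exact sum_mul_exp_indicator_le _ (M.trans_nonneg y o b) (M.sum_trans y o b) B t
            · simp only [if_neg hv, mul_one]
              exact (M.sum_trans y o b).le
        _ = 1 := by simp only [← Finset.mul_sum, sum_policy, mul_one]

theorem interactionLaw_priorBound_lt (M : MPP S Ω A) (alg : Algorithm X Ω A L) (T : ℕ) {δ : ℝ}
    (hl : 1 ≤ Real.log ((T : ℝ) * Fintype.card X / δ)) {x : X} (hx : S.layer x ≠ Fin.last L) :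
    (M.interactionLaw alg T).real {w | (∀ t k, S.layer ((w t).1.state k) = k) ∧ ∃ n : Fin T,
      priorBound T δ (historyBefore w n) x <
        ∑ ω, |priorEst (historyBefore w n) x ω - M.prior x ω|} ≤
      2 * T * Real.exp (-Real.log ((T : ℝ) * Fintype.card X / δ)) := by
  classical
  set k : Fin L := ⟨S.layer x, Layers.val_layer_lt hx⟩
  have hk : (k : ℕ) = S.layer x := rfl
  have hne : (Finset.univ : Finset Ω).Nonempty :=
    Finset.univ_nonempty_iff.2 M.nonempty_outcome
  have h := M.interactionLaw_exists_lt_sum_abs alg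
    (fun e => e.1.state k.castSucc = x) (fun e => e.1.outcome k) Finset.univ (M.prior x) hne
    (fun ω _ => M.prior_nonneg x ω) (M.sum_prior x)
    (measurableSet_traj {τ | τ.state k.castSucc = x})
    (fun B => measurableSet_traj {τ | τ.outcome k ∈ B}) (fun φ B _ t => ?_) T hl
  · refine (measureReal_mono ?_ (measure_ne_top _ _)).trans h
    rintro w ⟨hw, n, hn⟩
    refine ⟨fun t _ => Finset.mem_univ _, n, ?_⟩
    have h1 : countState (historyBefore w n) x = (Finset.univ.filter fun i : Fin n =>
        (w (i.castLE n.isLt.le)).1.state k.castSucc = x).card := by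
      unfold countState
      congr 1
      exact Finset.filter_congr fun i _ => visitsState_iff (hw _) hk
    have h2 : ∀ ω, countOutcome (historyBefore w n) x ω = (Finset.univ.filter fun i : Fin n =>
        (w (i.castLE n.isLt.le)).1.state k.castSucc = x ∧
        (w (i.castLE n.isLt.le)).1.outcome k = ω).card := by
      intro ω
      unfold countOutcome
      congr 1
      exact Finset.filter_congr fun i _ => exists_state_eq_iff (hw _) hk _
    simp only [priorBound, priorEst, h1, h2] at hn
    exact hn
  · refine le_of_eq_of_le (lintegral_congr fun e => ?_) (M.lintegral_step_le_one φ k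
      (fun y o _ _ => if y = x then Real.exp
        (t * ((if o ∈ B then 1 else 0) - ∑ i ∈ B, M.prior x i) - t ^ 2 / 8) else 1) ?_ ?_)
    · rw [apply_ite ENNReal.ofReal, ENNReal.ofReal_one]
    · intro y o b y'
      split_ifs <;> positivity
    · intro y
      by_cases hv : y = x
      · subst hv
        simp only [if_true, stepProb, ← Finset.sum_mul, ← Finset.mul_sum, M.sum_trans, mul_one,
          sum_policy]
        exact sum_mul_exp_indicator_le _ (M.prior_nonneg y) (M.sum_prior y) B t
      · simp only [if_neg hv, mul_one]
        exact (M.sum_stepProb φ y).le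

theorem measurable_receiver_reward {X Ω A : Type*} (x : X) (ω : Ω) (a : A) :
    Measurable fun r : RewardTable X Ω A × RewardTable X Ω A => (r.2 x ω a : ℝ) :=
  measurable_subtype_coe.comp ((measurable_pi_apply a).comp ((measurable_pi_apply ω).comp
    ((measurable_pi_apply x).comp measurable_snd)))

/-- Hoeffding's lemma for the reward at a target: the trajectory, which decides whether the reward
counts, is independent of the rewards. -/
theorem lintegral_reward_le_one (M : MPP S Ω A) (φ : Policy X Ω A) (U : Set (Trajectory X Ω A L))
    [DecidablePred (· ∈ U)] (x : X) (ω : Ω) (a : A) (t : ℝ) :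
    ∫⁻ e, (if e.1 ∈ U then ENNReal.ofReal (Real.exp
      (t * ((e.2.2 x ω a : ℝ) - M.receiverMean x ω a) - t ^ 2 / 8)) else 1)
      ∂(M.episodeLaw φ) ≤ 1 := by
  have hm := measurable_receiver_reward x ω a
  have hmeas : Measurable fun e : Episode X Ω A L => if e.1 ∈ U then ENNReal.ofReal (Real.exp
      (t * ((e.2.2 x ω a : ℝ) - M.receiverMean x ω a) - t ^ 2 / 8)) else 1 := by
    refine Measurable.ite (measurableSet_traj U) ?_ measurable_const
    have := hm.comp (measurable_snd : Measurable (Prod.snd : Episode X Ω A L → _))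
    simp only [Function.comp_def] at this
    fun_prop
  rw [episodeLaw, lintegral_prod _ hmeas.aemeasurable]
  refine (lintegral_mono (g := fun _ => 1) fun τ => ?_).trans (by simp)
  by_cases hτ : τ ∈ U
  · simp only [hτ, if_true]
    have := lintegral_exp_sub_integral_le
      (M.rewardLaw : Measure (RewardTable X Ω A × RewardTable X Ω A)) hm (a := 0) (b := 1)
      (fun r => (r.2 x ω a).2) t
    simpa [receiverMean] using this
  · simp [hτ]

theorem interactionLaw_rewardBound_lt (M : MPP S Ω A) (alg : Algorithm X Ω A L) (T : ℕ) {δ : ℝ}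
    (hl : 1 ≤ Real.log (3 * (T : ℝ) * Fintype.card X * Fintype.card Ω / δ))
    {x : X} (hx : S.layer x ≠ Fin.last L) (ω : Ω) (a : A) :
    (M.interactionLaw alg T).real {w | (∀ t k, S.layer ((w t).1.state k) = k) ∧ ∃ n : Fin T,
      rewardBound T δ (historyBefore w n) x ω <
        |receiverEst (historyBefore w n) x ω a - M.receiverMean x ω a|} ≤
      2 * T * Real.exp
        (-(2 * Real.log (3 * (T : ℝ) * Fintype.card X * Fintype.card Ω / δ))) := by
  classical
  set l := Real.log (3 * (T : ℝ) * Fintype.card X * Fintype.card Ω / δ) with hldef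
  set k : Fin L := ⟨S.layer x, Layers.val_layer_lt hx⟩
  have hk : (k : ℕ) = S.layer x := rfl
  obtain ⟨U, hU⟩ : ∃ U : Set (Trajectory X Ω A L),
      ∀ τ, τ ∈ U ↔ τ.state k.castSucc = x ∧ τ.outcome k = ω :=
    ⟨{τ | τ.state k.castSucc = x ∧ τ.outcome k = ω}, fun _ => Iff.rfl⟩
  have hm := (measurable_receiver_reward x ω a).comp
    (measurable_snd : Measurable (Prod.snd : Episode X Ω A L → _))
  -- `σ = 1` and `σ = -1` give the two tails
  have hE := fun σ : ℝ => fun hσ : σ ^ 2 = 1 =>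
    M.interactionLaw_exists_sqrt_le alg (fun e => e.1 ∈ U)
    (fun e => σ * ((e.2.2 x ω a : ℝ) - M.receiverMean x ω a)) (measurableSet_traj U)
    ((hm.sub measurable_const).const_mul σ) (fun φ t => by
      have := M.lintegral_reward_le_one φ U x ω a (t * σ)
      rw [mul_pow, hσ, mul_one] at this
      simpa only [mul_assoc] using this) T (c := 2 * l) (by linarith)
  have h1 := hE 1 (by norm_num)
  have h2 := hE (-1) (by norm_num)
  refine (measureReal_mono ?_ (measure_ne_top _ _)).trans ((measureReal_union_le _ _).trans
    ((add_le_add h1 h2).trans (by linarith)))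
  rintro w ⟨hw, n, hn⟩
  set N : ℕ := (Finset.univ.filter fun i : Fin n => (w (i.castLE n.isLt.le)).1 ∈ U).card with hN
  set R : ℝ := ∑ i : Fin n, if (w (i.castLE n.isLt.le)).1 ∈ U then
    ((w (i.castLE n.isLt.le)).2.2 x ω a : ℝ) else 0 with hR
  have hcount : countOutcome (historyBefore w n) x ω = N := by
    unfold countOutcome
    rw [hN]
    congr 1
    exact Finset.filter_congr fun i _ => (exists_state_eq_iff (hw _) hk _).trans (hU _).symm
  have hest : receiverEst (historyBefore w n) x ω a = R / max 1 (N : ℝ) := by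
    rw [receiverEst_eq hw hk n ω a hU, hcount]
  have hNr : (N : ℝ) = ∑ i : Fin n, if (w (i.castLE n.isLt.le)).1 ∈ U then (1 : ℝ) else 0 := by
    rw [hN, Finset.card_filter]
    push_cast
    rfl
  have hR0 : 0 ≤ R := Finset.sum_nonneg fun i _ => by
    split_ifs
    · exact ((w (i.castLE n.isLt.le)).2.2 x ω a).2.1
    · exact le_rfl
  have hRN : R ≤ N := by
    rw [hNr]
    refine Finset.sum_le_sum fun i _ => ?_
    split_ifs
    · exact ((w (i.castLE n.isLt.le)).2.2 x ω a).2.2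
    · exact le_rfl
  have hmean := M.receiverMean_mem_Icc x ω a
  have hmax : (0 : ℝ) < max 1 (N : ℝ) := by positivity
  have habs : |receiverEst (historyBefore w n) x ω a - M.receiverMean x ω a| ≤ 1 := by
    have e1 : 0 ≤ R / max 1 (N : ℝ) := by positivity
    have e2 : R / max 1 (N : ℝ) ≤ 1 := (div_le_one hmax).2 (hRN.trans (le_max_right _ _))
    rw [hest, abs_le]
    constructor <;> linarith [hmean.1, hmean.2]
  have hsqrt : √(l / max 1 (N : ℝ)) < |R / max 1 (N : ℝ) - M.receiverMean x ω a| := by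
    rw [← hest]
    rw [rewardBound, hcount, min_lt_iff] at hn
    exact hn.resolve_left (not_lt.2 habs)
  have hN0 : 0 < N := by
    rw [Nat.pos_iff_ne_zero]
    intro h0
    rw [hest] at habs
    simp only [h0, Nat.cast_zero, max_eq_left zero_le_one, div_one] at hsqrt habs
    have : 1 ≤ √l := Real.one_le_sqrt.2 hl
    linarith
  have hN1 : (1 : ℝ) ≤ N := by exact_mod_cast hN0
  have hNpos : (0 : ℝ) < N := by linarith
  rw [max_eq_right hN1] at hsqrt
  have e2 : √((N : ℝ) * (2 * l) / 2) = N * √(l / N) := by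
    rw [← Real.sqrt_sq hNpos.le, ← Real.sqrt_mul (by positivity), Real.sqrt_sq hNpos.le]
    congr 1
    field_simp
  have e3 : ∀ σ : ℝ, (∑ i : Fin n, if (w (i.castLE n.isLt.le)).1 ∈ U then
      σ * (((w (i.castLE n.isLt.le)).2.2 x ω a : ℝ) - M.receiverMean x ω a) else 0) =
      N * (σ * (R / N - M.receiverMean x ω a)) := by
    intro σ
    have : N * (σ * (R / N - M.receiverMean x ω a)) = σ * (R - N * M.receiverMean x ω a) := by
      field_simp
    rw [this, hR, hNr, Finset.sum_mul, ← Finset.sum_sub_distrib, Finset.mul_sum]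
    refine Finset.sum_congr rfl fun i _ => ?_
    split_ifs <;> simp
  rcases lt_abs.1 hsqrt with h | h
  · left
    refine ⟨n, hN0, ?_⟩
    rw [e3]
    change √((N : ℝ) * (2 * l) / 2) ≤ _
    rw [e2, one_mul]
    exact mul_le_mul_of_nonneg_left h.le hNpos.le
  · right
    refine ⟨n, hN0, ?_⟩
    rw [e3]
    change √((N : ℝ) * (2 * l) / 2) ≤ _
    rw [e2, neg_one_mul]
    exact mul_le_mul_of_nonneg_left h.le hNpos.le

theorem one_le_log_of_seven_le {y : ℝ} (h : 7 ≤ y) : 1 ≤ Real.log y := by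
  rw [Real.le_log_iff_exp_le (by linarith)]
  linarith [Real.exp_one_lt_three]

/-- All estimates are accurate in all episodes with high probability. The number of actions does
not enter the confidence bounds for the rewards; the union bound over the actions is affordable
since there are at most `T` of them. -/
theorem interactionLaw_not_accurate (M : MPP S Ω A) (alg : Algorithm X Ω A L) {T : ℕ} (hT : 0 < T)
    [Nonempty A] (hA : Fintype.card A ≤ T) {δ : ℝ} (hδ : 0 < δ) (hδ' : δ < 1 / 7) :
    (M.interactionLaw alg T).real {w | ¬ ∀ n : Fin T, M.Accurate T δ (historyBefore w n)} ≤
      5 * δ := by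
  classical
  have hΩ : Nonempty Ω := M.nonempty_outcome
  have hX : Nonempty X := ⟨S.init⟩
  have cT : (1 : ℝ) ≤ T := by exact_mod_cast hT
  have cX : (1 : ℝ) ≤ Fintype.card X := by exact_mod_cast Fintype.card_pos
  have cO : (1 : ℝ) ≤ Fintype.card Ω := by exact_mod_cast Fintype.card_pos
  have cA : (1 : ℝ) ≤ Fintype.card A := by exact_mod_cast Fintype.card_pos
  have cAT : (Fintype.card A : ℝ) ≤ T := by exact_mod_cast hA
  have hlog : ∀ K : ℝ, 1 ≤ K → 1 ≤ Real.log (K / δ) := by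
    intro K hK
    refine one_le_log_of_seven_le ?_
    rw [le_div_iff₀ hδ]
    linarith
  have hexp : ∀ K : ℝ, 1 ≤ K → Real.exp (-Real.log (K / δ)) = δ / K := by
    intro K hK
    rw [Real.exp_neg, Real.exp_log (by positivity), inv_div]
  have hKA : (1 : ℝ) ≤ (T : ℝ) * Fintype.card X * Fintype.card Ω * Fintype.card A :=
    one_le_mul_of_one_le_of_one_le (one_le_mul_of_one_le_of_one_le
      (one_le_mul_of_one_le_of_one_le cT cX) cO) cA
  have hKX : (1 : ℝ) ≤ (T : ℝ) * Fintype.card X := one_le_mul_of_one_le_of_one_le cT cX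
  have hKR : (1 : ℝ) ≤ 3 * (T : ℝ) * Fintype.card X * Fintype.card Ω :=
    one_le_mul_of_one_le_of_one_le (one_le_mul_of_one_le_of_one_le (by linarith) cX) cO
  let B0 : Set (Fin T → Episode X Ω A L) := {w | ¬ ∀ t k, S.layer ((w t).1.state k) = k}
  let B1 : X × Ω × A → Set (Fin T → Episode X Ω A L) := fun i =>
    {w | (∀ t k, S.layer ((w t).1.state k) = k) ∧ ∃ n : Fin T,
      transBound S T δ (historyBefore w n) i.1 i.2.1 i.2.2 <
      ∑ y ∈ S.next i.1,
        |transEst (historyBefore w n) i.1 i.2.1 i.2.2 y - M.trans i.1 i.2.1 i.2.2 y|}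
  let B2 : X → Set (Fin T → Episode X Ω A L) := fun x =>
    {w | (∀ t k, S.layer ((w t).1.state k) = k) ∧ ∃ n : Fin T,
      priorBound T δ (historyBefore w n) x <
        ∑ ω, |priorEst (historyBefore w n) x ω - M.prior x ω|}
  let B3 : X × Ω × A → Set (Fin T → Episode X Ω A L) := fun i =>
    {w | (∀ t k, S.layer ((w t).1.state k) = k) ∧ ∃ n : Fin T,
      rewardBound T δ (historyBefore w n) i.1 i.2.1 <
        |receiverEst (historyBefore w n) i.1 i.2.1 i.2.2 - M.receiverMean i.1 i.2.1 i.2.2|}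
  have hsub : {w | ¬ ∀ n : Fin T, M.Accurate T δ (historyBefore w n)} ⊆
      B0 ∪ ((⋃ i ∈ S.nonfinal ×ˢ Finset.univ, B1 i) ∪
        ((⋃ x ∈ S.nonfinal, B2 x) ∪ ⋃ i ∈ S.nonfinal ×ˢ Finset.univ, B3 i)) := by
    intro w hw
    by_contra hcon
    simp only [Set.mem_union, Set.mem_iUnion, not_or, not_exists] at hcon
    obtain ⟨h0, h1, h2, h3⟩ := hcon
    have h0 : ∀ t k, S.layer ((w t).1.state k) = k := not_not.1 h0
    refine hw fun n => ⟨fun x hx ω a => ?_, fun x hx => ?_, fun x hx ω a => ?_⟩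
    · by_contra hc
      exact h1 (x, ω, a) (by simp [Layers.nonfinal, hx]) ⟨h0, n, not_le.1 hc⟩
    · by_contra hc
      exact h2 x (by simp [Layers.nonfinal, hx]) ⟨h0, n, not_le.1 hc⟩
    · by_contra hc
      exact h3 (x, ω, a) (by simp [Layers.nonfinal, hx]) ⟨h0, n, not_le.1 hc⟩
  have hcard : ((S.nonfinal ×ˢ (Finset.univ : Finset (Ω × A))).card : ℝ) ≤
      Fintype.card X * Fintype.card Ω * Fintype.card A := by
    rw [Finset.card_product, Finset.card_univ, Fintype.card_prod, mul_assoc]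
    push_cast
    gcongr
    exact Finset.card_le_univ _
  have hcard' : (S.nonfinal.card : ℝ) ≤ Fintype.card X := by
    exact_mod_cast Finset.card_le_univ _
  have hnf : ∀ i ∈ S.nonfinal ×ˢ (Finset.univ : Finset (Ω × A)), S.layer i.1 ≠ Fin.last L :=
    fun i hi => (Finset.mem_filter.1 (Finset.mem_product.1 hi).1).2
  have b1 : (M.interactionLaw alg T).real (⋃ i ∈ S.nonfinal ×ˢ Finset.univ, B1 i) ≤ 2 * δ := by
    refine (measureReal_biUnion_finset_le _ _).trans ((Finset.sum_le_card_nsmul _ _ _ fun i hi =>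
      M.interactionLaw_transBound_lt alg T (hlog _ hKA) (hnf i hi) i.2.1 i.2.2).trans ?_)
    rw [nsmul_eq_mul, hexp _ hKA]
    refine (mul_le_mul_of_nonneg_right hcard (by positivity)).trans (le_of_eq ?_)
    field_simp
  have b2 : (M.interactionLaw alg T).real (⋃ x ∈ S.nonfinal, B2 x) ≤ 2 * δ := by
    refine (measureReal_biUnion_finset_le _ _).trans ((Finset.sum_le_card_nsmul _ _ _ fun x hx =>
      M.interactionLaw_priorBound_lt alg T (hlog _ hKX) (Finset.mem_filter.1 hx).2).trans ?_)
    rw [nsmul_eq_mul, hexp _ hKX]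
    refine (mul_le_mul_of_nonneg_right hcard' (by positivity)).trans (le_of_eq ?_)
    field_simp
  have b3 : (M.interactionLaw alg T).real (⋃ i ∈ S.nonfinal ×ˢ Finset.univ, B3 i) ≤ δ := by
    refine (measureReal_biUnion_finset_le _ _).trans ((Finset.sum_le_card_nsmul _ _ _ fun i hi =>
      M.interactionLaw_rewardBound_lt alg T (hlog _ hKR) (hnf i hi) i.2.1 i.2.2).trans ?_)
    have e1 : Real.exp (-(2 * Real.log (3 * (T : ℝ) * Fintype.card X * Fintype.card Ω / δ))) =
        (δ / (3 * (T : ℝ) * Fintype.card X * Fintype.card Ω)) ^ 2 := by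
      rw [← hexp _ hKR, ← Real.exp_nat_mul]
      congr 1
      push_cast
      ring
    rw [nsmul_eq_mul, e1]
    refine (mul_le_mul_of_nonneg_right hcard (by positivity)).trans ?_
    have e2 : (Fintype.card X * Fintype.card Ω * Fintype.card A : ℝ) *
        (2 * T * (δ / (3 * (T : ℝ) * Fintype.card X * Fintype.card Ω)) ^ 2) =
        (2 / 9 * δ) * (Fintype.card A / T) * (1 / (Fintype.card X * Fintype.card Ω)) * δ := by
      field_simp
      ring
    rw [e2]
    have e3 : (Fintype.card A : ℝ) / T ≤ 1 := (div_le_one (by linarith)).2 cAT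
    have e4 : (1 : ℝ) / (Fintype.card X * Fintype.card Ω) ≤ 1 :=
      (div_le_one (by positivity)).2 (one_le_mul_of_one_le_of_one_le cX cO)
    have e5 : 2 / 9 * δ * (Fintype.card A / T) * (1 / (Fintype.card X * Fintype.card Ω)) ≤ 1 :=
      mul_le_one₀ (mul_le_one₀ (by linarith) (by positivity) e3) (by positivity) e4
    exact mul_le_of_le_one_left hδ.le e5
  have b0 : (M.interactionLaw alg T).real B0 = 0 := M.interactionLaw_not_layered alg T
  refine (measureReal_mono hsub (measure_ne_top _ _)).trans ((measureReal_union_le _ _).trans ?_)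
  have u1 := measureReal_union_le (μ := M.interactionLaw alg T)
    (⋃ i ∈ S.nonfinal ×ˢ Finset.univ, B1 i)
    ((⋃ x ∈ S.nonfinal, B2 x) ∪ ⋃ i ∈ S.nonfinal ×ˢ Finset.univ, B3 i)
  have u2 := measureReal_union_le (μ := M.interactionLaw alg T)
    (⋃ x ∈ S.nonfinal, B2 x) (⋃ i ∈ S.nonfinal ×ˢ Finset.univ, B3 i)
  linarith

end MPP

/-! ### The sum of the bonuses -/

section Pathwise

open Classical in
/-- A sum along the visits to a target, each with weight `1 / √N` for the number `N` of earlier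
visits. -/
theorem sum_one_div_sqrt_card_le (T : ℕ) : ∀ v : Fin T → Prop,
    (∑ t : Fin T, if v t then
      1 / √(max 1 ((Finset.univ.filter fun i : Fin t => v (i.castLE t.isLt.le)).card : ℝ)) else 0) ≤
    3 * √((Finset.univ.filter v).card : ℝ) := by
  induction T with
  | zero => intro v; simp
  | succ T ih =>
    intro v
    have h := ih fun t => v t.castSucc
    set N : ℕ := (Finset.univ.filter fun t : Fin T => v t.castSucc).card with hN
    have h1 : (Finset.univ.filter v).card = N + if v (Fin.last T) then 1 else 0 := by
      rw [hN, Finset.card_filter, Finset.card_filter, Fin.sum_univ_castSucc]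
    rw [Fin.sum_univ_castSucc, h1]
    have h2 : (∑ t : Fin T, if v t.castSucc then 1 / √(max 1 ((Finset.univ.filter
        fun i : Fin t.castSucc => v (i.castLE t.castSucc.isLt.le)).card : ℝ)) else 0) ≤
      3 * √(N : ℝ) := h
    have h3 : (Finset.univ.filter
      fun i : Fin (Fin.last T) => v (i.castLE (Fin.last T).isLt.le)).card = N := rfl
    rw [h3]
    by_cases hv : v (Fin.last T)
    · rw [if_pos hv, if_pos hv]
      push_cast
      refine (add_le_add_left h2 _).trans ?_
      rcases Nat.eq_zero_or_pos N with h0 | h0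
      · rw [h0]
        norm_num
      · have hN1 : (1 : ℝ) ≤ N := by exact_mod_cast h0
        rw [max_eq_right hN1]
        set s := √(N : ℝ) with hs
        set u := √((N : ℝ) + 1) with hu
        have hs2 : s ^ 2 = N := Real.sq_sqrt (by linarith)
        have hu2 : u ^ 2 = N + 1 := Real.sq_sqrt (by linarith)
        have hs1 : 1 ≤ s := Real.one_le_sqrt.2 hN1
        have hu1 : u ≤ 2 * s := by
          refine Real.sqrt_le_iff.2 ⟨by linarith, ?_⟩
          rw [mul_pow, hs2]
          linarith
        have hsu : s ≤ u := Real.sqrt_le_sqrt (by linarith)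
        have h4 : (u - s) * (3 * s) ≥ 1 := by nlinarith
        have h5 : 1 / s ≤ 3 * (u - s) := by
          rw [div_le_iff₀ (by linarith)]
          linarith
        linarith
    · rw [if_neg hv, if_neg hv]
      simpa using h2

open Classical in
/-- The sum of `1 / √N` over all visits to a finite family of targets, at most `L` of which are
visited in each episode. -/
theorem sum_sum_one_div_sqrt_card_le {I : Type*} [Fintype I] {T L : ℕ} (v : Fin T → I → Prop)
    (hv : ∀ t, (∑ i, if v t i then (1 : ℝ) else 0) ≤ L) :
    (∑ t : Fin T, ∑ i, if v t i then
      1 / √(max 1 ((Finset.univ.filter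
        fun j : Fin t => v (j.castLE t.isLt.le) i).card : ℝ)) else 0) ≤
    3 * √((Fintype.card I : ℝ) * (L * T)) := by
  rw [Finset.sum_comm]
  refine (Finset.sum_le_sum fun i _ => sum_one_div_sqrt_card_le T fun t => v t i).trans ?_
  rw [← Finset.mul_sum]
  refine mul_le_mul_of_nonneg_left (Real.le_sqrt_of_sq_le ?_) (by norm_num)
  refine (sq_sum_le_card_mul_sum_sq (s := Finset.univ)
    (f := fun i => √((Finset.univ.filter fun t => v t i).card : ℝ))).trans ?_
  rw [Finset.card_univ]
  refine mul_le_mul_of_nonneg_left ?_ (Nat.cast_nonneg _)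
  have h1 : ∀ i, √((Finset.univ.filter fun t => v t i).card : ℝ) ^ 2 =
      ∑ t, if v t i then (1 : ℝ) else 0 := by
    intro i
    rw [Real.sq_sqrt (Nat.cast_nonneg _), Finset.card_filter]
    push_cast
    rfl
  simp only [h1]
  rw [Finset.sum_comm]
  refine (Finset.sum_le_sum fun t _ => hv t).trans ?_
  simp [mul_comm]

open Classical in
/-- A trajectory makes at most `L` visits, one in each step. -/
theorem sum_ite_le_of_exists {I : Type*} [Fintype I] {L : ℕ} (f : Fin L → I) (p : I → Prop)
    (hp : ∀ i, p i → ∃ k, f k = i) (c : I → ℝ) (hc : ∀ i, 0 ≤ c i) :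
    (∑ i, if p i then c i else 0) ≤ ∑ k, c (f k) := by
  calc _ ≤ ∑ i, ∑ k, if f k = i then c i else 0 := by
        refine Finset.sum_le_sum fun i _ => ?_
        have h0 : ∀ k, 0 ≤ if f k = i then c i else 0 := fun k => by
          split_ifs
          · exact hc i
          · exact le_rfl
        split_ifs with h
        · obtain ⟨k, hk⟩ := hp i h
          refine le_trans ?_ (Finset.single_le_sum (fun k _ => h0 k) (Finset.mem_univ k))
          rw [if_pos hk]
        · exact Finset.sum_nonneg fun k _ => h0 k
    _ = _ := by
        rw [Finset.sum_comm]
        simp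

open Classical in
theorem sum_ite_one_le_of_exists {I : Type*} [Fintype I] {L : ℕ} (f : Fin L → I) (p : I → Prop)
    (hp : ∀ i, p i → ∃ k, f k = i) : (∑ i, if p i then (1 : ℝ) else 0) ≤ L :=
  (sum_ite_le_of_exists f p hp (fun _ => 1) fun _ => zero_le_one).trans (by simp)

theorem exists_of_visitsOutcome {X Ω A : Type*} {L : ℕ} (τ : Trajectory X Ω A L) (i : X × Ω)
    (h : τ.VisitsOutcome i.1 i.2) : ∃ k : Fin L, (τ.state k.castSucc, τ.outcome k) = i :=
  let ⟨k, h1, h2⟩ := h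
  ⟨k, Prod.ext h1 h2⟩

theorem exists_of_visitsAction {X Ω A : Type*} {L : ℕ} (τ : Trajectory X Ω A L) (i : X × Ω × A)
    (h : τ.VisitsAction i.1 i.2.1 i.2.2) :
    ∃ k : Fin L, (τ.state k.castSucc, τ.outcome k, τ.action k) = i :=
  let ⟨k, h1, h2, h3⟩ := h
  ⟨k, Prod.ext h1 (Prod.ext h2 h3)⟩

end Pathwise

section Bonus

variable {X Ω A : Type*} [Fintype X] [Fintype Ω] [Fintype A] {L n : ℕ} {S : Layers X L}

open Classical in
/-- The bonus, with the visits indexed by pairs and triples. -/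
theorem bonus_eq (T : ℕ) (δ : ℝ) (h : Fin n → Feedback X Ω A L) (τ : Trajectory X Ω A L) :
    bonus S T δ h τ =
      (∑ i : X × Ω, if τ.VisitsOutcome i.1 i.2 then
        4 * rewardBound T δ h i.1 i.2 else 0) +
      (∑ x, if τ.VisitsState x then
        (10 + 2 * L) * min 1 (priorBound T δ h x) else 0) +
      ∑ i : X × Ω × A, if τ.VisitsAction i.1 i.2.1 i.2.2 then
        2 * L * min 1 (transBound S T δ h i.1 i.2.1 i.2.2) else 0 := by
  unfold bonus
  rw [Finset.sum_add_distrib, Finset.sum_add_distrib]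
  simp only [Fintype.sum_prod_type]

theorem bonus_nonneg (T : ℕ) (δ : ℝ) (h : Fin n → Feedback X Ω A L) (τ : Trajectory X Ω A L) :
    0 ≤ bonus S T δ h τ := by
  classical
  rw [bonus_eq]
  refine add_nonneg (add_nonneg (Finset.sum_nonneg fun i _ => ?_) (Finset.sum_nonneg fun i _ => ?_))
    (Finset.sum_nonneg fun i _ => ?_)
  · have := rewardBound_nonneg T δ h i.1 i.2
    split_ifs <;> positivity
  · have : 0 ≤ min 1 (priorBound T δ h i) := le_min zero_le_one (Real.sqrt_nonneg _)
    split_ifs <;> positivity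
  · have : 0 ≤ min 1 (transBound S T δ h i.1 i.2.1 i.2.2) := le_min zero_le_one (Real.sqrt_nonneg _)
    split_ifs <;> positivity

theorem bonus_le (T : ℕ) (δ : ℝ) (h : Fin n → Feedback X Ω A L) (τ : Trajectory X Ω A L) :
    bonus S T δ h τ ≤ 18 * (L : ℝ) ^ 2 := by
  classical
  rw [bonus_eq]
  have h1 := sum_ite_le_of_exists (fun k : Fin L => (τ.state k.castSucc, τ.outcome k))
    _ (exists_of_visitsOutcome τ)
    (fun i => 4 * rewardBound T δ h i.1 i.2) fun i => by
      have := rewardBound_nonneg T δ h i.1 i.2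
      positivity
  have h2 := sum_ite_le_of_exists (fun k : Fin L => τ.state k.castSucc)
    (fun x => τ.VisitsState x) (fun _ h => h)
    (fun x => (10 + 2 * L) * min 1 (priorBound T δ h x)) fun i => by
      have : 0 ≤ min 1 (priorBound T δ h i) := le_min zero_le_one (Real.sqrt_nonneg _)
      positivity
  have h3 := sum_ite_le_of_exists (fun k : Fin L => (τ.state k.castSucc, τ.outcome k, τ.action k))
    _ (exists_of_visitsAction τ)
    (fun i => 2 * L * min 1 (transBound S T δ h i.1 i.2.1 i.2.2)) fun i => by
      have : 0 ≤ min 1 (transBound S T δ h i.1 i.2.1 i.2.2) :=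
        le_min zero_le_one (Real.sqrt_nonneg _)
      positivity
  have g1 : ∑ k : Fin L, 4 * rewardBound T δ h (τ.state k.castSucc) (τ.outcome k) ≤
      ∑ k : Fin L, 4 := Finset.sum_le_sum fun k _ => by
    linarith [rewardBound_le_one T δ h (τ.state k.castSucc) (τ.outcome k)]
  have g2 : ∑ k : Fin L, (10 + 2 * L) * min 1 (priorBound T δ h (τ.state k.castSucc)) ≤
      ∑ k : Fin L, (10 + 2 * (L : ℝ)) :=
    Finset.sum_le_sum fun k _ => mul_le_of_le_one_right (by positivity) (min_le_left _ _)
  have g3 : ∑ k : Fin L, 2 * L * min 1 (transBound S T δ h (τ.state k.castSucc) (τ.outcome k)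
      (τ.action k)) ≤ ∑ k : Fin L, 2 * (L : ℝ) :=
    Finset.sum_le_sum fun k _ => mul_le_of_le_one_right (by positivity) (min_le_left _ _)
  simp only [Finset.sum_const, Finset.card_univ, Fintype.card_fin, nsmul_eq_mul] at g1 g2 g3
  have hL : (L : ℝ) ≤ (L : ℝ) ^ 2 := by exact_mod_cast Nat.le_self_pow two_ne_zero L
  have := (add_le_add (add_le_add (h1.trans g1) (h2.trans g2)) (h3.trans g3))
  refine this.trans ?_
  nlinarith

open Classical in
/-- On every realization, the sum of the bonuses is of the order `√T`. -/
theorem sum_bonus_le {T : ℕ} (w : Fin T → Episode X Ω A L) {δ : ℝ}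
    (hl : 0 ≤ Real.log ((T : ℝ) * Fintype.card X * Fintype.card Ω * Fintype.card A / δ)) :
    ∑ t, bonus S T δ (historyBefore w t) (w t).1 ≤
      4 * √(Real.log (3 * (T : ℝ) * Fintype.card X * Fintype.card Ω / δ)) *
        (3 * √((Fintype.card X * Fintype.card Ω : ℝ) * (L * T))) +
      (10 + 2 * L) * √(2 * (Fintype.card Ω : ℝ) * Real.log ((T : ℝ) * Fintype.card X / δ)) *
        (3 * √((Fintype.card X : ℝ) * (L * T))) +
      2 * L * √(2 * (Fintype.card X : ℝ) *
        Real.log ((T : ℝ) * Fintype.card X * Fintype.card Ω * Fintype.card A / δ)) *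
        (3 * √((Fintype.card X * Fintype.card Ω * Fintype.card A : ℝ) * (L * T))) := by
  simp only [bonus_eq, Finset.sum_add_distrib]
  refine add_le_add (add_le_add ?_ ?_) ?_
  · have h := sum_sum_one_div_sqrt_card_le (T := T) (L := L)
      (fun t (i : X × Ω) => (w t).1.VisitsOutcome i.1 i.2)
      fun t => sum_ite_one_le_of_exists _ _ (exists_of_visitsOutcome _)
    rw [Fintype.card_prod, Nat.cast_mul] at h
    refine le_trans ?_ (mul_le_mul_of_nonneg_left h (by positivity))
    rw [Finset.mul_sum]
    refine Finset.sum_le_sum fun t _ => ?_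
    rw [Finset.mul_sum]
    refine Finset.sum_le_sum fun i _ => ?_
    rw [mul_ite, mul_zero]
    split_ifs
    swap
    · exact le_rfl
    rw [mul_assoc]
    refine mul_le_mul_of_nonneg_left ((min_le_right _ _).trans (le_of_eq ?_)) (by norm_num)
    rw [Real.sqrt_div' _ (by positivity), mul_one_div]
    rfl
  · have h := sum_sum_one_div_sqrt_card_le (T := T) (L := L)
      (fun t (i : X) => (w t).1.VisitsState i) fun t => sum_ite_one_le_of_exists _ _ fun _ h => h
    refine le_trans ?_ (mul_le_mul_of_nonneg_left h (by positivity))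
    rw [Finset.mul_sum]
    refine Finset.sum_le_sum fun t _ => ?_
    rw [Finset.mul_sum]
    refine Finset.sum_le_sum fun i _ => ?_
    rw [mul_ite, mul_zero]
    split_ifs
    swap
    · exact le_rfl
    rw [mul_assoc]
    refine mul_le_mul_of_nonneg_left ((min_le_right _ _).trans (le_of_eq ?_)) (by positivity)
    rw [priorBound, Real.sqrt_div' _ (by positivity), mul_one_div]
    rfl
  · have h := sum_sum_one_div_sqrt_card_le (T := T) (L := L)
      (fun t (i : X × Ω × A) => (w t).1.VisitsAction i.1 i.2.1 i.2.2)
      fun t => sum_ite_one_le_of_exists _ _ (exists_of_visitsAction _)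
    rw [Fintype.card_prod, Fintype.card_prod, Nat.cast_mul, Nat.cast_mul, ← mul_assoc
      (Fintype.card X : ℝ)] at h
    refine le_trans ?_ (mul_le_mul_of_nonneg_left h (by positivity))
    rw [Finset.mul_sum]
    refine Finset.sum_le_sum fun t _ => ?_
    rw [Finset.mul_sum]
    refine Finset.sum_le_sum fun i _ => ?_
    rw [mul_ite, mul_zero]
    split_ifs
    swap
    · exact le_rfl
    rw [mul_assoc (2 * (L : ℝ)) (√_)]
    refine mul_le_mul_of_nonneg_left ((min_le_right _ _).trans ?_)
      (by positivity : (0 : ℝ) ≤ 2 * L)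
    rw [transBound, Real.sqrt_div' _ (by positivity), mul_one_div]
    have e1 : ((S.next i.1).card : ℝ) ≤ Fintype.card X := by exact_mod_cast Finset.card_le_univ _
    refine le_trans (b := √(2 * (Fintype.card X : ℝ) *
      Real.log ((T : ℝ) * Fintype.card X * Fintype.card Ω * Fintype.card A / δ)) /
      √(max 1 (countAction (historyBefore w t) i.1 i.2.1 i.2.2 : ℝ))) ?_ le_rfl
    gcongr

end Bonus

namespace MPP

variable {X Ω A : Type*} [Fintype X] [Fintype Ω] [Fintype A] {L : ℕ} {S : Layers X L}

/-- The Azuma-Hoeffding inequality for functions of the trajectories, centred at their conditional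
means. -/
theorem interactionLaw_azuma (M : MPP S Ω A) (alg : Algorithm X Ω A L)
    (F : (n : ℕ) → (Fin n → Trajectory X Ω A L) → Trajectory X Ω A L → ℝ) {R : ℝ} (hR : 0 < R)
    (hF : ∀ n σ τ, F n σ τ ∈ Set.Icc 0 R) {T : ℕ} (hT : 0 < T) {c : ℝ} (hc : 0 ≤ c) :
    (M.interactionLaw alg T).real {w | R * √(T * c / 2) ≤ ∑ t : Fin T,
      ((∑ τ, M.trajProb (policyAfter alg fun i : Fin t => w (i.castLE t.isLt.le)) τ *
        F t (fun i => (w (i.castLE t.isLt.le)).1) τ) -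
        F t (fun i => (w (i.castLE t.isLt.le)).1) (w t).1)} ≤ Real.exp (-c) := by
  set b := √(T * c / 2) with hb
  have hTr : (0 : ℝ) < T := by exact_mod_cast hT
  have hb2 : b ^ 2 = T * c / 2 := Real.sq_sqrt (by positivity)
  -- the minimizer of `s ↦ T * s ^ 2 * R ^ 2 / 8 - s * R * b`
  let s : ℝ := 4 * b / (T * R)
  let D : (n : ℕ) → (Fin n → Episode X Ω A L) → Episode X Ω A L → ℝ := fun n w e =>
    (∑ τ, M.trajProb (policyAfter alg w) τ * F n (fun i => (w i).1) τ) - F n (fun i => (w i).1) e.1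
  let g : (n : ℕ) → (Fin n → Episode X Ω A L) → Episode X Ω A L → ENNReal := fun n w e =>
    ENNReal.ofReal (Real.exp (s * D n w e - s ^ 2 * R ^ 2 / 8))
  have hg : ∀ n, Measurable (Function.uncurry (g n)) := by
    intro n
    have h1 : Measurable fun p : (Fin n → Episode X Ω A L) × Episode X Ω A L =>
        ((fun i => (p.1 i).1 : Fin n → Trajectory X Ω A L), p.2.1) :=
      Measurable.prodMk (measurable_pi_lambda _ fun i =>
        measurable_fst.comp ((measurable_pi_apply i).comp measurable_fst))
        (measurable_fst.comp measurable_snd)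
    have h2 : Measurable fun p : (Fin n → Episode X Ω A L) × Episode X Ω A L =>
        F n (fun i => (p.1 i).1) p.2.1 :=
      (Measurable.of_discrete (f := fun r : (Fin n → Trajectory X Ω A L) × Trajectory X Ω A L =>
        F n r.1 r.2)).comp h1
    have h3 : ∀ τ, Measurable fun p : (Fin n → Episode X Ω A L) × Episode X Ω A L =>
        F n (fun i => (p.1 i).1) τ := fun τ =>
      (Measurable.of_discrete (f := fun r : (Fin n → Trajectory X Ω A L) × Trajectory X Ω A L =>
        F n r.1 τ)).comp h1
    have h4 : ∀ τ, Measurable fun p : (Fin n → Episode X Ω A L) × Episode X Ω A L =>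
        M.trajProb (policyAfter alg p.1) τ := fun τ =>
      (M.measurable_trajProb τ).comp ((measurable_policyAfter alg n).comp measurable_fst)
    have h5 : Measurable fun p : (Fin n → Episode X Ω A L) × Episode X Ω A L => D n p.1 p.2 :=
      (Finset.measurable_fun_sum _ fun τ _ => (h4 τ).mul (h3 τ)).sub h2
    change Measurable fun p : (Fin n → Episode X Ω A L) × Episode X Ω A L =>
      ENNReal.ofReal (Real.exp (s * D n p.1 p.2 - s ^ 2 * R ^ 2 / 8))
    fun_prop
  have hg1 : ∀ n w, ∫⁻ e, g n w e ∂(M.episodeLaw (policyAfter alg w)) ≤ 1 := by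
    intro n w
    rw [M.lintegral_episodeLaw_fst _ fun τ => ENNReal.ofReal (Real.exp (s * ((∑ τ,
      M.trajProb (policyAfter alg w) τ * F n (fun i => (w i).1) τ) - F n (fun i => (w i).1) τ) -
      s ^ 2 * R ^ 2 / 8))]
    simp only [← ENNReal.ofReal_mul (M.trajProb_nonneg _ _)]
    rw [← ENNReal.ofReal_sum_of_nonneg fun τ _ => mul_nonneg (M.trajProb_nonneg _ τ)
      (Real.exp_nonneg _), ENNReal.ofReal_le_one]
    have := sum_mul_exp_le (M.trajProb (policyAfter alg w)) (F n fun i => (w i).1)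
      (M.trajProb_nonneg _) (M.sum_trajProb _) (hF n _) (-s)
    refine le_of_eq_of_le (Finset.sum_congr rfl fun τ _ => ?_) this
    congr 2
    ring
  have hmark := meas_ge_le_lintegral_div (μ := M.interactionLaw alg T)
    (measurable_prod_prefix (T := T) g hg).aemeasurable
    (ε := ENNReal.ofReal (Real.exp c)) (by simp [Real.exp_pos]) ENNReal.ofReal_ne_top
  have hle := hmark.trans (ENNReal.div_le_div_right
    (M.lintegral_prod_interactionLaw_le alg g hg hg1 T) _)
  rw [measureReal_def]
  refine ENNReal.toReal_le_of_le_ofReal (Real.exp_nonneg _) ((measure_mono fun w hw => ?_).trans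
    (hle.trans (le_of_eq ?_)))
  · simp only [Set.mem_ofPred_eq, g] at hw ⊢
    rw [← ENNReal.ofReal_prod_of_nonneg (fun _ _ => Real.exp_nonneg _), ← Real.exp_sum]
    refine ENNReal.ofReal_le_ofReal (Real.exp_le_exp.2 ?_)
    rw [Finset.sum_sub_distrib, ← Finset.mul_sum, Finset.sum_const, Finset.card_univ,
      Fintype.card_fin, nsmul_eq_mul]
    have hs0 : 0 ≤ s := by positivity
    have e1 : s * (R * b) = 2 * c := by
      simp only [s]
      field_simp
      rw [hb2]
      ring
    have e2 : T * (s ^ 2 * R ^ 2 / 8) = c := by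
      simp only [s]
      field_simp
      rw [hb2]
      ring
    have := mul_le_mul_of_nonneg_left hw hs0
    rw [e2]
    rw [e1] at this
    simp only [D]
    linarith
  · rw [Real.exp_neg, ENNReal.ofReal_inv_of_pos (Real.exp_pos c), one_div]

end MPP

/-! ### The bound on the cumulative violation -/

namespace MPP

variable {X Ω A : Type*} [Fintype X] [Fintype Ω] [Fintype A] {L : ℕ} {S : Layers X L}

/-- The mean of the bonus of an episode, given the past. -/
noncomputable def meanBonus (M : MPP S Ω A) (alg : Algorithm X Ω A L) (T : ℕ) (δ : ℝ)
    (w : Fin T → Episode X Ω A L) (t : Fin T) : ℝ :=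
  ∑ τ, M.trajProb (policyAfter alg fun i : Fin t => w (i.castLE t.isLt.le)) τ *
    bonus S T δ (historyBefore w t) τ

theorem interactionLaw_meanBonus (M : MPP S Ω A) (alg : Algorithm X Ω A L) {T : ℕ} (hT : 0 < T)
    (hL : 0 < L) {δ : ℝ} (hδ : 0 < δ) (hδ1 : δ ≤ 1) :
    (M.interactionLaw alg T).real {w | 18 * (L : ℝ) ^ 2 * √(T * Real.log (1 / δ) / 2) ≤
      ∑ t, (M.meanBonus alg T δ w t - bonus S T δ (historyBefore w t) (w t).1)} ≤ δ := by
  have hLr : (0 : ℝ) < L := by exact_mod_cast hL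
  -- the bonus reads the trajectories only, so that arbitrary rewards can be filled in
  have h := M.interactionLaw_azuma alg
    (fun n σ τ => bonus S T δ (fun i : Fin n => (σ i, fun _ _ => 0, fun _ _ => 0)) τ)
    (R := 18 * (L : ℝ) ^ 2) (by positivity)
    (fun n σ τ => ⟨bonus_nonneg _ _ _ _, bonus_le _ _ _ _⟩) hT
    (Real.log_nonneg (by rwa [one_le_div hδ]) : 0 ≤ Real.log (1 / δ))
  have e1 : Real.exp (-Real.log (1 / δ)) = δ := by
    rw [one_div, Real.log_inv, neg_neg, Real.exp_log hδ]
  rw [e1] at h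
  exact h

/-- The sum of the bonuses and of the deviation from their means, in terms of the rate. -/
theorem rate_bound {X O A L T l l₁ l₂ l₃ : ℝ} (hX : 1 ≤ X) (hO : 1 ≤ O) (hA : 1 ≤ A) (hL : 1 ≤ L)
    (hT : 0 ≤ T) (hl : 0 ≤ l) (h₁ : l₁ ≤ 2 * l) (h₂ : l₂ ≤ l) (h₃ : l₃ ≤ l) :
    4 * √l₁ * (3 * √(X * O * (L * T))) + (10 + 2 * L) * √(2 * O * l₂) * (3 * √(X * (L * T))) +
      2 * L * √(2 * X * l) * (3 * √(X * O * A * (L * T))) + 18 * L ^ 2 * √(T * l₃ / 2) ≤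
    126 * (L ^ 2 * X * √(T * A * O * l)) := by
  set Q := √(T * A * O * l) with hQ
  have hQ0 : 0 ≤ Q := Real.sqrt_nonneg _
  have hA0 : 0 ≤ A := by linarith
  have hO0 : 0 ≤ O := by linarith
  have hX0 : 0 ≤ X := by linarith
  have hL0 : 0 ≤ L := by linarith
  have key : ∀ y, y ≤ (2 * X * L) ^ 2 * (T * A * O * l) → √y ≤ 2 * X * L * Q := by
    intro y hy
    rw [hQ, ← Real.sqrt_sq (by positivity : 0 ≤ 2 * X * L), ← Real.sqrt_mul (by positivity)]
    exact Real.sqrt_le_sqrt hy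
  have hTO : 0 ≤ T * O * l := by positivity
  have hXL : 1 ≤ X * L := one_le_mul_of_one_le_of_one_le hX hL
  have hXLA : 1 ≤ X * L * A := one_le_mul_of_one_le_of_one_le hXL hA
  have b1 : √l₁ * √(X * O * (L * T)) ≤ 2 * X * L * Q := by
    rw [← Real.sqrt_mul' _ (by positivity)]
    refine key _ ?_
    have e1 : l₁ * (X * O * (L * T)) ≤ 2 * l * (X * O * (L * T)) :=
      mul_le_mul_of_nonneg_right h₁ (by positivity)
    have e2 : (0 : ℝ) ≤ (T * O * l) * (X * L) * (2 * (X * L * A) - 1) :=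
      mul_nonneg (by positivity) (by linarith)
    nlinarith
  have b2 : √(2 * O * l₂) * √(X * (L * T)) ≤ 2 * X * L * Q := by
    rw [← Real.sqrt_mul' _ (by positivity)]
    refine key _ ?_
    have e1 : 2 * O * l₂ * (X * (L * T)) ≤ 2 * O * l * (X * (L * T)) := by gcongr
    have e2 : (0 : ℝ) ≤ (T * O * l) * (X * L) * (2 * (X * L * A) - 1) :=
      mul_nonneg (by positivity) (by linarith)
    nlinarith
  have b3 : √(2 * X * l) * √(X * O * A * (L * T)) ≤ 2 * X * L * Q := by
    rw [← Real.sqrt_mul' _ (by positivity)]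
    refine key _ ?_
    have e2 : (0 : ℝ) ≤ (T * O * l) * (X ^ 2 * L * A) * (2 * L - 1) :=
      mul_nonneg (by positivity) (by linarith)
    nlinarith
  have b4 : √(T * l₃ / 2) ≤ Q := by
    refine Real.sqrt_le_sqrt ?_
    have e1 : T * l₃ ≤ T * l := mul_le_mul_of_nonneg_left h₃ hT
    have e2 : (T * l) * 1 ≤ (T * l) * (A * O) :=
      mul_le_mul_of_nonneg_left (one_le_mul_of_one_le_of_one_le hA hO) (by positivity)
    have e3 : 0 ≤ T * l := by positivity
    nlinarith
  have c1 : L * (X * Q) ≤ L ^ 2 * (X * Q) :=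
    mul_le_mul_of_nonneg_right (by nlinarith) (by positivity)
  have c2 : L ^ 2 * Q ≤ L ^ 2 * (X * Q) :=
    mul_le_mul_of_nonneg_left (le_mul_of_one_le_left hQ0 hX) (by positivity)
  have d2 : (10 + 2 * L) * (√(2 * O * l₂) * √(X * (L * T))) ≤ 12 * L * (2 * X * L * Q) :=
    mul_le_mul (by linarith) b2 (by positivity) (by positivity)
  have d3 : 2 * L * (√(2 * X * l) * √(X * O * A * (L * T))) ≤ 2 * L * (2 * X * L * Q) :=
    mul_le_mul_of_nonneg_left b3 (by positivity)
  have d4 : L ^ 2 * √(T * l₃ / 2) ≤ L ^ 2 * Q := mul_le_mul_of_nonneg_left b4 (by positivity)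
  linarith

variable [Nonempty A]

theorem violation_le_mul (M : MPP S Ω A) (alg : Algorithm X Ω A L) (T : ℕ)
    (w : Fin T → Episode X Ω A L) : M.violation alg T w ≤ T * L := by
  refine (Finset.sum_le_sum (g := fun _ => (L : ℝ)) fun t _ =>
    M.sum_occAction_mul_le _ fun a x => M.bestResponse _ a x).trans ?_
  simp

theorem violation_le_sum_meanBonus (M : MPP S Ω A) {alg : Algorithm X Ω A L} {T : ℕ} {δ : ℝ}
    (halg : alg.IsOPPS S T δ) {w : Fin T → Episode X Ω A L}
    (hw : ∀ n : Fin T, M.Accurate T δ (historyBefore w n)) :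
    M.violation alg T w ≤ ∑ t, M.meanBonus alg T δ w t := by
  refine Finset.sum_le_sum fun t _ => ?_
  obtain ⟨q, ⟨⟨ζ, ε, hq⟩, -⟩, hφ⟩ := halg t t.isLt (historyBefore w t) (hw t).exists_feasible
  exact M.sum_occAction_mul_le_sum_bonus (hw t) hq hφ fun a x => M.bestResponse _ a x

/-- The first of the two bounds on the violation. -/
theorem interactionLaw_violation_le (M : MPP S Ω A) {alg : Algorithm X Ω A L} {T : ℕ} {δ : ℝ}
    (hδ : 0 < δ) (hδ' : δ < 1 / 7) (halg : alg.IsOPPS S T δ) :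
    1 - 7 * δ ≤ (M.interactionLaw alg T).real {w | M.violation alg T w ≤
      126 * ((L : ℝ) ^ 2 * Fintype.card X * √((T : ℝ) * Fintype.card A * Fintype.card Ω *
        Real.log ((T : ℝ) * Fintype.card X * Fintype.card Ω * Fintype.card A / δ)))} := by
  have hΩ : Nonempty Ω := M.nonempty_outcome
  have hX : Nonempty X := ⟨S.init⟩
  have cX : (1 : ℝ) ≤ Fintype.card X := by exact_mod_cast Fintype.card_pos
  have cO : (1 : ℝ) ≤ Fintype.card Ω := by exact_mod_cast Fintype.card_pos
  have cA : (1 : ℝ) ≤ Fintype.card A := by exact_mod_cast Fintype.card_pos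
  set l := Real.log ((T : ℝ) * Fintype.card X * Fintype.card Ω * Fintype.card A / δ) with hl
  set B := 126 * ((L : ℝ) ^ 2 * Fintype.card X * √((T : ℝ) * Fintype.card A * Fintype.card Ω * l))
    with hB
  have hB0 : 0 ≤ B := by positivity
  -- the violation is at most `T L`, which settles the degenerate cases
  have htriv : (T * L : ℝ) ≤ B →
      1 - 7 * δ ≤ (M.interactionLaw alg T).real {w | M.violation alg T w ≤ B} := by
    intro h
    have : {w | M.violation alg T w ≤ B} = Set.univ :=
      Set.eq_univ_of_forall fun w => (M.violation_le_mul alg T w).trans h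
    rw [this, probReal_univ]
    linarith
  rcases Nat.eq_zero_or_pos T with hT | hT
  · exact htriv (by rw [hT, Nat.cast_zero, zero_mul]; exact hB0)
  rcases Nat.eq_zero_or_pos L with hL | hL
  · refine htriv ?_
    have : (L : ℝ) = 0 := by exact_mod_cast hL
    rw [this, mul_zero]
    exact hB0
  have cT : (1 : ℝ) ≤ T := by exact_mod_cast hT
  have cL : (1 : ℝ) ≤ L := by exact_mod_cast hL
  have hKA : (1 : ℝ) ≤ (T : ℝ) * Fintype.card X * Fintype.card Ω * Fintype.card A :=
    one_le_mul_of_one_le_of_one_le (one_le_mul_of_one_le_of_one_le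
      (one_le_mul_of_one_le_of_one_le cT cX) cO) cA
  have hdiv : ∀ K : ℝ, 1 ≤ K → 7 ≤ K / δ := by
    intro K hK
    rw [le_div_iff₀ hδ]
    linarith
  have hl1 : 1 ≤ l := one_le_log_of_seven_le (hdiv _ hKA)
  -- the accuracy of the reward estimates needs `Fintype.card A ≤ T`
  rcases lt_or_ge T (Fintype.card A) with hA | hA
  · refine htriv ?_
    have cTA : (T : ℝ) ≤ Fintype.card A := by exact_mod_cast hA.le
    have h1 : (T : ℝ) ≤ √((T : ℝ) * Fintype.card A * Fintype.card Ω * l) := by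
      refine Real.le_sqrt_of_sq_le ?_
      calc (T : ℝ) ^ 2 = T * T * 1 * 1 := by ring
        _ ≤ _ := by gcongr
    have h2 : (L : ℝ) ≤ (L : ℝ) ^ 2 * Fintype.card X := by
      calc (L : ℝ) = L * 1 * 1 := by ring
        _ ≤ L * L * Fintype.card X := by gcongr
        _ = _ := by ring
    have h3 : (T : ℝ) * L ≤ √((T : ℝ) * Fintype.card A * Fintype.card Ω * l) *
        ((L : ℝ) ^ 2 * Fintype.card X) :=
      mul_le_mul h1 h2 (by positivity) (by positivity)
    rw [hB]
    nlinarith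
  have hacc := M.interactionLaw_not_accurate alg hT hA hδ hδ'
  have hazu := M.interactionLaw_meanBonus alg hT hL hδ (by linarith)
  have hcover : (Set.univ : Set (Fin T → Episode X Ω A L)) ⊆ {w | M.violation alg T w ≤ B} ∪
      ({w | ¬ ∀ n : Fin T, M.Accurate T δ (historyBefore w n)} ∪
        {w | 18 * (L : ℝ) ^ 2 * √(T * Real.log (1 / δ) / 2) ≤
          ∑ t, (M.meanBonus alg T δ w t - bonus S T δ (historyBefore w t) (w t).1)}) := by
    intro w _
    by_contra hcon
    simp only [Set.mem_union, Set.mem_ofPred_eq, not_or, not_not, not_le] at hcon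
    obtain ⟨h1, h2, h3⟩ := hcon
    refine absurd ?_ (not_le.2 h1)
    rw [Finset.sum_sub_distrib] at h3
    have h4 := M.violation_le_sum_meanBonus halg h2
    have h5 := sum_bonus_le (S := S) w (by linarith : 0 ≤ l)
    have hlog : ∀ K K' : ℝ, 1 ≤ K → K ≤ K' → Real.log (K / δ) ≤ Real.log (K' / δ) := by
      intro K K' h h'
      exact Real.log_le_log (by positivity) (by gcongr)
    have hTX : (1 : ℝ) ≤ (T : ℝ) * Fintype.card X := one_le_mul_of_one_le_of_one_le cT cX
    have hTXO : (1 : ℝ) ≤ (T : ℝ) * Fintype.card X * Fintype.card Ω :=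
      one_le_mul_of_one_le_of_one_le hTX cO
    have l1 : Real.log (3 * (T : ℝ) * Fintype.card X * Fintype.card Ω / δ) ≤ 2 * l := by
      have e1 : 3 * (T : ℝ) * Fintype.card X * Fintype.card Ω / δ =
          3 * ((T : ℝ) * Fintype.card X * Fintype.card Ω / δ) := by ring
      rw [e1, Real.log_mul (by norm_num) (by positivity)]
      have e2 := hlog _ _ hTXO (le_mul_of_one_le_right (by linarith) cA)
      have e3 : Real.log 3 ≤ l := by
        refine Real.log_le_log (by norm_num) ?_
        linarith [hdiv _ hKA]
      linarith
    have l2 : Real.log ((T : ℝ) * Fintype.card X / δ) ≤ l := by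
      refine hlog _ _ hTX ?_
      rw [mul_assoc ((T : ℝ) * _)]
      exact le_mul_of_one_le_right (by linarith) (one_le_mul_of_one_le_of_one_le cO cA)
    have l3 : Real.log (1 / δ) ≤ l := hlog _ _ le_rfl hKA
    have h6 := rate_bound cX cO cA cL (by linarith : (0 : ℝ) ≤ T) (by linarith : 0 ≤ l) l1 l2 l3
    linarith
  have h1 := measureReal_mono (μ := M.interactionLaw alg T) hcover (measure_ne_top _ _)
  rw [probReal_univ] at h1
  -- the two exceptional events have probability at most `5 * δ` and `δ`
  have h2 := h1.trans ((measureReal_union_le _ _).trans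
    (add_le_add_right (measureReal_union_le _ _) _))
  linarith

end MPP

end Persuasion

theorem mainTheorem2 :
    ∃ C : ℝ, 0 < C ∧
      ∀ (X Ω A : Type*) [Fintype X] [Fintype Ω] [Fintype A] [Nonempty A] (L T : ℕ)
        (S : Persuasion.Layers X L) (M : Persuasion.MPP S Ω A) (δ : ℝ), 0 < δ → δ < 1 →
        ∀ alg : Persuasion.Algorithm X Ω A L, alg.IsOPPS S T δ →
          1 - 7 * δ ≤ (M.interactionLaw alg T).real
            {w | M.violation alg T w ≤
              C * ((L : ℝ) ^ 2 * Fintype.card X *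
                √((T : ℝ) * Fintype.card A * Fintype.card Ω *
                  Real.log ((T : ℝ) * Fintype.card X * Fintype.card Ω * Fintype.card A / δ)))} ∧
          1 - 7 * δ ≤ (M.interactionLaw alg T).real
            {w | M.violation alg T w ≤
              C * ((L : ℝ) ^ 2 * Fintype.card X *
                √((T : ℝ) * Fintype.card A * Fintype.card Ω * Real.log (1 / δ)) *
                √(1 + Real.log ((T : ℝ) * Fintype.card X * Fintype.card Ω * Fintype.card A)))} := by
  refine ⟨126, by norm_num, ?_⟩
  intro X Ω A _ _ _ _ L T S M δ hδ hδ1 alg halg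
  -- for `1 / 7 ≤ δ` nothing is claimed; below, `1 / δ ≥ 7` makes all logarithms at least `1`
  rcases le_or_gt (1 / 7) δ with h7 | h7
  · have h0 : 1 - 7 * δ ≤ 0 := by linarith
    exact ⟨h0.trans measureReal_nonneg, h0.trans measureReal_nonneg⟩
  have hmain := M.interactionLaw_violation_le hδ h7 halg
  refine ⟨hmain, hmain.trans (measureReal_mono (fun w hw => ?_) (measure_ne_top _ _))⟩
  rw [Set.mem_ofPred_eq] at hw ⊢
  refine hw.trans ?_
  rcases Nat.eq_zero_or_pos T with hT | hT
  · simp [hT]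
  have hΩ : Nonempty Ω := M.nonempty_outcome
  have hX : Nonempty X := ⟨S.init⟩
  have cT : (1 : ℝ) ≤ T := by exact_mod_cast hT
  have cX : (1 : ℝ) ≤ Fintype.card X := by exact_mod_cast Fintype.card_pos
  have cO : (1 : ℝ) ≤ Fintype.card Ω := by exact_mod_cast Fintype.card_pos
  have cA : (1 : ℝ) ≤ Fintype.card A := by exact_mod_cast Fintype.card_pos
  have hK : (1 : ℝ) ≤ (T : ℝ) * Fintype.card X * Fintype.card Ω * Fintype.card A :=
    one_le_mul_of_one_le_of_one_le (one_le_mul_of_one_le_of_one_le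
      (one_le_mul_of_one_le_of_one_le cT cX) cO) cA
  set K := (T : ℝ) * Fintype.card X * Fintype.card Ω * Fintype.card A with hKdef
  have hK0 : 0 ≤ Real.log K := Real.log_nonneg hK
  have hlam : 1 ≤ Real.log (1 / δ) := by
    refine Persuasion.MPP.one_le_log_of_seven_le ?_
    rw [le_div_iff₀ hδ]
    linarith
  -- `log (K / δ) = log K + log (1 / δ) ≤ log (1 / δ) (1 + log K)`
  have hlog : Real.log (K / δ) ≤ Real.log (1 / δ) * (1 + Real.log K) := by
    rw [div_eq_mul_one_div, Real.log_mul (by positivity) (by positivity)]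
    nlinarith
  rw [mul_assoc ((L : ℝ) ^ 2 * _), ← Real.sqrt_mul (by positivity), mul_assoc _ (Real.log (1 / δ))]
  gcongr
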